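/- Fix $m\ge 1$, let $\mu_m\subset\mathbb C^*$ be the group of $m$-th roots of unity, and let $\mathfrak S_n(\mu_m)=\mu_m^n\rtimes\mathfrak S_n$, embedded in $\mathrm{GL}_n(\mathbb C)$ as the group of monomial matrices whose nonzero entries lie in $\mu_m$ ($n\ge 0$). Notation. For a partition $\lambda$ let $m_r(\lambda)$ be the number of parts equal to $r$, $\ell(\lambda)$ the number of parts, and $z_\lambda=\prod_{r\ge1}m_r(\lambda)!\,r^{m_r(\lambda)}$. Let $\Phi$ be the set of functions $\rho$ from $\mu_m$ to partitions, and put $|\rho|=\sum_\zeta|\rho(\zeta)|$ and $Z_\rho=\prod_\zeta z_{\rho(\zeta)}m^{\ell(\rho(\zeta))}$. For $\rho\in\Phi$ with $|\rho|=n$ let $C_\rho\subset\mathfrak S_n(\mu_m)$ be the class of those $(a_1,\dots,a_n;\sigma)$ for which, for all $\zeta\in\mu_m$ and $l\ge1$, exactly $m_l(\rho(\zeta))$ cycles $c$ of $\sigma$ of length $l$ have cycle product $\prod_{i\in c}a_i=\zeta$. Let $\Lambda$ be the ring of symmetric functions over $\mathbb C$, with power sums $p_\lambda$, complete functions $h_n$,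 Schur functions $s_\lambda$, and the bilinear Hall pairing $\langle p_\lambda,p_\mu\rangle=z_\lambda\delta_{\lambda\mu}$. This pairing is extended to $\langle K,f\rangle_Y$ for $f\in\Lambda$ and a formal series $K$ that is symmetric in the variables $Y=(y_1,y_2,\dots)$, degree by degree in $Y$ and coefficientwise in the other variables. For a formal series $A=\sum_\alpha c_\alpha t^\alpha$ let $f\mapsto f(A)$ be the $\mathbb C$-algebra homomorphism on $\Lambda$ with $p_n\mapsto p_n(A)=\sum_\alpha c_\alpha t^{n\alpha}$ for $n\ge 1$, and let $\Omega(A)=\sum_{n\ge0}h_n(A)$; put $\Omega(Y;\zeta)=\prod_{i\ge1}(1-\zeta y_i)^{-1}$. For $\zeta\in\mu_m$ let $X_\zeta=x_{\zeta,1}+x_{\zeta,2}+\cdots$ be a set of variables, let $\mathfrak X=(X_\zeta)_{\zeta\in\mu_m}$, and let $P_\rho(\mathfrak X)=\prod_\zeta p_{\rho(\zeta)}(X_\zeta)$. Proposition. Every class $C_\rho$ is nonempty, and the multiset $\Xi_\rho$ of eigenvalues (roots of the characteristic polynomial) of $\gamma\in C_\rho$ does not depend on the choice of $\gamma$. For every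 partition $\lambda$ the formal series $$F_\lambda(\mathfrak X)=\sum_{\rho\in\Phi}\frac{s_\lambda(\Xi_\rho)}{Z_\rho}P_\rho(\mathfrak X)\qquad\text{and}\qquad \Omega\Big(\frac1m\sum_{\zeta\in\mu_m}X_\zeta\,\Omega(Y;\zeta)\Big)$$ converge, the second is symmetric in $Y$, and $$F_\lambda(\mathfrak X)=\Big\langle \Omega\Big(\frac1m\sum_{\zeta\in\mu_m}X_\zeta\,\Omega(Y;\zeta)\Big),\ s_\lambda(Y)\Big\rangle_Y .$$ Moreover, for every $n\ge\ell(\lambda)$ the homogeneous component of degree $n$ of $F_\lambda$ is the Frobenius characteristic $\sum_{|\rho|=n}\frac{\chi(C_\rho)}{Z_\rho}P_\rho(\mathfrak X)$ of $\mathrm{Res}^{\mathrm{GL}_n(\mathbb C)}_{\mathfrak S_n(\mu_m)}V^\lambda$, where $\chi$ is the character of this restriction and $V^\lambda$ is the irreducible representation of $\mathrm{GL}_n(\mathbb C)$ with highest weight $\lambda$. -/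

import Mathlib

open scoped MvPowerSeries.WithPiTopology

noncomputable section

namespace WreathSym

/-- The set of all integer partitions. -/
abbrev Par : Type := Σ n : ℕ, n.Partition

namespace Par

/-- The parts `λ₁, λ₂, …` as a multiset of positive integers. -/
def parts (lam : Par) : Multiset ℕ := lam.2.parts

/-- `|λ|`. -/
def size (lam : Par) : ℕ := lam.1

/-- `ℓ(λ)`. -/
def length (lam : Par) : ℕ := lam.parts.card

/-- `m_r(λ)`. -/
def mult (lam : Par) (r : ℕ) : ℕ := lam.parts.count r

/-- `z_λ = ∏_r m_r(λ)! r^{m_r(λ)}`. -/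
def z (lam : Par) : ℕ :=
  ∏ r ∈ lam.parts.toFinset, (lam.mult r).factorial * r ^ lam.mult r

/-- The Young diagram whose row lengths are the parts of `λ` in decreasing order. -/
def diagram (lam : Par) : YoungDiagram :=
  YoungDiagram.ofRowLens (lam.parts.sort (· ≥ ·)) (lam.parts.pairwise_sort (· ≥ ·)).sortedGE

/-- The partition with a given multiset of positive parts. -/
def mk' (s : Multiset ℕ) (hs : ∀ i ∈ s, 0 < i) : Par := ⟨s.sum, ⟨s, fun {i} h => hs i h, rfl⟩⟩

theorem parts_mk' (s : Multiset ℕ) (hs : ∀ i ∈ s, 0 < i) : (mk' s hs).parts = s := rfl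

theorem pos (lam : Par) {i : ℕ} (h : i ∈ lam.parts) : 0 < i := lam.2.parts_pos h

theorem parts_injective : Function.Injective parts := by
  rintro ⟨n, p⟩ ⟨k, q⟩ h
  have h' : p.parts = q.parts := h
  have : n = k := by rw [← p.parts_sum, ← q.parts_sum, h']
  subst this
  rw [Nat.Partition.ext h']

end Par

/-! ### The ring of symmetric functions -/

/-- The formal power series `∑_a c_a x^a`. -/
def series {σ : Type*} (c : (σ →₀ ℕ) → ℂ) : MvPowerSeries σ ℂ := c

theorem coeff_series {σ : Type*} (c : (σ →₀ ℕ) → ℂ) (a : σ →₀ ℕ) :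
    MvPowerSeries.coeff a (series c) = c a := rfl

/-- A power series in `x₀, x₁, …` is symmetric if it is invariant under all permutations of the
variables. -/
def IsSymm (f : MvPowerSeries ℕ ℂ) : Prop :=
  ∀ e : Equiv.Perm ℕ, MvPowerSeries.rename e f = f

/-- A power series has bounded degree. -/
def IsBounded (f : MvPowerSeries ℕ ℂ) : Prop :=
  ∃ d : ℕ, ∀ a : ℕ →₀ ℕ, d < a.degree → MvPowerSeries.coeff a f = 0

/-- The ring `Λ` of symmetric functions over `ℂ`: symmetric power series of bounded degree. -/
def SymmFun : Subalgebra ℂ (MvPowerSeries ℕ ℂ) where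
  carrier := {f | IsSymm f ∧ IsBounded f}
  mul_mem' := by
    rintro f g ⟨hf, d, hd⟩ ⟨hg, k, hk⟩
    refine ⟨fun e => by rw [map_mul, hf e, hg e], d + k, fun a ha => ?_⟩
    rw [MvPowerSeries.coeff_mul]
    refine Finset.sum_eq_zero fun p hp => ?_
    have h := congrArg Finsupp.degree (Finset.HasAntidiagonal.mem_antidiagonal.mp hp)
    rw [map_add] at h
    rcases lt_or_ge d p.1.degree with h1 | h1
    · rw [hd _ h1, zero_mul]
    · rw [hk _ (by omega), mul_zero]
  add_mem' := by
    rintro f g ⟨hf, d, hd⟩ ⟨hg, k, hk⟩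
    refine ⟨fun e => by rw [map_add, hf e, hg e], d + k, fun a ha => ?_⟩
    rw [map_add, hd a (by omega), hk a (by omega), add_zero]
  algebraMap_mem' := by
    intro c
    refine ⟨fun e => AlgHom.commutes _ c, 0, fun a ha => ?_⟩
    have : a ≠ 0 := by rintro rfl; simp at ha
    classical
    rw [MvPowerSeries.algebraMap_apply, MvPowerSeries.coeff_C, if_neg this]

theorem isSymm_iff (f : MvPowerSeries ℕ ℂ) :
    IsSymm f ↔ ∀ (e : Equiv.Perm ℕ) (a : ℕ →₀ ℕ),
      MvPowerSeries.coeff (a.mapDomain e) f = MvPowerSeries.coeff a f := by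
  have key : ∀ (e : Equiv.Perm ℕ) (a : ℕ →₀ ℕ) (g : MvPowerSeries ℕ ℂ),
      MvPowerSeries.coeff (a.mapDomain e) (MvPowerSeries.rename e g) =
        MvPowerSeries.coeff a g := by
    intro e a g
    have := MvPowerSeries.coeff_embDomain_rename e.toEmbedding g a
    rwa [Finsupp.embDomain_eq_mapDomain] at this
  constructor
  · intro h e a
    conv_lhs => rw [← h e]
    exact key e a f
  · intro h e
    ext b
    obtain ⟨a, rfl⟩ : ∃ a : ℕ →₀ ℕ, a.mapDomain e = b := by
      refine ⟨b.mapDomain e.symm, ?_⟩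
      rw [← Finsupp.mapDomain_comp]
      simp
    rw [key, h]

/-- The power sum `p_r = ∑_i (x_i)^r` of a family of elements. -/
def powerSum {σ ι : Type*} (x : ι → MvPowerSeries σ ℂ) (r : ℕ) : MvPowerSeries σ ℂ :=
  ∑' i, x i ^ r

open Classical in
theorem coeff_powerSum_X {r : ℕ} (hr : 0 < r) (a : ℕ →₀ ℕ) :
    MvPowerSeries.coeff a (powerSum (fun i : ℕ => MvPowerSeries.X (R := ℂ) i) r) =
      if ∃ i, a = Finsupp.single i r then 1 else 0 := by
  have hs : HasSum (fun i : ℕ => (MvPowerSeries.X i : MvPowerSeries ℕ ℂ) ^ r)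
      (series fun a => if ∃ i, a = Finsupp.single i r then 1 else 0) := by
    rw [MvPowerSeries.WithPiTopology.hasSum_iff_hasSum_coeff]
    intro d
    simp only [MvPowerSeries.coeff_X_pow, coeff_series]
    by_cases h : ∃ i, d = Finsupp.single i r
    · obtain ⟨i, rfl⟩ := h
      rw [if_pos ⟨i, rfl⟩]
      have he : (fun j => if Finsupp.single i r = Finsupp.single j r then (1 : ℂ) else 0) =
          fun j => if j = i then 1 else 0 := by
        funext j
        simp only [Finsupp.single_left_inj hr.ne', eq_comm]
      rw [he]
      exact hasSum_ite_eq i (1 : ℂ)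
    · rw [if_neg h]
      push Not at h
      simp only [h, if_false]
      exact hasSum_zero
  rw [powerSum, hs.tsum_eq, coeff_series]

theorem powerSum_X_mem {r : ℕ} (hr : 0 < r) :
    powerSum (fun i : ℕ => MvPowerSeries.X (R := ℂ) i) r ∈ SymmFun := by
  classical
  refine ⟨(isSymm_iff _).2 fun e a => ?_, r, fun a ha => ?_⟩
  · rw [coeff_powerSum_X hr, coeff_powerSum_X hr]
    congr 1
    refine propext ⟨?_, ?_⟩
    · rintro ⟨i, hi⟩
      refine ⟨e.symm i, Finsupp.mapDomain_injective e.injective ?_⟩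
      simp [hi]
    · rintro ⟨i, rfl⟩
      exact ⟨e i, by simp⟩
  · rw [coeff_powerSum_X hr, if_neg]
    rintro ⟨i, rfl⟩
    simp at ha

/-- `p_λ(x) = ∏_i p_{λ_i}(x)`. -/
def powerSumPar {σ ι : Type*} (x : ι → MvPowerSeries σ ℂ) (lam : Par) : MvPowerSeries σ ℂ :=
  (lam.parts.map (powerSum x)).prod

theorem powerSumPar_X_mem (lam : Par) :
    powerSumPar (fun i : ℕ => MvPowerSeries.X (R := ℂ) i) lam ∈ SymmFun := by
  refine Subalgebra.multiset_prod_mem _ fun f hf => ?_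
  obtain ⟨r, hr, rfl⟩ := Multiset.mem_map.1 hf
  exact powerSum_X_mem (lam.pos hr)

/-- The power sum symmetric function `p_λ ∈ Λ`. -/
def pSym (lam : Par) : SymmFun := ⟨_, powerSumPar_X_mem lam⟩

/-- The complete homogeneous symmetric function `h_n ∈ Λ`, the sum of all monomials of
degree `n`. -/
def hSym (n : ℕ) : SymmFun :=
  ⟨series fun a => if a.degree = n then 1 else 0, (isSymm_iff _).2 fun e a => by
    rw [coeff_series, coeff_series, Finsupp.degree_mapDomain], n, fun a ha => by
    rw [coeff_series, if_neg (by omega)]⟩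

/-! ### The power sums form a basis -/

/-- The multiset of nonzero exponents of a monomial. -/
def shape (a : ℕ →₀ ℕ) : Multiset ℕ := a.support.val.map a

theorem shape_pos (a : ℕ →₀ ℕ) : ∀ i ∈ shape a, 0 < i := by
  intro i hi
  obtain ⟨j, hj, rfl⟩ := Multiset.mem_map.1 hi
  exact Nat.pos_of_ne_zero (Finsupp.mem_support_iff.1 hj)

theorem card_shape (a : ℕ →₀ ℕ) : (shape a).card = a.support.card := by
  simp [shape]

theorem sum_shape (a : ℕ →₀ ℕ) : (shape a).sum = a.degree := rfl

theorem shape_single_add {i r : ℕ} (hr : 0 < r) {a : ℕ →₀ ℕ} (hi : i ∉ a.support) :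
    shape (Finsupp.single i r + a) = r ::ₘ shape a := by
  have hd : Disjoint (Finsupp.single i r).support a.support := by
    rw [Finsupp.support_single _ hr.ne']
    simpa using hi
  have hs : (Finsupp.single i r + a).support = insert i a.support := by
    rw [Finsupp.support_add_eq hd, Finsupp.support_single _ hr.ne', Finset.insert_eq]
  rw [shape, hs, Finset.insert_val_of_notMem hi, Multiset.map_cons]
  congr 1
  · simp [Finsupp.notMem_support_iff.1 hi]
  · refine Multiset.map_congr rfl fun j hj => ?_
    have : i ≠ j := by rintro rfl; exact hi hj
    simp [this]

theorem exists_shape (s : Multiset ℕ) (hs : ∀ i ∈ s, 0 < i) : ∃ a, shape a = s := by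
  induction s using Multiset.induction with
  | empty => exact ⟨0, by simp [shape]⟩
  | cons r s ih =>
    obtain ⟨a, ha⟩ := ih fun i hi => hs i (Multiset.mem_cons_of_mem hi)
    obtain ⟨i, hi⟩ := Infinite.exists_notMem_finset a.support
    exact ⟨Finsupp.single i r + a, by
      rw [shape_single_add (hs r (Multiset.mem_cons_self r s)) hi, ha]⟩

theorem exists_perm_of_shape_eq {a b : ℕ →₀ ℕ} (hab : shape a = shape b) :
    ∃ e : Equiv.Perm ℕ, a.mapDomain e = b := by
  obtain ⟨f, hf⟩ : ∃ f : a.support ≃ b.support, ∀ x, b (f x) = a x := by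
    have hc : ∀ r, Fintype.card {x : a.support // a x = r} =
        Fintype.card {x : b.support // b x = r} := by
      intro r
      have := congrArg (Multiset.count r) hab
      rw [shape, shape, Multiset.count_map, Multiset.count_map] at this
      have h1 : ∀ c : ℕ →₀ ℕ, Fintype.card {x : c.support // c x = r} =
          (c.support.val.filter fun x => r = c x).card := by
        intro c
        rw [Fintype.card_subtype]
        rw [← Finset.card_map (Function.Embedding.subtype _)]
        change _ = (c.support.filter fun x => r = c x).card
        congr 1
        ext x
        simp [eq_comm, and_comm]

      rw [h1, h1, this]
    have g := fun r => Fintype.card_eq.1 (hc r)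
    replace g := fun r => Classical.choice (g r)
    refine ⟨(Equiv.sigmaFiberEquiv fun x : a.support => a x).symm.trans
      ((Equiv.sigmaCongrRight fun r => (g r)).trans
        (Equiv.sigmaFiberEquiv fun x : b.support => b x)), fun x => ?_⟩
    simp [Equiv.sigmaFiberEquiv]
    exact (g (a x) ⟨x, rfl⟩).2
  obtain ⟨e, he⟩ := Cardinal.extend_function_of_lt (s := (a.support : Set ℕ))
    (f.toEmbedding.trans (Function.Embedding.subtype _))
    (lt_of_lt_of_le (Cardinal.lt_aleph0_of_finite _) (Cardinal.aleph0_le_mk ℕ)) ⟨Equiv.refl ℕ⟩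
  refine ⟨e, Finsupp.ext fun y => ?_⟩
  obtain ⟨x, rfl⟩ := e.surjective y
  rw [Finsupp.mapDomain_apply e.injective]
  by_cases hx : x ∈ a.support
  · have := he ⟨x, hx⟩
    rw [this]
    exact (hf ⟨x, hx⟩).symm
  · rw [Finsupp.notMem_support_iff.1 hx]
    by_contra hne
    have hy : e x ∈ b.support := Finsupp.mem_support_iff.2 fun h => hne h.symm
    have h2 := he (f.symm ⟨e x, hy⟩)
    have h3 : e (f.symm ⟨e x, hy⟩ : a.support) = e x := by rw [h2]; simp
    exact hx (e.injective h3 ▸ (f.symm ⟨e x, hy⟩).2)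

theorem coeff_eq_of_shape_eq {f : MvPowerSeries ℕ ℂ} (hf : IsSymm f) {a b : ℕ →₀ ℕ}
    (hab : shape a = shape b) : MvPowerSeries.coeff a f = MvPowerSeries.coeff b f := by
  obtain ⟨e, rfl⟩ := exists_perm_of_shape_eq hab
  exact ((isSymm_iff f).1 hf e a).symm

/-- `a` is the exponent of a monomial occurring in the product of the power sums `p_r`, `r ∈ s`. -/
def Rep (s : Multiset ℕ) (a : ℕ →₀ ℕ) : Prop :=
  ∃ t : Multiset (ℕ × ℕ), t.map Prod.snd = s ∧
    (t.map fun q => Finsupp.single q.1 q.2).sum = a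

theorem rep_shape (a : ℕ →₀ ℕ) : Rep (shape a) a := by
  refine ⟨a.support.val.map fun i => (i, a i), ?_, ?_⟩
  · simp [shape]
  · rw [Multiset.map_map]
    exact Finsupp.sum_single a

theorem card_support_of_rep (t : Multiset (ℕ × ℕ)) (ht : ∀ q ∈ t, 0 < q.2) :
    (t.map fun q => Finsupp.single q.1 q.2).sum.support.card ≤ t.card ∧
    ((t.map fun q => Finsupp.single q.1 q.2).sum.support.card = t.card →
      shape (t.map fun q => Finsupp.single q.1 q.2).sum = t.map Prod.snd) := by
  induction t using Multiset.induction with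
  | empty => simp [shape]
  | cons q t ih =>
    obtain ⟨i1, i2⟩ := ih fun q hq => ht q (Multiset.mem_cons_of_mem hq)
    have hq := ht q (Multiset.mem_cons_self q t)
    rw [Multiset.map_cons, Multiset.sum_cons, Multiset.card_cons, Multiset.map_cons]
    set a := (t.map fun q => Finsupp.single q.1 q.2).sum
    by_cases hm : q.1 ∈ a.support
    · have : (Finsupp.single q.1 q.2 + a).support ⊆ a.support := by
        refine Finsupp.support_add.trans (Finset.union_subset ?_ subset_rfl)
        exact Finsupp.support_single_subset.trans (by simpa using hm)
      have := Finset.card_le_card this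
      exact ⟨by omega, fun h => by omega⟩
    · have hsh := shape_single_add hq hm
      have hc := congrArg Multiset.card hsh
      rw [card_shape, Multiset.card_cons, card_shape] at hc
      exact ⟨by omega, fun h => by rw [hsh, i2 (by omega)]⟩

theorem exists_coeff_prod (s : Multiset ℕ) (hs : ∀ i ∈ s, 0 < i) :
    ∃ c : (ℕ →₀ ℕ) → ℕ, ∀ a, MvPowerSeries.coeff a
      (s.map (powerSum fun i : ℕ => MvPowerSeries.X (R := ℂ) i)).prod = c a ∧
      (c a ≠ 0 ↔ Rep s a) := by
  classical
  induction s using Multiset.induction with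
  | empty =>
    refine ⟨fun a => if a = 0 then 1 else 0, fun a => ⟨?_, ?_⟩⟩
    · simp [MvPowerSeries.coeff_one]
    · by_cases ha : a = 0
      · simp [ha]; exact ⟨0, by simp⟩
      · simp only [ha, if_false]
        refine ⟨fun h => absurd rfl h, ?_⟩
        rintro ⟨t, ht, h2⟩
        rw [Multiset.map_eq_zero] at ht
        subst ht
        exact absurd h2.symm ha
  | cons r s ih =>
    obtain ⟨c, hc⟩ := ih fun i hi => hs i (Multiset.mem_cons_of_mem hi)
    have hr := hs r (Multiset.mem_cons_self r s)
    refine ⟨fun a => ∑ x ∈ Finset.HasAntidiagonal.antidiagonal a,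
      (if ∃ i, x.1 = Finsupp.single i r then 1 else 0) * c x.2, fun a => ⟨?_, ?_⟩⟩
    · rw [Multiset.map_cons, Multiset.prod_cons, MvPowerSeries.coeff_mul]
      push_cast
      refine Finset.sum_congr rfl fun x _ => ?_
      rw [coeff_powerSum_X hr, (hc x.2).1]
    · rw [Ne, Finset.sum_eq_zero_iff, not_forall]
      simp only [Classical.not_imp]
      constructor
      · rintro ⟨x, hx, h2⟩
        have h3 := right_ne_zero_of_mul h2
        obtain ⟨i, hi⟩ : ∃ i, x.1 = Finsupp.single i r := by
          by_contra hne
          simp [hne] at h2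
        obtain ⟨t, ht, hta⟩ := ((hc x.2).2).1 h3
        refine ⟨(i, r) ::ₘ t, by simp [ht], ?_⟩
        rw [Multiset.map_cons, Multiset.sum_cons, hta, ← hi]
        exact Finset.HasAntidiagonal.mem_antidiagonal.1 hx
      · rintro ⟨t, ht, hta⟩
        obtain ⟨q, hq, hqr⟩ : ∃ q ∈ t, q.2 = r := by
          have : r ∈ t.map Prod.snd := ht ▸ Multiset.mem_cons_self r s
          simpa using this
        obtain ⟨t', rfl⟩ := Multiset.exists_cons_of_mem hq
        rw [Multiset.map_cons, hqr, Multiset.cons_inj_right] at ht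
        rw [Multiset.map_cons, Multiset.sum_cons, hqr] at hta
        refine ⟨(Finsupp.single q.1 r, (t'.map fun q => Finsupp.single q.1 q.2).sum),
          Finset.HasAntidiagonal.mem_antidiagonal.2 hta, ?_⟩
        rw [if_pos ⟨q.1, rfl⟩, one_mul]
        exact ((hc _).2).2 ⟨t', ht, rfl⟩

theorem coeff_p_shape_ne_zero (lam : Par) {a : ℕ →₀ ℕ} (ha : shape a = lam.parts) :
    MvPowerSeries.coeff a (pSym lam : MvPowerSeries ℕ ℂ) ≠ 0 := by
  obtain ⟨c, hc⟩ := exists_coeff_prod lam.parts fun i hi => lam.pos hi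
  change MvPowerSeries.coeff a (lam.parts.map (powerSum _)).prod ≠ 0
  rw [(hc a).1, Nat.cast_ne_zero, (hc a).2, ← ha]
  exact rep_shape a

theorem coeff_p_ne_zero (lam : Par) {a : ℕ →₀ ℕ}
    (ha : MvPowerSeries.coeff a (pSym lam : MvPowerSeries ℕ ℂ) ≠ 0) :
    a.degree = lam.size ∧ a.support.card ≤ lam.length ∧
      (a.support.card = lam.length → shape a = lam.parts) := by
  obtain ⟨c, hc⟩ := exists_coeff_prod lam.parts fun i hi => lam.pos hi
  change MvPowerSeries.coeff a (lam.parts.map (powerSum _)).prod ≠ 0 at ha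
  rw [(hc a).1, Nat.cast_ne_zero, (hc a).2] at ha
  obtain ⟨t, ht, rfl⟩ := ha
  have hpos : ∀ q ∈ t, 0 < q.2 := fun q hq =>
    lam.pos (ht ▸ Multiset.mem_map_of_mem Prod.snd hq)
  have h := card_support_of_rep t hpos
  have hl : lam.length = t.card := by rw [Par.length, ← ht, Multiset.card_map]
  refine ⟨?_, ?_⟩
  · rw [Par.size, ← lam.2.parts_sum, map_multiset_sum, Multiset.map_map]
    change _ = lam.parts.sum
    rw [← ht]
    simp
  · rw [hl, ← ht]
    exact h

theorem linearIndependent_p : LinearIndependent ℂ pSym := by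
  rw [linearIndependent_iff]
  intro l hl
  by_contra hne
  obtain ⟨lam, hlam, hmax⟩ := Finset.exists_max_image l.support Par.length
    (Finsupp.support_nonempty_iff.2 hne)
  obtain ⟨a, ha⟩ := exists_shape lam.parts fun i hi => lam.pos hi
  have hcard : a.support.card = lam.length := by rw [← card_shape, ha]; rfl
  have h0 := congrArg (fun f : SymmFun => MvPowerSeries.coeff a (f : MvPowerSeries ℕ ℂ)) hl
  simp only [Finsupp.linearCombination_apply, Finsupp.sum, AddSubmonoidClass.coe_finsetSum,
    Subalgebra.coe_smul, map_sum, map_smul, ZeroMemClass.coe_zero, map_zero] at h0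
  rw [Finset.sum_eq_single lam] at h0
  · exact smul_ne_zero (Finsupp.mem_support_iff.1 hlam) (coeff_p_shape_ne_zero lam ha) h0
  · intro mu hmu hml
    by_contra hc
    obtain ⟨-, h1, h2⟩ := coeff_p_ne_zero mu (right_ne_zero_of_smul hc)
    have := hmax mu hmu
    exact hml (Par.parts_injective (by rw [← ha, h2 (by omega)]))
  · intro h; exact absurd hlam h

theorem mem_span_p (d L : ℕ) : ∀ f : SymmFun,
    (∀ a : ℕ →₀ ℕ, d < a.degree → MvPowerSeries.coeff a (f : MvPowerSeries ℕ ℂ) = 0) →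
    (∀ a : ℕ →₀ ℕ, MvPowerSeries.coeff a (f : MvPowerSeries ℕ ℂ) ≠ 0 → a.support.card < L) →
    f ∈ Submodule.span ℂ (Set.range pSym) := by
  classical
  induction L with
  | zero =>
    intro f _ hf
    have : f = 0 := by
      ext a
      by_contra h
      exact absurd (hf a h) (by omega)
    rw [this]
    exact Submodule.zero_mem _
  | succ L ih =>
    intro f hd hf
    choose mon hmon using fun lam : Par => exists_shape lam.parts fun i hi => lam.pos hi
    let S : Finset Par := ((Finset.range (d + 1)).sigma fun n =>
      (Finset.univ : Finset n.Partition)).filter fun lam => lam.length = L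
    let g : SymmFun := ∑ lam ∈ S, (MvPowerSeries.coeff (mon lam) (f : MvPowerSeries ℕ ℂ) /
      MvPowerSeries.coeff (mon lam) (pSym lam : MvPowerSeries ℕ ℂ)) • pSym lam
    have hS : ∀ lam : Par, lam ∈ S ↔ lam.size ≤ d ∧ lam.length = L := by
      intro lam
      simp [S, Par.size]
    have hg : g ∈ Submodule.span ℂ (Set.range pSym) :=
      Submodule.sum_mem _ fun lam _ =>
        Submodule.smul_mem _ _ (Submodule.subset_span ⟨lam, rfl⟩)
    have hgc : ∀ a : ℕ →₀ ℕ, MvPowerSeries.coeff a (g : MvPowerSeries ℕ ℂ) =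
        ∑ lam ∈ S, (MvPowerSeries.coeff (mon lam) (f : MvPowerSeries ℕ ℂ) /
          MvPowerSeries.coeff (mon lam) (pSym lam : MvPowerSeries ℕ ℂ)) *
          MvPowerSeries.coeff a (pSym lam : MvPowerSeries ℕ ℂ) := by
      intro a
      simp only [g, AddSubmonoidClass.coe_finsetSum, Subalgebra.coe_smul, map_sum, map_smul,
        smul_eq_mul]
    have hterm : ∀ a : ℕ →₀ ℕ, L ≤ a.support.card → ∀ lam ∈ S, lam.parts ≠ shape a →
        MvPowerSeries.coeff a (pSym lam : MvPowerSeries ℕ ℂ) = 0 := by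
      intro a ha lam hlam hne
      by_contra hc
      obtain ⟨-, h1, h2⟩ := coeff_p_ne_zero lam hc
      have := ((hS lam).1 hlam).2
      exact hne (h2 (by omega)).symm
    have hsize : ∀ lam : Par, lam.parts.sum = lam.size := fun lam => lam.2.parts_sum
    have hzero : ∀ a : ℕ →₀ ℕ, L ≤ a.support.card →
        MvPowerSeries.coeff a (f : MvPowerSeries ℕ ℂ) =
          MvPowerSeries.coeff a (g : MvPowerSeries ℕ ℂ) := by
      intro a ha
      rw [hgc]
      by_cases hin : a.degree ≤ d ∧ a.support.card = L
      · have hmS : Par.mk' (shape a) (shape_pos a) ∈ S :=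
          (hS _).2 ⟨hin.1, by rw [Par.length, Par.parts_mk', card_shape, hin.2]⟩
        rw [Finset.sum_eq_single_of_mem _ hmS]
        · set lam := Par.mk' (shape a) (shape_pos a)
          have hsh : shape (mon lam) = shape a := hmon lam
          rw [coeff_eq_of_shape_eq f.2.1 hsh, coeff_eq_of_shape_eq (pSym lam).2.1 hsh,
            div_mul_cancel₀ _ (coeff_p_shape_ne_zero lam rfl)]
        · intro mu hmu hne
          rw [hterm a ha mu hmu fun h => hne (Par.parts_injective h), mul_zero]
      · rw [Finset.sum_eq_zero]
        · by_contra hc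
          have h1 := hf a hc
          have h2 : a.degree ≤ d := by
            by_contra h3
            exact hc (hd a (by omega))
          exact hin ⟨h2, by omega⟩
        · intro lam hlam
          rw [hterm a ha lam hlam, mul_zero]
          intro hsh
          have h1 := (hS lam).1 hlam
          rw [← hsize lam, hsh, sum_shape, Par.length, hsh, card_shape] at h1
          exact hin h1
    have hfg : f - g ∈ Submodule.span ℂ (Set.range pSym) := by
      refine ih (f - g) (fun a ha => ?_) fun a hc => ?_
      · rw [Subalgebra.coe_sub, map_sub, hd a ha, hgc, Finset.sum_eq_zero, sub_zero]
        intro lam hlam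
        by_contra hc
        have h1 := (coeff_p_ne_zero lam (right_ne_zero_of_mul hc)).1
        have h2 := ((hS lam).1 hlam).1
        omega
      · by_contra h
        refine hc ?_
        rw [Subalgebra.coe_sub, map_sub, hzero a (by omega), sub_self]
    have := Submodule.add_mem _ hfg hg
    rwa [sub_add_cancel] at this

/-! ### Schur functions -/

/-- The content of a semistandard tableau: the exponent of the monomial `∏_c x_{T(c)}`. -/
def content {mu : YoungDiagram} (T : SemistandardYoungTableau mu) : ℕ →₀ ℕ :=
  ∑ c ∈ mu.cells, Finsupp.single (T c.1 c.2) 1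

namespace BenderKnuth

variable {mu : YoungDiagram} (T : SemistandardYoungTableau mu)

/-- The number of entries smaller than `v` in row `r`. -/
def num (r v : ℕ) : ℕ := ((Finset.range (mu.rowLen r)).filter fun j => T r j < v).card

theorem lt_num_iff {r v j : ℕ} (hj : j < mu.rowLen r) : T r j < v ↔ j < num T r v := by
  constructor
  · intro h
    have hsub : Finset.range (j + 1) ⊆
        (Finset.range (mu.rowLen r)).filter fun i => T r i < v := by
      intro i hi
      rw [Finset.mem_range] at hi
      rw [Finset.mem_filter, Finset.mem_range]
      exact ⟨by omega, lt_of_le_of_lt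
        (T.row_weak_of_le (by omega) (YoungDiagram.mem_iff_lt_rowLen.2 hj)) h⟩
    have := Finset.card_le_card hsub
    rw [Finset.card_range] at this
    exact this
  · intro h
    by_contra hc
    have hsub : ((Finset.range (mu.rowLen r)).filter fun i => T r i < v) ⊆ Finset.range j := by
      intro i hi
      rw [Finset.mem_filter, Finset.mem_range] at hi
      rw [Finset.mem_range]
      by_contra hij
      have := T.row_weak_of_le (show j ≤ i by omega) (YoungDiagram.mem_iff_lt_rowLen.2 hi.1)
      omega
    have := Finset.card_le_card hsub
    rw [Finset.card_range] at this
    exact absurd h (not_lt.2 this)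

theorem num_le_rowLen (r v : ℕ) : num T r v ≤ mu.rowLen r :=
  (Finset.card_filter_le _ _).trans (Finset.card_range _).le

theorem num_mono (r : ℕ) {v w : ℕ} (h : v ≤ w) : num T r v ≤ num T r w :=
  Finset.card_le_card fun i hi => by
    rw [Finset.mem_filter] at hi ⊢
    exact ⟨hi.1, by omega⟩

theorem num_succ_le (r v : ℕ) : num T (r + 1) (v + 1) ≤ num T r v := by
  by_contra hc
  push Not at hc
  have hj : num T r v < mu.rowLen (r + 1) := hc.trans_le (num_le_rowLen T _ _)
  have h1 := (lt_num_iff T hj).2 hc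
  have h2 := T.col_strict (lt_add_one r) (YoungDiagram.mem_iff_lt_rowLen.2 hj)
  have hj' : num T r v < mu.rowLen r := hj.trans_le (mu.rowLen_anti r (r + 1) (Nat.le_succ r))
  have h3 := (lt_num_iff T (v := v) hj').1 (by omega)
  omega

/-- A number characterised by the thresholds of row `r`. -/
theorem num_eq_of (r v N : ℕ) (hN : N ≤ mu.rowLen r)
    (h : ∀ j < mu.rowLen r, T r j < v ↔ j < N) : num T r v = N := by
  rw [num]
  conv_rhs => rw [← Finset.card_range N]
  congr 1
  ext j
  rw [Finset.mem_filter, Finset.mem_range, Finset.mem_range]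
  constructor
  · rintro ⟨h1, h2⟩
    exact (h j h1).1 h2
  · intro h1
    exact ⟨by omega, (h j (by omega)).2 h1⟩

variable (k : ℕ)

/-- Lower bound for the number of entries at most `k` in row `r`. -/
def lo (r : ℕ) : ℕ := max (num T r k) (num T (r + 1) (k + 2))

/-- Upper bound for the number of entries at most `k` in row `r`. -/
def hi : ℕ → ℕ
  | 0 => num T 0 (k + 2)
  | r + 1 => min (num T (r + 1) (k + 2)) (num T r k)

/-- The reflected number of entries at most `k` in row `r`. -/
def mid (r : ℕ) : ℕ := lo T k r + hi T k r - num T r (k + 1)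

theorem lo_le (r : ℕ) : lo T k r ≤ num T r (k + 1) :=
  max_le (num_mono T r (by omega)) (num_succ_le T r (k + 1))

theorem le_hi (r : ℕ) : num T r (k + 1) ≤ hi T k r := by
  cases r with
  | zero => exact num_mono T 0 (by omega)
  | succ r => exact le_min (num_mono T _ (by omega)) (num_succ_le T r k)

theorem lo_le_mid (r : ℕ) : lo T k r ≤ mid T k r := by
  have := le_hi T k r
  have := lo_le T k r
  rw [mid]; omega

theorem mid_le_hi (r : ℕ) : mid T k r ≤ hi T k r := by
  have := le_hi T k r
  have := lo_le T k r
  rw [mid]; omega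

theorem le_mid (r : ℕ) : num T r k ≤ mid T k r := (le_max_left _ _).trans (lo_le_mid T k r)

theorem mid_le (r : ℕ) : mid T k r ≤ num T r (k + 2) := by
  refine (mid_le_hi T k r).trans ?_
  cases r with
  | zero => exact le_rfl
  | succ r => exact min_le_left _ _

/-- The entries after exchanging the roles of `k` and `k + 1`. -/
def entry (r j : ℕ) : ℕ :=
  if j < mu.rowLen r then
    if j < num T r k ∨ num T r (k + 2) ≤ j then T r j
    else if j < mid T k r then k else k + 1
  else 0

theorem entry_col {r j : ℕ} (hj : j < mu.rowLen (r + 1)) : entry T k r j < entry T k (r + 1) j := by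
  have hj' : j < mu.rowLen r := hj.trans_le (mu.rowLen_anti r (r + 1) (Nat.le_succ r))
  have hc := T.col_strict (lt_add_one r) (YoungDiagram.mem_iff_lt_rowLen.2 hj)
  have a1 := lt_num_iff T (v := k) hj
  have a2 := lt_num_iff T (v := k) hj'
  have c1 := lt_num_iff T (v := k + 2) hj
  have c2 := lt_num_iff T (v := k + 2) hj'
  have m1 : num T (r + 1) (k + 2) ≤ mid T k r := (le_max_right _ _).trans (lo_le_mid T k r)
  have m2 : mid T k (r + 1) ≤ num T r k := (mid_le_hi T k (r + 1)).trans (min_le_right _ _)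
  have m3 := le_mid T k r
  have m4 := mid_le T k r
  have m5 := le_mid T k (r + 1)
  have m6 := mid_le T k (r + 1)
  rw [entry, entry, if_pos hj, if_pos hj']
  split_ifs <;> omega

/-- The Bender–Knuth involution for `k` and `k + 1`. -/
def flip : SemistandardYoungTableau mu where
  entry := entry T k
  row_weak' := by
    intro r j1 j2 hlt hcell
    have hj := YoungDiagram.mem_iff_lt_rowLen.1 hcell
    have hj1 : j1 < mu.rowLen r := hlt.trans hj
    have hw := T.row_weak hlt hcell
    have a1 := lt_num_iff T (v := k) hj
    have a2 := lt_num_iff T (v := k) hj1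
    have c1 := lt_num_iff T (v := k + 2) hj
    have c2 := lt_num_iff T (v := k + 2) hj1
    have m3 := le_mid T k r
    have m4 := mid_le T k r
    rw [entry, entry, if_pos hj, if_pos hj1]
    split_ifs <;> omega
  col_strict' := by
    intro i1 i2 j hlt hcell
    induction i2, hlt using Nat.le_induction with
    | base => exact entry_col T k (YoungDiagram.mem_iff_lt_rowLen.1 hcell)
    | succ i hi ih =>
      exact (ih (mu.up_left_mem (Nat.le_succ i) le_rfl hcell)).trans
        (entry_col T k (YoungDiagram.mem_iff_lt_rowLen.1 hcell))
  zeros' := by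
    intro i j hcell
    rw [entry, if_neg fun h => hcell (YoungDiagram.mem_iff_lt_rowLen.2 h)]

theorem flip_apply (r j : ℕ) : flip T k r j = entry T k r j := rfl

theorem num_flip_of_ne (r : ℕ) {v : ℕ} (hv : v ≠ k + 1) : num (flip T k) r v = num T r v := by
  refine num_eq_of _ r v _ (num_le_rowLen T r v) fun j hj => ?_
  rw [← lt_num_iff T hj]
  have a1 := lt_num_iff T (v := k) hj
  have c1 := lt_num_iff T (v := k + 2) hj
  have m3 := le_mid T k r
  have m4 := mid_le T k r
  rw [flip_apply, entry, if_pos hj]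
  split_ifs <;> omega

theorem num_flip (r : ℕ) : num (flip T k) r (k + 1) = mid T k r := by
  refine num_eq_of _ r _ _ ((mid_le T k r).trans (num_le_rowLen T r _)) fun j hj => ?_
  have a1 := lt_num_iff T (v := k) hj
  have c1 := lt_num_iff T (v := k + 2) hj
  have m3 := le_mid T k r
  have m4 := mid_le T k r
  rw [flip_apply, entry, if_pos hj]
  split_ifs <;> omega

theorem mid_flip (r : ℕ) : mid (flip T k) k r = num T r (k + 1) := by
  have h1 : lo (flip T k) k r = lo T k r := by
    rw [lo, lo, num_flip_of_ne T k _ (by omega), num_flip_of_ne T k _ (by omega)]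
  have h2 : hi (flip T k) k r = hi T k r := by
    cases r with
    | zero => rw [hi, hi, num_flip_of_ne T k _ (by omega)]
    | succ r =>
      rw [hi, hi, num_flip_of_ne T k _ (by omega), num_flip_of_ne T k _ (by omega)]
  have h3 := lo_le T k r
  have h4 := le_hi T k r
  rw [mid, h1, h2, num_flip, mid]
  omega

theorem flip_flip : flip (flip T k) k = T := by
  ext r j
  rw [flip_apply, entry]
  split_ifs with hj h1 h2
  · rw [num_flip_of_ne T k _ (by omega), num_flip_of_ne T k _ (by omega)] at h1
    rw [flip_apply, entry, if_pos hj, if_pos h1]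
  · rw [num_flip_of_ne T k _ (by omega), num_flip_of_ne T k _ (by omega)] at h1
    rw [mid_flip] at h2
    have a1 := lt_num_iff T (v := k) hj
    have b1 := lt_num_iff T (v := k + 1) hj
    omega
  · rw [num_flip_of_ne T k _ (by omega), num_flip_of_ne T k _ (by omega)] at h1
    rw [mid_flip] at h2
    have c1 := lt_num_iff T (v := k + 2) hj
    have b1 := lt_num_iff T (v := k + 1) hj
    omega
  · exact (T.zeros fun h => hj (YoungDiagram.mem_iff_lt_rowLen.1 h)).symm

theorem content_apply (v : ℕ) : content T v = (mu.cells.filter fun c => T c.1 c.2 = v).card := by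
  rw [content, Finsupp.finsetSum_apply, Finset.card_filter]
  exact Finset.sum_congr rfl fun c _ => Finsupp.single_apply

theorem content_add (v : ℕ) : content T v + ∑ r ∈ Finset.range (mu.colLen 0), num T r v =
    ∑ r ∈ Finset.range (mu.colLen 0), num T r (v + 1) := by
  have hS : mu.cells = ((Finset.range (mu.colLen 0)).sigma fun r => Finset.range (mu.rowLen r)).map
      (Equiv.sigmaEquivProd ℕ ℕ).toEmbedding := by
    ext ⟨i, j⟩
    rw [YoungDiagram.mem_cells]
    simp only [Finset.mem_map_equiv, Finset.mem_sigma, Finset.mem_range]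
    constructor
    · intro h
      exact ⟨YoungDiagram.mem_iff_lt_colLen.1 (mu.up_left_mem le_rfl (Nat.zero_le j) h),
        YoungDiagram.mem_iff_lt_rowLen.1 h⟩
    · rintro ⟨-, h⟩
      exact YoungDiagram.mem_iff_lt_rowLen.2 h
  rw [content_apply, Finset.card_filter, hS, Finset.sum_map, Finset.sum_sigma,
    ← Finset.sum_add_distrib]
  refine Finset.sum_congr rfl fun r _ => ?_
  rw [num, num, Finset.card_filter, Finset.card_filter, ← Finset.sum_add_distrib]
  refine Finset.sum_congr rfl fun j _ => ?_
  change (if T r j = v then 1 else 0) + _ = _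
  split_ifs <;> omega

theorem sum_lo_hi (L : ℕ) : ∑ r ∈ Finset.range L, lo T k r + ∑ r ∈ Finset.range (L + 1), hi T k r =
    ∑ r ∈ Finset.range L, num T r k + ∑ r ∈ Finset.range (L + 1), num T r (k + 2) := by
  induction L with
  | zero => simp [hi]
  | succ L ih =>
    rw [Finset.sum_range_succ, Finset.sum_range_succ _ (L + 1),
      Finset.sum_range_succ (fun r => num T r k), Finset.sum_range_succ _ (L + 1), lo, hi]
    have := max_add_min (num T L k) (num T (L + 1) (k + 2))
    rw [min_comm] at this
    omega

theorem sum_mid : ∑ r ∈ Finset.range (mu.colLen 0), mid T k r +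
      ∑ r ∈ Finset.range (mu.colLen 0), num T r (k + 1) =
    ∑ r ∈ Finset.range (mu.colLen 0), num T r k +
      ∑ r ∈ Finset.range (mu.colLen 0), num T r (k + 2) := by
  have h := sum_lo_hi T k (mu.colLen 0)
  have hz : mu.rowLen (mu.colLen 0) = 0 := by
    by_contra hne
    have : (mu.colLen 0, 0) ∈ mu := YoungDiagram.mem_iff_lt_rowLen.2 (Nat.pos_of_ne_zero hne)
    exact absurd (YoungDiagram.mem_iff_lt_colLen.1 this) (lt_irrefl _)
  have h1 : num T (mu.colLen 0) (k + 2) = 0 := by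
    have := num_le_rowLen T (mu.colLen 0) (k + 2)
    omega
  have h2 : hi T k (mu.colLen 0) = 0 := by
    cases hL : mu.colLen 0 with
    | zero => rw [hL] at h1; exact h1
    | succ L => rw [hL] at h1; rw [hi, h1, Nat.zero_min]
  rw [Finset.sum_range_succ, Finset.sum_range_succ _ (mu.colLen 0), h1, h2, add_zero,
    add_zero] at h
  rw [← h, ← Finset.sum_add_distrib, ← Finset.sum_add_distrib]
  refine Finset.sum_congr rfl fun r _ => ?_
  have h3 := lo_le T k r
  have h4 := le_hi T k r
  rw [mid]
  omega

theorem content_flip : content (flip T k) = (content T).mapDomain (Equiv.swap k (k + 1)) := by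
  ext v
  obtain ⟨w, rfl⟩ := (Equiv.swap k (k + 1)).surjective v
  rw [Finsupp.mapDomain_apply (Equiv.injective _)]
  have hs := sum_mid T k
  have e1 := content_add T w
  have e2 := content_add (flip T k) (Equiv.swap k (k + 1) w)
  by_cases h1 : w = k
  · subst h1
    rw [Equiv.swap_apply_left] at e2 ⊢
    simp only [num_flip] at e2
    rw [Finset.sum_congr rfl fun r _ => num_flip_of_ne T w r (v := w + 1 + 1) (by omega)] at e2
    change _ = ∑ r ∈ _, num T r (w + 2) at e2
    omega
  · by_cases h2 : w = k + 1
    · subst h2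
      rw [Equiv.swap_apply_right] at e2 ⊢
      simp only [num_flip] at e2
      rw [Finset.sum_congr rfl fun r _ => num_flip_of_ne T k r (v := k) (by omega)] at e2
      change _ = ∑ r ∈ _, num T r (k + 2) at e1
      omega
    · rw [Equiv.swap_apply_of_ne_of_ne h1 h2] at e2 ⊢
      rw [Finset.sum_congr rfl fun r _ => num_flip_of_ne T k r (v := w) (by omega),
        Finset.sum_congr rfl fun r _ => num_flip_of_ne T k r (v := w + 1) (by omega)] at e2
      omega

end BenderKnuth

/-- The Schur function as a power series: `∑_T x^T` over all semistandard tableaux of shape `mu`. -/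
def schurSeries (mu : YoungDiagram) : MvPowerSeries ℕ ℂ :=
  series fun a => (Nat.card {T : SemistandardYoungTableau mu // content T = a} : ℂ)

theorem isSymm_of_swap {f : MvPowerSeries ℕ ℂ}
    (hf : ∀ (k : ℕ) (a : ℕ →₀ ℕ), MvPowerSeries.coeff (a.mapDomain (Equiv.swap k (k + 1))) f =
      MvPowerSeries.coeff a f) : IsSymm f := by
  let G : Submonoid (Equiv.Perm ℕ) :=
    { carrier := {e | ∀ a : ℕ →₀ ℕ, MvPowerSeries.coeff (a.mapDomain e) f =
        MvPowerSeries.coeff a f}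
      mul_mem' := by
        intro e e' he he' a
        rw [Equiv.Perm.coe_mul, Finsupp.mapDomain_comp, he, he']
      one_mem' := by
        intro a
        rw [Equiv.Perm.coe_one, Finsupp.mapDomain_id] }
  have hadj : ∀ i d, Equiv.swap i (i + d) ∈ G := by
    intro i d
    induction d with
    | zero =>
      rw [add_zero, Equiv.swap_self]
      exact G.one_mem
    | succ d ih =>
      rcases Nat.eq_zero_or_pos d with rfl | hd
      · exact hf i
      · have h := Equiv.swap_mul_swap_mul_swap (x := i + d + 1) (y := i + d) (z := i)
          (by omega) (by omega)
        rw [Equiv.swap_comm (i + d) i, Equiv.swap_comm (i + d + 1) (i + d)] at h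
        rw [← add_assoc, ← h]
        exact G.mul_mem (G.mul_mem ih (hf (i + d))) ih
  have hswap : ∀ i j, Equiv.swap i j ∈ G := by
    intro i j
    rcases le_total i j with h | h
    · obtain ⟨d, rfl⟩ := Nat.exists_eq_add_of_le h
      exact hadj i d
    · obtain ⟨d, rfl⟩ := Nat.exists_eq_add_of_le h
      rw [Equiv.swap_comm]
      exact hadj j d
  have hext : ∀ (e : Equiv.Perm ℕ) (s : Finset ℕ), ∃ e' ∈ G, ∀ x ∈ s, e' x = e x := by
    intro e s
    induction s using Finset.induction with
    | empty => exact ⟨1, G.one_mem, by simp⟩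
    | insert x s hx ih =>
      obtain ⟨e', he', hs⟩ := ih
      refine ⟨Equiv.swap (e' x) (e x) * e', G.mul_mem (hswap _ _) he', fun y hy => ?_⟩
      rw [Equiv.Perm.mul_apply]
      rcases Finset.mem_insert.1 hy with rfl | hy'
      · rw [Equiv.swap_apply_left]
      · have hyx : y ≠ x := by rintro rfl; exact hx hy'
        rw [Equiv.swap_apply_of_ne_of_ne, hs y hy']
        · exact fun h => hyx (e'.injective h)
        · rw [hs y hy']
          exact fun h => hyx (e.injective h)
  refine (isSymm_iff f).2 fun e a => ?_
  obtain ⟨e', he', hs⟩ := hext e a.support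
  rw [← he' a, Finsupp.mapDomain_congr fun x hx => (hs x hx).symm]

theorem schurSeries_mem (mu : YoungDiagram) : schurSeries mu ∈ SymmFun := by
  refine ⟨isSymm_of_swap fun k a => ?_, mu.cells.card, fun a ha => ?_⟩
  · rw [schurSeries, coeff_series, coeff_series, Nat.cast_inj]
    have hinv : ∀ b : ℕ →₀ ℕ, (b.mapDomain (Equiv.swap k (k + 1))).mapDomain
        (Equiv.swap k (k + 1)) = b := by
      intro b
      rw [← Finsupp.mapDomain_comp, ← Equiv.Perm.coe_mul, Equiv.swap_mul_self,
        Equiv.Perm.coe_one, Finsupp.mapDomain_id]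
    refine Nat.card_congr
      { toFun := fun T => ⟨BenderKnuth.flip T.1 k, by
          rw [BenderKnuth.content_flip, T.2, hinv]⟩
        invFun := fun T => ⟨BenderKnuth.flip T.1 k, by
          rw [BenderKnuth.content_flip, T.2]⟩
        left_inv := fun T => Subtype.ext (BenderKnuth.flip_flip T.1 k)
        right_inv := fun T => Subtype.ext (BenderKnuth.flip_flip T.1 k) }
  · rw [schurSeries, coeff_series, Nat.cast_eq_zero, Nat.card_eq_zero]
    left
    refine ⟨fun T => ?_⟩
    have h := congrArg Finsupp.degree T.2
    rw [content, map_sum] at h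
    simp only [Finsupp.degree_single, Finset.sum_const, smul_eq_mul, mul_one] at h
    omega

/-- The Schur function `s_λ ∈ Λ`. -/
def schur (lam : Par) : SymmFun := ⟨schurSeries lam.diagram, schurSeries_mem _⟩

/-! ### The Hall pairing and plethystic substitution -/

/-- The basis `(p_λ)_λ` of `Λ`. -/
def pBasis : Module.Basis Par ℂ SymmFun :=
  Module.Basis.mk linearIndependent_p fun f _ => by
    obtain ⟨d, hd⟩ := f.2.2
    refine mem_span_p d (d + 1) f hd fun a ha => Nat.lt_succ_of_le ?_
    have h1 : a.degree ≤ d := by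
      by_contra h
      exact ha (hd a (by omega))
    refine le_trans ?_ h1
    rw [Finsupp.degree_apply, Finset.card_eq_sum_ones]
    exact Finset.sum_le_sum fun i hi => Nat.pos_of_ne_zero (Finsupp.mem_support_iff.1 hi)

theorem pBasis_apply (lam : Par) : pBasis lam = pSym lam := Module.Basis.mk_apply _ _ _

/-- The Hall pairing: the bilinear form on `Λ` with `⟨p_λ, p_μ⟩ = z_λ δ_{λ,μ}`. -/
def hallPairing : SymmFun →ₗ[ℂ] SymmFun →ₗ[ℂ] ℂ :=
  pBasis.constr ℂ fun lam => pBasis.constr ℂ fun mu => if lam = mu then (lam.z : ℂ) else 0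

theorem hallPairing_p (lam mu : Par) :
    hallPairing (pSym lam) (pSym mu) = if lam = mu then (lam.z : ℂ) else 0 := by
  rw [hallPairing, ← pBasis_apply, ← pBasis_apply, Module.Basis.constr_basis,
    Module.Basis.constr_basis]

/-- `p_n(A) = ∑_a c_a t^{n a}` for a series `A = ∑_a c_a t^a` and `n ≥ 1`. -/
def adams {σ : Type*} (n : ℕ) (A : MvPowerSeries σ ℂ) : MvPowerSeries σ ℂ :=
  if hn : n = 0 then 0 else MvPowerSeries.expand n hn A

/-- The union of two partitions. -/
def Par.union (lam mu : Par) : Par :=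
  Par.mk' (lam.parts + mu.parts) fun i hi => by
    rcases Multiset.mem_add.1 hi with h | h
    · exact lam.pos h
    · exact mu.pos h

theorem p_mul (lam mu : Par) : pSym lam * pSym mu = pSym (lam.union mu) := by
  refine Subtype.ext ?_
  change (lam.parts.map _).prod * (mu.parts.map _).prod = ((lam.parts + mu.parts).map _).prod
  rw [Multiset.map_add, Multiset.prod_add]

/-- The plethystic substitution `f ↦ f(A)`: the algebra homomorphism on `Λ` determined by
`p_n ↦ p_n(A)`. -/
def plethysm {σ : Type*} (A : MvPowerSeries σ ℂ) : SymmFun →ₐ[ℂ] MvPowerSeries σ ℂ :=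
  AlgHom.ofLinearMap
    (pBasis.constr ℂ fun lam : Par => (lam.parts.map fun r => adams r A).prod)
    (by
      have h1 : (1 : SymmFun) = pBasis (Par.mk' 0 (by simp)) := by
        rw [pBasis_apply]
        rfl
      rw [h1, Module.Basis.constr_basis]
      rfl)
    (by
      intro f g
      set φ := pBasis.constr ℂ fun lam : Par => (lam.parts.map fun r => adams r A).prod with hφ
      have key : (LinearMap.mul ℂ SymmFun).compr₂ φ =
          (LinearMap.mul ℂ (MvPowerSeries σ ℂ)).compl₁₂ φ φ := by
        refine pBasis.ext fun lam => pBasis.ext fun mu => ?_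
        rw [LinearMap.compr₂_apply, LinearMap.compl₁₂_apply, LinearMap.mul_apply',
          LinearMap.mul_apply', pBasis_apply, pBasis_apply, p_mul, ← pBasis_apply,
          ← pBasis_apply, ← pBasis_apply, hφ, Module.Basis.constr_basis,
          Module.Basis.constr_basis, Module.Basis.constr_basis, ← Multiset.prod_add,
          ← Multiset.map_add]
        rfl
      exact LinearMap.congr_fun (LinearMap.congr_fun key f) g)

/-- The plethystic exponential `Ω(A) = ∑_{n ≥ 0} h_n(A)`. -/
def plethysticExp {σ : Type*} (A : MvPowerSeries σ ℂ) : MvPowerSeries σ ℂ :=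
  ∑' n : ℕ, plethysm A (hSym n)

/-- `Ω(x; ζ) = ∏_i (1 - ζ x_i)⁻¹`. -/
def omegaProd {σ ι : Type*} (x : ι → MvPowerSeries σ ℂ) (ζ : ℂ) : MvPowerSeries σ ℂ :=
  ∏' i, (1 - MvPowerSeries.C ζ * x i)⁻¹

/-- The homogeneous component of degree `d` of a symmetric series (of possibly unbounded
degree). -/
def symmComponent (F : MvPowerSeries ℕ ℂ) (hF : IsSymm F) (d : ℕ) : SymmFun :=
  ⟨MvPowerSeries.homogeneousComponent d F, (isSymm_iff _).2 fun e a => by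
    rw [MvPowerSeries.coeff_homogeneousComponent, MvPowerSeries.coeff_homogeneousComponent,
      Finsupp.degree_mapDomain, (isSymm_iff F).1 hF], d, fun a ha => by
    rw [MvPowerSeries.coeff_homogeneousComponent, if_neg (by omega)]⟩

/-- The Hall pairing `⟨F, f⟩` of a symmetric series `F` of possibly unbounded degree with
`f ∈ Λ`: only the finitely many degrees occurring in `f` contribute. -/
def hallSeries (F : MvPowerSeries ℕ ℂ) (hF : IsSymm F) (f : SymmFun) : ℂ :=
  ∑ᶠ d : ℕ, hallPairing (symmComponent F hF d) f

/-- The coefficient of `x^a` in `K(x, y)`, a series in `y`. -/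
def coeffX {σ : Type*} (a : σ →₀ ℕ) (K : MvPowerSeries (σ ⊕ ℕ) ℂ) : MvPowerSeries ℕ ℂ :=
  series fun b => MvPowerSeries.coeff (a.sumElim b) K

/-- `K(x, y)` is symmetric in `y`. -/
def IsSymmY {σ : Type*} (K : MvPowerSeries (σ ⊕ ℕ) ℂ) : Prop :=
  ∀ a : σ →₀ ℕ, IsSymm (coeffX a K)

/-- The pairing `⟨K(x, y), f(y)⟩_y`, taken coefficientwise in `x`. -/
def pairingY {σ : Type*} (K : MvPowerSeries (σ ⊕ ℕ) ℂ) (hK : IsSymmY K) (f : SymmFun) :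
    MvPowerSeries σ ℂ :=
  series fun a => hallSeries (coeffX a K) (hK a) f

/-- The evaluation `f(x_0, …, x_{n-1})`, all other variables being set to zero. -/
def evalFin {n : ℕ} (f : SymmFun) (x : Fin n → ℂ) : ℂ :=
  ∑ᶠ b : Fin n →₀ ℕ, MvPowerSeries.coeff (b.embDomain Fin.valEmbedding) (f : MvPowerSeries ℕ ℂ) *
    ∏ i, x i ^ b i

/-- The evaluation of `f ∈ Λ` at a finite multiset of complex numbers. -/
def evalMultiset (f : SymmFun) (A : Multiset ℂ) : ℂ := evalFin f A.toList.get

/-! ### Wreath products -/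

instance fintypeRoots (m : ℕ) [NeZero m] : Fintype (rootsOfUnity m ℂ) := Fintype.ofFinite _

/-- `𝔖_n(μ_m) = μ_m^n ⋊ 𝔖_n`, where `(σ • a)_i = a_{σ⁻¹ i}`. -/
abbrev WreathGroup (m n : ℕ) : Type :=
  (Fin n → rootsOfUnity m ℂ) ⋊[mulAutArrow (G := Equiv.Perm (Fin n))] Equiv.Perm (Fin n)

/-- The monomial matrix of `(a; σ)`: its nonzero entries are `a_{σ j}` at `(σ j, j)`. -/
def toMatrix {m n : ℕ} : WreathGroup m n →* Matrix (Fin n) (Fin n) ℂ where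
  toFun γ := Matrix.of fun i j => if i = γ.right j then ((γ.left i : ℂˣ) : ℂ) else 0
  map_one' := by
    ext i j
    rw [Matrix.one_apply]
    simp
    congr
  map_mul' γ δ := by
    ext i j
    rw [Matrix.mul_apply, Finset.sum_eq_single (δ.right j)]
    · by_cases hi : i = γ.right (δ.right j)
      · subst hi
        have hact : δ.left (γ.right⁻¹ (γ.right (δ.right j))) = δ.left (δ.right j) := by simp
        simp
        exact congrArg (fun z : rootsOfUnity m ℂ => ((z : ℂˣ) : ℂ)) hact
      · simp [hi]
    · intro b _ hb
      simp [hb]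
    · simp

/-- The embedding of `𝔖_n(μ_m)` into `GL_n(ℂ)`. -/
def toGL {m n : ℕ} : WreathGroup m n →* Matrix.GeneralLinearGroup (Fin n) ℂ :=
  toMatrix.toHomUnits

/-- The cycles of the permutation part of `γ`, fixed points included. -/
abbrev Cycle {m n : ℕ} (γ : WreathGroup m n) : Type :=
  Quotient (Equiv.Perm.SameCycle.setoid γ.right)

open Classical in
/-- The set of points of a cycle. -/
def Cycle.points {m n : ℕ} {γ : WreathGroup m n} (q : Cycle γ) : Finset (Fin n) :=
  Finset.univ.filter fun i => Quotient.mk (Equiv.Perm.SameCycle.setoid γ.right) i = q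

/-- The cycle product `∏_{i ∈ q} a_i ∈ μ_m`. -/
def cycleProduct {m n : ℕ} {γ : WreathGroup m n} (q : Cycle γ) : rootsOfUnity m ℂ :=
  ∏ i ∈ q.points, γ.left i

/-- `Φ`: functions from `μ_m` to partitions. -/
abbrev Phi (m : ℕ) : Type := rootsOfUnity m ℂ → Par

/-- `|ρ| = ∑_ζ |ρ(ζ)|`. -/
def Phi.size {m : ℕ} [NeZero m] (ρ : Phi m) : ℕ := ∑ ζ, (ρ ζ).size

instance finite_phi {m : ℕ} [NeZero m] (n : ℕ) : Finite {ρ : Phi m // ρ.size = n} := by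
  have hS : {lam : Par | lam.size ≤ n}.Finite := by
    refine (((Finset.range (n + 1)).sigma fun k =>
      (Finset.univ : Finset k.Partition)).finite_toSet).subset fun lam hlam => ?_
    simpa [Par.size, Nat.lt_succ_iff] using hlam
  refine ((Set.Finite.pi' fun _ : rootsOfUnity m ℂ => hS).subset fun ρ hρ ζ => ?_).to_subtype
  have h : Phi.size ρ = n := hρ
  exact (Finset.single_le_sum (f := fun ζ => (ρ ζ).size) (fun _ _ => Nat.zero_le _)
    (Finset.mem_univ ζ)).trans h.le

/-- `Z_ρ = ∏_ζ z_{ρ(ζ)} m^{ℓ(ρ(ζ))}`. -/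
def Phi.Z {m : ℕ} [NeZero m] (ρ : Phi m) : ℕ := ∏ ζ, (ρ ζ).z * m ^ (ρ ζ).length

/-- The class `C_ρ ⊆ 𝔖_n(μ_m)`: elements with exactly `m_ℓ(ρ(ζ))` cycles of length `ℓ` and cycle
product `ζ`, for all `ζ ∈ μ_m` and `ℓ ≥ 1`. -/
def conjClass {m : ℕ} (n : ℕ) (ρ : Phi m) : Set (WreathGroup m n) :=
  {γ | ∀ (ζ : rootsOfUnity m ℂ) (l : ℕ), 1 ≤ l →
    Nat.card {q : Cycle γ // cycleProduct q = ζ ∧ q.points.card = l} = (ρ ζ).mult l}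

open Classical in
/-- A representative of the class `C_ρ ⊆ 𝔖_n(μ_m)`. -/
def classRep {m : ℕ} (n : ℕ) (ρ : Phi m) : WreathGroup m n :=
  if hne : (conjClass n ρ).Nonempty then hne.some else 1

/-- `Ξ_ρ`: the multiset of roots of the characteristic polynomial of an element of `C_ρ`. -/
def Xi {m : ℕ} [NeZero m] (ρ : Phi m) : Multiset ℂ :=
  (toMatrix (classRep ρ.size ρ)).charpoly.roots

/-- `P_ρ = ∏_ζ p_{ρ(ζ)}(X_ζ)`, where `X_ζ` is the variable set `x_{ζ,0}, x_{ζ,1}, …`. -/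
def P {m : ℕ} [NeZero m] (ρ : Phi m) : MvPowerSeries (rootsOfUnity m ℂ × ℕ) ℂ :=
  ∏ ζ, powerSumPar (fun i : ℕ => MvPowerSeries.X (ζ, i)) (ρ ζ)

/-- The term of index `ρ` of the generating series `F_λ`. -/
def FTerm {m : ℕ} [NeZero m] (lam : Par) (ρ : Phi m) :
    MvPowerSeries (rootsOfUnity m ℂ × ℕ) ℂ :=
  (evalMultiset (schur lam) (Xi ρ) / (ρ.Z : ℂ)) • P ρ

/-- `F_λ = ∑_{ρ ∈ Φ} P_ρ s_λ(Ξ_ρ) / Z_ρ`. -/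
def F (m : ℕ) [NeZero m] (lam : Par) : MvPowerSeries (rootsOfUnity m ℂ × ℕ) ℂ :=
  ∑' ρ : Phi m, FTerm lam ρ

/-- The series `(1/m) ∑_ζ X_ζ Ω(Y; ζ)`, where `X_ζ = x_{ζ,0} + x_{ζ,1} + …`, in the variables
`x_{ζ,i}` (left summand) and `y_i` (right summand). -/
def kernelAlphabet (m : ℕ) [NeZero m] : MvPowerSeries ((rootsOfUnity m ℂ × ℕ) ⊕ ℕ) ℂ :=
  (1 / (m : ℂ)) • ∑ ζ : rootsOfUnity m ℂ,
    (∑' i : ℕ, MvPowerSeries.X (Sum.inl (ζ, i))) *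
      omegaProd (fun i : ℕ => MvPowerSeries.X (Sum.inr i)) ((ζ : ℂˣ) : ℂ)

/-! ### Highest weight representations -/

/-- The action of `GL_n(ℂ)` on polynomials in the variables `x_{a,c}`, `a ∈ ℕ`, `c < n`, by
`(g f)(x) = f(x g)`. -/
def polyRep (n : ℕ) : Representation ℂ (Matrix.GeneralLinearGroup (Fin n) ℂ)
    (MvPolynomial (ℕ × Fin n) ℂ) where
  toFun g := (MvPolynomial.aeval fun q : ℕ × Fin n =>
    ∑ d, (g.val d q.2) • (MvPolynomial.X (q.1, d) : MvPolynomial (ℕ × Fin n) ℂ)).toLinearMap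
  map_one' := by
    refine congrArg AlgHom.toLinearMap (MvPolynomial.algHom_ext (g := AlgHom.id ℂ _) fun q => ?_)
    simp [Matrix.one_apply, ite_smul]
  map_mul' g g' := by
    refine congrArg AlgHom.toLinearMap (MvPolynomial.algHom_ext (g := AlgHom.comp
      (MvPolynomial.aeval fun q : ℕ × Fin n => ∑ d, (g.val d q.2) • MvPolynomial.X (q.1, d))
      (MvPolynomial.aeval fun q : ℕ × Fin n => ∑ d, (g'.val d q.2) • MvPolynomial.X (q.1, d)))
      fun q => ?_)
    simp only [MvPolynomial.aeval_X, AlgHom.comp_apply, map_sum, map_smul, Finset.smul_sum,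
      smul_smul, Units.val_mul, Matrix.mul_apply, Finset.sum_smul]
    rw [Finset.sum_comm]
    refine Finset.sum_congr rfl fun d _ => Finset.sum_congr rfl fun e _ => ?_
    rw [mul_comm]

/-- The minor of `(x_{a,c})` on the first `k` rows and the columns `c_0, …, c_{k-1}`. -/
def minor {n k : ℕ} (c : Fin k → Fin n) : MvPolynomial (ℕ × Fin n) ℂ :=
  Matrix.det (Matrix.of fun a b : Fin k => MvPolynomial.X ((a : ℕ), c b))

/-- The product of the minors given by the columns of a filling `T` of the diagram `mu` with
entries in `{0, …, n-1}`; `T j` is the `j`-th column. -/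
def minorProd {n : ℕ} (mu : YoungDiagram)
    (T : (j : Fin (mu.rowLen 0)) → Fin (mu.colLen j) → Fin n) : MvPolynomial (ℕ × Fin n) ℂ :=
  ∏ j, minor (T j)

theorem polyRep_minor {n k : ℕ} (g : Matrix.GeneralLinearGroup (Fin n) ℂ) (c : Fin k → Fin n) :
    polyRep n g (minor c) = ∑ d : Fin k → Fin n, (∏ b, g.val (d b) (c b)) • minor d := by
  change MvPolynomial.aeval _ (minor c) = _
  rw [minor, AlgHom.map_det, ← Matrix.det_transpose]
  have hrow : (AlgHom.mapMatrix (MvPolynomial.aeval fun q : ℕ × Fin n =>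
      ∑ d, (g.val d q.2) • (MvPolynomial.X (q.1, d) : MvPolynomial (ℕ × Fin n) ℂ))
      (Matrix.of fun a b : Fin k =>
        (MvPolynomial.X ((a : ℕ), c b) : MvPolynomial (ℕ × Fin n) ℂ))).transpose =
      fun b : Fin k => ∑ d : Fin n, (MvPolynomial.C (σ := ℕ × Fin n) (g.val d (c b))) •
        fun a : Fin k => (MvPolynomial.X ((a : ℕ), d) : MvPolynomial (ℕ × Fin n) ℂ) := by
    funext b a
    simp [MvPolynomial.smul_eq_C_mul]
  rw [hrow]
  change (Matrix.detRowAlternating (n := Fin k)).toMultilinearMap _ = _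
  rw [MultilinearMap.map_sum]
  refine Finset.sum_congr rfl fun d _ => ?_
  rw [MultilinearMap.map_smul_univ, minor, ← Matrix.det_transpose, ← map_prod,
    MvPolynomial.smul_eq_C_mul]
  rfl

/-- The underlying space of `V^λ`: the span of the products of minors over all fillings of the
diagram `mu`. The filling `T j b = b` gives the product of the leading minors
`Δ_{λ'_1} Δ_{λ'_2} ⋯` (`λ'` the conjugate partition), which is fixed by the upper unitriangular
matrices and on which `diag(t_1, …, t_n)` acts by `t_1^{λ_1} ⋯ t_n^{λ_n}`: it is the highest weight
vector of this irreducible module. -/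
def weylModule (n : ℕ) (mu : YoungDiagram) : Submodule ℂ (MvPolynomial (ℕ × Fin n) ℂ) :=
  Submodule.span ℂ (Set.range (minorProd (n := n) mu))

theorem weylModule_invariant (n : ℕ) (mu : YoungDiagram)
    (g : Matrix.GeneralLinearGroup (Fin n) ℂ) :
    weylModule n mu ≤ (weylModule n mu).comap (polyRep n g) := by
  refine Submodule.span_le.2 ?_
  rintro _ ⟨T, rfl⟩
  have hprod : polyRep n g (minorProd mu T) = ∏ j, polyRep n g (minor (T j)) :=
    map_prod (MvPolynomial.aeval fun q : ℕ × Fin n =>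
      ∑ d, (g.val d q.2) • (MvPolynomial.X (q.1, d) : MvPolynomial (ℕ × Fin n) ℂ)) _ _
  change polyRep n g (minorProd mu T) ∈ weylModule n mu
  rw [hprod]
  simp only [polyRep_minor]
  rw [Finset.prod_univ_sum]
  refine Submodule.sum_mem _ fun T' _ => ?_
  rw [Finset.prod_smul]
  exact Submodule.smul_mem _ _ (Submodule.subset_span ⟨T', rfl⟩)

instance finiteDimensional_weylModule (n : ℕ) (mu : YoungDiagram) :
    FiniteDimensional ℂ (weylModule n mu) :=
  FiniteDimensional.span_of_finite ℂ (Set.finite_range _)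

/-- The highest weight representation `V^λ` of `GL_n(ℂ)`, for `ℓ(λ) ≤ n`, realised on the span of
products of minors. -/
def weylRep (n : ℕ) (lam : Par) :
    Representation ℂ (Matrix.GeneralLinearGroup (Fin n) ℂ) (weylModule n lam.diagram) :=
  (polyRep n).subrepresentation _ (weylModule_invariant n lam.diagram)

/-- The restriction of `V^λ` to `𝔖_n(μ_m)`. -/
def resWeylRep (m n : ℕ) (lam : Par) :
    Representation ℂ (WreathGroup m n) (weylModule n lam.diagram) :=
  (weylRep n lam).comp toGL

/-- The Frobenius characteristic `∑_{ρ ∈ Φ_n} (χ(C_ρ) / Z_ρ) P_ρ` of a representation of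
`𝔖_n(μ_m)` with character `χ`. -/
def frobeniusChar {m n : ℕ} [NeZero m] {V : Type*} [AddCommGroup V] [Module ℂ V]
    [FiniteDimensional ℂ V] (W : Representation ℂ (WreathGroup m n) V) :
    MvPowerSeries (rootsOfUnity m ℂ × ℕ) ℂ :=
  ∑ᶠ ρ : {ρ : Phi m // ρ.size = n}, (W.character (classRep n ρ.1) / (ρ.1.Z : ℂ)) • P ρ.1

end WreathSym

end

/-! The kernel is a reproducing kernel for evaluation at the multisets `Ξ_ρ`, and this is seen in
the basis of power sums.

A cycle of length `l` with cycle product `ζ` contributes `l ζ^(r/l)` to the trace of the `r`-th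
power of a monomial matrix if `l ∣ r`, and `0` otherwise. Hence `p_r(Ξ_ρ)` is `eigenPowerSum ρ r`
(`trace_pow_of_mem_conjClass`). On the other side `p_l` sends `Ω(Y; ζ)` to `∏ (1 - ζ y_i^l)⁻¹`,
whose logarithm is the sum of `l ζ^(r/l) p_r(Y) / r` over the multiples `r` of `l`: the same
numbers. So the product of these series over all parts of `ρ`, called `cauchySeries ρ`, equals `∑_λ
p_λ(Ξ_ρ) p_λ(Y) / z_λ` (`homogeneousComponent_cauchySeries`), and pairing it with `f` gives
`f(Ξ_ρ)`.

The formula `h_n = ∑ p_λ / z_λ`, applied to a sum over `ζ`, expands the kernel as `∑_ρ P_ρ(X)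
cauchySeries ρ / Z_ρ` (`plethysm_kernelAlphabet`). Comparing coefficients in `X` gives the identity
for `F_λ`. Convergence holds because `P_ρ` is homogeneous of degree `|ρ|` and only finitely many `ρ`
have a given size. Exponentials and logarithms are replaced throughout by the differential equation
`IsNewton`, which has a unique solution over a `ℂ`-algebra.

The multiset `Ξ_ρ` is well defined because elements of a finite group act diagonalizably, so that
power sums of eigenvalues are traces of powers, and because a finite multiset is determined by its
power sums. Nonemptiness comes from an explicit product of rotations.

For the last claim the character of `V^λ` is computed on the span of products of minors. Exchange
relations show that the standard fillings span (`minorProd_mem_span_standard`), and distinct leading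
monomials show that they are independent. Semistandard tableaux thus index a basis of weight
vectors, the character at `diag(x)` is `s_λ(x)`, and conjugating an element of `C_ρ` to a diagonal
matrix gives `χ(C_ρ) = s_λ(Ξ_ρ)`. -/

open scoped MvPowerSeries.WithPiTopology

noncomputable section

namespace WreathSym

/-! ### The exponential formula for power sums -/

/-- The finite set of partitions of `n`. -/
def parOf (n : ℕ) : Finset Par := Finset.univ.map ⟨Sigma.mk n, sigma_mk_injective⟩

theorem mem_parOf {n : ℕ} {lam : Par} : lam ∈ parOf n ↔ lam.size = n := by
  rw [parOf, Finset.mem_map]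
  constructor
  · rintro ⟨p, -, rfl⟩
    rfl
  · rintro rfl
    exact ⟨lam.2, Finset.mem_univ _, rfl⟩

namespace Par

theorem sum_parts (lam : Par) : lam.parts.sum = lam.size := lam.2.parts_sum

/-- Adjoin a part to a partition. -/
def cons (r : ℕ) (lam : Par) (hr : 0 < r) : Par :=
  mk' (r ::ₘ lam.parts) fun i hi => by
    rcases Multiset.mem_cons.1 hi with rfl | h
    · exact hr
    · exact lam.pos h

/-- Remove a part from a partition. -/
def erase (r : ℕ) (lam : Par) : Par :=
  mk' (lam.parts.erase r) fun _ hi => lam.pos (Multiset.mem_of_mem_erase hi)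

theorem parts_cons (r : ℕ) (lam : Par) (hr : 0 < r) : (cons r lam hr).parts = r ::ₘ lam.parts := rfl

theorem parts_erase (r : ℕ) (lam : Par) : (erase r lam).parts = lam.parts.erase r := rfl

theorem size_cons (r : ℕ) (lam : Par) (hr : 0 < r) : (cons r lam hr).size = r + lam.size := by
  rw [← sum_parts, parts_cons, Multiset.sum_cons, sum_parts]

theorem cons_erase {r : ℕ} {lam : Par} (h : r ∈ lam.parts) :
    cons r (erase r lam) (lam.pos h) = lam :=
  parts_injective (by rw [parts_cons, parts_erase, Multiset.cons_erase h])

theorem erase_cons (r : ℕ) (lam : Par) (hr : 0 < r) : erase r (cons r lam hr) = lam :=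
  parts_injective (by rw [parts_erase, parts_cons, Multiset.erase_cons_head])

theorem z_eq_prod (lam : Par) {s : Finset ℕ} (hs : lam.parts.toFinset ⊆ s) :
    lam.z = ∏ r ∈ s, (lam.mult r).factorial * r ^ lam.mult r := by
  refine Finset.prod_subset hs fun r _ hr => ?_
  have : lam.mult r = 0 := Multiset.count_eq_zero.2 fun h => hr (Multiset.mem_toFinset.2 h)
  rw [this]
  rfl

/-- Only the factor at `r` changes: its multiplicity goes from `k` to `k + 1`, which contributes `(k
+ 1) r`. This ratio turns sums weighted by `1 / z_λ` into Newton's recursion. -/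
theorem z_cons (r : ℕ) (lam : Par) (hr : 0 < r) :
    (cons r lam hr).z = r * (cons r lam hr).mult r * lam.z := by
  have h1 : (cons r lam hr).parts.toFinset = insert r lam.parts.toFinset := by
    rw [parts_cons, Multiset.toFinset_cons]
  rw [z_eq_prod _ h1.subset, z_eq_prod lam (Finset.subset_insert r _),
    ← Finset.mul_prod_erase _ _ (Finset.mem_insert_self r _),
    ← Finset.mul_prod_erase _ (fun i => (lam.mult i).factorial * i ^ lam.mult i)
      (Finset.mem_insert_self r _)]
  have h2 : (cons r lam hr).mult r = lam.mult r + 1 := by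
    rw [mult, parts_cons, Multiset.count_cons_self, mult]
  rw [h2, Nat.factorial_succ, pow_succ,
    Finset.prod_congr rfl fun i hi => show ((cons r lam hr).mult i).factorial *
      i ^ (cons r lam hr).mult i = (lam.mult i).factorial * i ^ lam.mult i by
        rw [mult, parts_cons, Multiset.count_cons_of_ne (Finset.ne_of_mem_erase hi), mult]]
  ring

theorem z_pos (lam : Par) : 0 < lam.z :=
  Finset.prod_pos fun _ hr => Nat.mul_pos (Nat.factorial_pos _)
    (pow_pos (lam.pos (Multiset.mem_toFinset.1 hr)) _)

end Par

section Exponential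

variable {R : Type*} [CommRing R]

/-- `c_λ = ∏_i c_{λ_i}`. -/
def parProd {R : Type*} [CommMonoid R] (c : ℕ → R) (lam : Par) : R := (lam.parts.map c).prod

/-- The power series `F` satisfies `F(0) = 1` and `F' = (∑_r c_{r+1} t^r) F`. -/
def IsNewton (c : ℕ → R) (F : PowerSeries R) : Prop :=
  PowerSeries.coeff 0 F = 1 ∧
    PowerSeries.derivative R F = PowerSeries.mk (fun n => c (n + 1)) * F

theorem IsNewton.one : IsNewton (fun _ => (0 : R)) 1 := by
  refine ⟨by simp, ?_⟩
  have : PowerSeries.mk (fun _ : ℕ => (0 : R)) = 0 := by ext; simp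
  rw [this, zero_mul, PowerSeries.derivative_one]

/-- By the Leibniz rule, logarithmic derivatives add under products. -/
theorem IsNewton.mul {c d : ℕ → R} {F G : PowerSeries R} (hF : IsNewton c F)
    (hG : IsNewton d G) : IsNewton (fun r => c r + d r) (F * G) := by
  refine ⟨?_, ?_⟩
  · rw [PowerSeries.coeff_mul]
    simp [hF.1, hG.1]
  · have : PowerSeries.mk (fun n => c (n + 1) + d (n + 1)) =
        PowerSeries.mk (fun n => c (n + 1)) + PowerSeries.mk (fun n => d (n + 1)) := by ext; simp
    rw [this, Derivation.leibniz, hF.2, hG.2, smul_eq_mul, smul_eq_mul]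
    ring

theorem IsNewton.prod {ι : Type*} (s : Finset ι) {c : ι → ℕ → R} {F : ι → PowerSeries R}
    (h : ∀ i ∈ s, IsNewton (c i) (F i)) :
    IsNewton (fun r => ∑ i ∈ s, c i r) (∏ i ∈ s, F i) := by
  classical
  induction s using Finset.induction with
  | empty => simpa using IsNewton.one
  | insert i s hi ih =>
    simp only [Finset.sum_insert hi, Finset.prod_insert hi]
    exact (h i (Finset.mem_insert_self i s)).mul
      (ih fun j hj => h j (Finset.mem_insert_of_mem hj))

theorem IsNewton.multiset_prod {ι : Type*} (s : Multiset ι) {c : ι → ℕ → R}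
    {F : ι → PowerSeries R} (h : ∀ i ∈ s, IsNewton (c i) (F i)) :
    IsNewton (fun r => (s.map fun i => c i r).sum) (s.map F).prod := by
  induction s using Multiset.induction with
  | empty => simpa using IsNewton.one
  | cons i s ih =>
    simp only [Multiset.map_cons, Multiset.sum_cons, Multiset.prod_cons]
    exact (h i (Multiset.mem_cons_self i s)).mul
      (ih fun j hj => h j (Multiset.mem_cons_of_mem hj))

/-- Comparing coefficients yields Newton's identities `n h_n = ∑ p_r h_{n-r}`, with both `n` and `r`
shifted by one. -/
theorem isNewton_iff {c : ℕ → R} {f : ℕ → R} : IsNewton c (PowerSeries.mk f) ↔ f 0 = 1 ∧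
    ∀ n, f (n + 1) * (n + 1) = ∑ p ∈ Finset.HasAntidiagonal.antidiagonal n, c (p.1 + 1) * f p.2 := by
  rw [IsNewton, PowerSeries.coeff_mk, PowerSeries.ext_iff]
  simp only [PowerSeries.coeff_derivative, PowerSeries.coeff_mul, PowerSeries.coeff_mk]

variable [Algebra ℂ R]

/-- `∑_{|λ| = n} c_λ / z_λ`, the value of `h_n` when the power sums have the values `c_r`. -/
def expCoeff (c : ℕ → R) (n : ℕ) : R := ∑ lam ∈ parOf n, ((lam.z : ℂ)⁻¹) • parProd c lam

/-- The recursion fixes the coefficient of index `n + 1` from the lower ones, because `n + 1` is a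
unit in a `ℂ`-algebra. -/
theorem IsNewton.unique {c : ℕ → R} {F G : PowerSeries R} (hF : IsNewton c F)
    (hG : IsNewton c G) : F = G := by
  ext n
  induction n using Nat.strong_induction_on with
  | _ n ih =>
    cases n with
    | zero => rw [hF.1, hG.1]
    | succ n =>
      have h : PowerSeries.coeff n (PowerSeries.derivative R F) =
          PowerSeries.coeff n (PowerSeries.derivative R G) := by
        rw [hF.2, hG.2, PowerSeries.coeff_mul, PowerSeries.coeff_mul]
        refine Finset.sum_congr rfl fun p hp => ?_
        rw [ih p.2 (by
          have := Finset.HasAntidiagonal.mem_antidiagonal.1 hp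
          omega)]
      rw [PowerSeries.coeff_derivative, PowerSeries.coeff_derivative] at h
      have hu : IsUnit ((n : R) + 1) := by
        have : IsUnit (algebraMap ℂ R ((n : ℂ) + 1)) :=
          (IsUnit.mk0 _ (Nat.cast_add_one_ne_zero n)).map _
        simpa using this
      exact hu.mul_right_cancel h

theorem expCoeff_zero (c : ℕ → R) : expCoeff c 0 = 1 := by
  have : parOf 0 = {Par.mk' 0 (by simp)} := by
    ext lam
    rw [mem_parOf, Finset.mem_singleton]
    constructor
    · intro h
      refine Par.parts_injective ?_
      rw [← Par.sum_parts, Multiset.sum_eq_zero_iff] at h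
      rw [Par.parts_mk']
      exact Multiset.eq_zero_of_forall_notMem fun i hi => (lam.pos hi).ne' (h i hi)
    · rintro rfl
      rfl
  rw [expCoeff, this, Finset.sum_singleton]
  simp [parProd, Par.parts_mk', Par.z]

/-- Double counting of the pairs of a partition `λ` of `n + 1` and a distinct part `r` of it, with
weight `r m_r(λ) / z_λ`. Summing over `r` first gives `(n + 1) / z_λ`. Removing the part `r` instead
turns the weight into `1 / z` of the remaining partition and splits off a factor `c_r`. -/
theorem isNewton_expCoeff (c : ℕ → R) : IsNewton c (PowerSeries.mk (expCoeff c)) := by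
  refine isNewton_iff.2 ⟨expCoeff_zero c, fun n => ?_⟩
  have hL : expCoeff c (n + 1) * ((n : R) + 1) = ∑ x ∈ (parOf (n + 1)).sigma
      (fun lam => lam.parts.toFinset),
      ((x.1.z : ℂ)⁻¹ * ((x.2 * x.1.mult x.2 : ℕ) : ℂ)) • parProd c x.1 := by
    rw [expCoeff, Finset.sum_mul, Finset.sum_sigma]
    refine Finset.sum_congr rfl fun lam hlam => ?_
    dsimp only
    rw [← Finset.sum_smul, ← Finset.mul_sum, ← Nat.cast_sum]
    have h1 : ∑ r ∈ lam.parts.toFinset, r * lam.mult r = n + 1 := by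
      rw [← mem_parOf.1 hlam, ← lam.sum_parts, Finset.sum_multiset_count]
      exact Finset.sum_congr rfl fun r _ => by rw [smul_eq_mul, mul_comm, Par.mult]
    rw [h1, mul_smul, Nat.cast_smul_eq_nsmul, nsmul_eq_mul, mul_comm, mul_smul_comm]
    push_cast
    rfl
  have hR : ∑ p ∈ Finset.HasAntidiagonal.antidiagonal n, c (p.1 + 1) * expCoeff c p.2 =
      ∑ x ∈ (Finset.HasAntidiagonal.antidiagonal n).sigma (fun p => parOf p.2),
        ((x.2.z : ℂ)⁻¹) • (c (x.1.1 + 1) * parProd c x.2) := by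
    rw [Finset.sum_sigma]
    refine Finset.sum_congr rfl fun p _ => ?_
    rw [expCoeff, Finset.mul_sum]
    exact Finset.sum_congr rfl fun lam _ => by rw [mul_smul_comm]
  rw [hL, hR]
  -- The part `r` is recorded as `r - 1`, since the recursion is indexed by the shifted value.
  refine Finset.sum_bij' (fun x _ => ⟨(x.2 - 1, n + 1 - x.2), x.1.erase x.2⟩)
    (fun x _ => ⟨x.2.cons (x.1.1 + 1) (Nat.succ_pos _), x.1.1 + 1⟩) ?_ ?_ ?_ ?_ ?_
  · rintro ⟨lam, r⟩ h
    simp only [Finset.mem_sigma, mem_parOf, Multiset.mem_toFinset,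
      Finset.HasAntidiagonal.mem_antidiagonal] at h ⊢
    have hc := Par.size_cons r (lam.erase r) (lam.pos h.2)
    rw [Par.cons_erase h.2] at hc
    have := lam.pos h.2
    omega
  · rintro ⟨⟨i, j⟩, lam⟩ h
    simp only [Finset.mem_sigma, mem_parOf, Multiset.mem_toFinset,
      Finset.HasAntidiagonal.mem_antidiagonal] at h ⊢
    refine ⟨?_, ?_⟩
    · rw [Par.size_cons]; omega
    · rw [Par.parts_cons]; exact Multiset.mem_cons_self _ _
  · rintro ⟨lam, r⟩ h
    simp only [Finset.mem_sigma, mem_parOf, Multiset.mem_toFinset] at h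
    have hr : r - 1 + 1 = r := Nat.succ_pred_eq_of_pos (lam.pos h.2)
    simp only [hr, Par.cons_erase h.2]
  · rintro ⟨⟨i, j⟩, lam⟩ h
    simp only [Finset.mem_sigma, mem_parOf, Finset.HasAntidiagonal.mem_antidiagonal] at h
    simp only [Par.erase_cons, Nat.add_sub_cancel, Nat.add_sub_add_right]
    have : n - i = j := by omega
    rw [this]
  · rintro ⟨lam, r⟩ h
    simp only [Finset.mem_sigma, mem_parOf, Multiset.mem_toFinset] at h
    have hr : r - 1 + 1 = r := Nat.succ_pred_eq_of_pos (lam.pos h.2)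
    have hz := Par.z_cons r (lam.erase r) (lam.pos h.2)
    rw [Par.cons_erase h.2] at hz
    have hp : parProd c lam = c r * parProd c (lam.erase r) := by
      rw [parProd, parProd, Par.parts_erase, ← Multiset.prod_cons, ← Multiset.map_cons,
        Multiset.cons_erase h.2]
    simp only [hr]
    rw [hp, hz]
    congr 1
    have h1 : (r : ℂ) ≠ 0 := Nat.cast_ne_zero.2 (lam.pos h.2).ne'
    have h2 : (lam.mult r : ℂ) ≠ 0 := Nat.cast_ne_zero.2 (Multiset.count_pos.2 h.2).ne'
    have h3 : ((lam.erase r).z : ℂ) ≠ 0 := Nat.cast_ne_zero.2 (Par.z_pos _).ne'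
    push_cast
    field_simp

/-- The tool for reading off a power sum expansion: it suffices to know the logarithmic derivative.
It is applied both to `h_n` and to the components of `cauchySeries`. -/
theorem expCoeff_eq {c : ℕ → R} {f : ℕ → R} (h : IsNewton c (PowerSeries.mk f)) (n : ℕ) :
    f n = expCoeff c n := by
  have := congrArg (PowerSeries.coeff n) (h.unique (isNewton_expCoeff c))
  simpa using this

/-- The exponential formula for a finite sum of systems of power sums. -/
theorem expCoeff_sum {ι : Type*} [DecidableEq ι] (s : Finset ι) (c : ι → ℕ → R) (n : ℕ) :
    expCoeff (fun r => ∑ i ∈ s, c i r) n =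
      ∑ l ∈ s.finsuppAntidiag n, ∏ i ∈ s, expCoeff (c i) (l i) := by
  have h := (isNewton_expCoeff (fun r => ∑ i ∈ s, c i r)).unique
    (IsNewton.prod s fun i _ => isNewton_expCoeff (c i))
  have := congrArg (PowerSeries.coeff n) h
  rw [PowerSeries.coeff_mk, PowerSeries.coeff_prod] at this
  simpa using this

end Exponential

/-! ### Power sums and complete symmetric functions -/

section Summation

/-- As `r > 0`, a fixed monomial can equal an `r`-th power of a variable only for variables in its
support, so each coefficient is a finite sum. -/
theorem hasSum_X_pow {σ ι : Type*} (e : ι ↪ σ) {r : ℕ} (hr : 0 < r) :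
    HasSum (fun i => (MvPowerSeries.X (e i) : MvPowerSeries σ ℂ) ^ r)
      (powerSum (fun i => MvPowerSeries.X (e i)) r) := by
  classical
  refine Summable.hasSum ?_
  rw [MvPowerSeries.WithPiTopology.summable_iff_summable_coeff]
  intro d
  refine summable_of_hasFiniteSupport ((d.support.finite_toSet.preimage e.injective.injOn).subset
    fun i hi => ?_)
  rw [Function.mem_support, MvPowerSeries.coeff_X_pow] at hi
  by_contra h
  refine hi (if_neg ?_)
  rintro rfl
  exact h (by simp [hr.ne'])

/-- Since `e` is injective, every coefficient of the image is either a single coefficient of the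
source or zero. Continuity lets renaming pass through infinite sums and products. -/
theorem continuous_rename {σ τ : Type*} (e : σ ↪ τ) :
    Continuous (MvPowerSeries.rename (R := ℂ) e) := by
  rw [continuous_iff_continuousAt]
  intro f
  rw [ContinuousAt, MvPowerSeries.WithPiTopology.tendsto_iff_coeff_tendsto]
  intro d
  by_cases hd : d ∈ Set.range (Finsupp.mapDomain e)
  · obtain ⟨x, rfl⟩ := hd
    rw [← Finsupp.embDomain_eq_mapDomain]
    simp only [MvPowerSeries.coeff_embDomain_rename]
    exact (MvPowerSeries.WithPiTopology.continuous_coeff ℂ x).tendsto f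
  · simp only [MvPowerSeries.coeff_rename_eq_zero _ _ hd]
    exact tendsto_const_nhds

theorem exists_eq_smul_of_dvd {σ : Type*} {l : ℕ} (d : σ →₀ ℕ) (h : ∀ i, l ∣ d i) :
    ∃ x : σ →₀ ℕ, d = l • x := by
  rcases Nat.eq_zero_or_pos l with rfl | hl
  · refine ⟨0, Finsupp.ext fun i => ?_⟩
    simpa using h i
  · refine ⟨d.mapRange (fun k => k / l) (by simp), Finsupp.ext fun i => ?_⟩
    rw [Finsupp.smul_apply, Finsupp.mapRange_apply, smul_eq_mul, Nat.mul_div_cancel' (h i)]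

theorem continuous_expand {σ : Type*} {l : ℕ} (hl : l ≠ 0) :
    Continuous (MvPowerSeries.expand (σ := σ) (R := ℂ) l hl) := by
  rw [continuous_iff_continuousAt]
  intro f
  rw [ContinuousAt, MvPowerSeries.WithPiTopology.tendsto_iff_coeff_tendsto]
  intro d
  by_cases hd : ∀ i, l ∣ d i
  · obtain ⟨x, rfl⟩ := exists_eq_smul_of_dvd d hd
    simp only [MvPowerSeries.coeff_expand_smul]
    exact (MvPowerSeries.WithPiTopology.continuous_coeff ℂ x).tendsto f
  · push Not at hd
    obtain ⟨i, hi⟩ := hd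
    simp only [MvPowerSeries.coeff_expand_of_not_dvd _ _ _ hi]
    exact tendsto_const_nhds

theorem rename_powerSum {σ τ ι : Type*} (e : σ ↪ τ) (f : ι ↪ σ) {r : ℕ} (hr : 0 < r) :
    MvPowerSeries.rename e (powerSum (fun i => MvPowerSeries.X (R := ℂ) (f i)) r) =
      powerSum (fun i => MvPowerSeries.X (e (f i))) r := by
  have h := (hasSum_X_pow f hr).map (MvPowerSeries.rename (R := ℂ) e) (continuous_rename e)
  refine h.unique ?_
  have h2 : HasSum (fun i => (MvPowerSeries.X (e (f i)) : MvPowerSeries τ ℂ) ^ r)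
      (powerSum (fun i => MvPowerSeries.X (e (f i))) r) := hasSum_X_pow (f.trans e) hr
  convert h2 using 2 with i
  simp

theorem expand_powerSum {σ ι : Type*} (f : ι ↪ σ) {l r : ℕ} (hl : l ≠ 0) (hr : 0 < r) :
    MvPowerSeries.expand l hl (powerSum (fun i => MvPowerSeries.X (R := ℂ) (f i)) r) =
      powerSum (fun i => MvPowerSeries.X (f i)) (l * r) := by
  have h := (hasSum_X_pow f hr).map (MvPowerSeries.expand (σ := σ) (R := ℂ) l hl)
    (continuous_expand hl)
  refine h.unique ?_
  convert hasSum_X_pow f (Nat.mul_pos (Nat.pos_of_ne_zero hl) hr) using 2 with i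
  simp [pow_mul]

/-- A coefficient of either side vanishes unless its exponent is divisible by `l` and supported on
the range of `e`. The two conditions are compatible because `x` and `l • x` have the same support.
-/
theorem expand_rename {σ τ : Type*} (e : σ ↪ τ) {l : ℕ} (hl : l ≠ 0) (f : MvPowerSeries σ ℂ) :
    MvPowerSeries.expand l hl (MvPowerSeries.rename e f) =
      MvPowerSeries.rename e (MvPowerSeries.expand l hl f) := by
  ext d
  by_cases hd : ∀ i, l ∣ d i
  · obtain ⟨x, rfl⟩ := exists_eq_smul_of_dvd d hd
    rw [MvPowerSeries.coeff_expand_smul]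
    by_cases hx : x ∈ Set.range (Finsupp.mapDomain e)
    · obtain ⟨y, rfl⟩ := hx
      have hy : l • y.mapDomain e = (l • y).mapDomain e := by rw [Finsupp.mapDomain_smul]
      rw [hy, ← Finsupp.embDomain_eq_mapDomain, ← Finsupp.embDomain_eq_mapDomain,
        MvPowerSeries.coeff_embDomain_rename, MvPowerSeries.coeff_embDomain_rename,
        MvPowerSeries.coeff_expand_smul]
    · rw [MvPowerSeries.coeff_rename_eq_zero _ _ hx, MvPowerSeries.coeff_rename_eq_zero]
      rintro ⟨y, hy⟩
      refine hx ?_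
      rw [← Finsupp.embDomain_eq_mapDomain] at hy
      have hr : x ∈ Set.range (Finsupp.embDomain e) := by
        rw [Finsupp.mem_range_embDomain_iff]
        have h2 : (l • x) ∈ Set.range (Finsupp.embDomain e) := ⟨y, hy⟩
        rw [Finsupp.mem_range_embDomain_iff] at h2
        intro i hi
        refine h2 ?_
        simp only [Finset.mem_coe, Finsupp.mem_support_iff, Finsupp.smul_apply, smul_eq_mul] at hi ⊢
        exact mul_ne_zero hl hi
      obtain ⟨u, hu⟩ := hr
      exact ⟨u, by rw [← Finsupp.embDomain_eq_mapDomain, hu]⟩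
  · push Not at hd
    obtain ⟨i, hi⟩ := hd
    rw [MvPowerSeries.coeff_expand_of_not_dvd _ _ _ hi]
    by_cases hx : d ∈ Set.range (Finsupp.mapDomain e)
    · obtain ⟨y, rfl⟩ := hx
      have hie : i ∈ Set.range e := by
        by_contra hc
        rw [Finsupp.mapDomain_of_notMem_range _ _ hc] at hi
        exact hi (dvd_zero l)
      obtain ⟨j, rfl⟩ := hie
      rw [Finsupp.mapDomain_apply e.injective] at hi
      rw [← Finsupp.embDomain_eq_mapDomain, MvPowerSeries.coeff_embDomain_rename,
        MvPowerSeries.coeff_expand_of_not_dvd _ _ _ hi]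
    · rw [MvPowerSeries.coeff_rename_eq_zero _ _ hx]

end Summation

/-- The power sum `p_r` in the variables `x₀, x₁, …`. -/
abbrev pX (r : ℕ) : MvPowerSeries ℕ ℂ := powerSum (fun i : ℕ => MvPowerSeries.X i) r

theorem coe_pSym (lam : Par) : (pSym lam : MvPowerSeries ℕ ℂ) = parProd pX lam := rfl

theorem parProd_congr {R : Type*} [CommMonoid R] {c d : ℕ → R} (h : ∀ r, 0 < r → c r = d r)
    (lam : Par) : parProd c lam = parProd d lam :=
  congrArg Multiset.prod (Multiset.map_congr rfl fun r hr => h r (lam.pos hr))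

theorem parProd_mul {R : Type*} [CommMonoid R] (c d : ℕ → R) (lam : Par) :
    parProd (fun r => c r * d r) lam = parProd c lam * parProd d lam := Multiset.prod_map_mul

theorem parProd_smul {R : Type*} [CommRing R] [Algebra ℂ R] (a : ℕ → ℂ) (c : ℕ → R) (lam : Par) :
    parProd (fun r => a r • c r) lam = parProd a lam • parProd c lam := by
  simp only [Algebra.smul_def]
  rw [parProd_mul, parProd, parProd, parProd, map_multiset_prod, Multiset.map_map]
  rfl

theorem map_parProd {R S : Type*} [CommSemiring R] [CommSemiring S] (φ : R →+* S) (c : ℕ → R)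
    (lam : Par) : φ (parProd c lam) = parProd (fun r => φ (c r)) lam := by
  rw [parProd, parProd, map_multiset_prod, Multiset.map_map]
  rfl

theorem expCoeff_congr {R : Type*} [CommRing R] [Algebra ℂ R] {c d : ℕ → R}
    (h : ∀ r, 0 < r → c r = d r) (n : ℕ) : expCoeff c n = expCoeff d n :=
  Finset.sum_congr rfl fun lam _ => by rw [parProd_congr h]

/-! ### Newton's identities for the complete symmetric functions and their plethysm. -/

theorem coeff_pX_mul {r : ℕ} (hr : 0 < r) (F : MvPowerSeries ℕ ℂ) (b : ℕ →₀ ℕ) :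
    MvPowerSeries.coeff b (pX r * F) = ∑ k ∈ b.support,
      if r ≤ b k then MvPowerSeries.coeff (b - Finsupp.single k r) F else 0 := by
  have h := (hasSum_X_pow (Function.Embedding.refl ℕ) hr).mul_right F
  rw [MvPowerSeries.WithPiTopology.hasSum_iff_hasSum_coeff] at h
  refine (h b).unique ?_
  have hk : ∀ k, MvPowerSeries.coeff b
      ((MvPowerSeries.X (Function.Embedding.refl ℕ k) : MvPowerSeries ℕ ℂ) ^ r * F) =
      if r ≤ b k then MvPowerSeries.coeff (b - Finsupp.single k r) F else 0 := by
    intro k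
    rw [MvPowerSeries.X_pow_eq, MvPowerSeries.coeff_monomial_mul, one_mul]
    exact if_congr Finsupp.single_le_iff rfl rfl
  simp only [hk]
  refine hasSum_sum_of_ne_finset_zero fun k hk => if_neg ?_
  rw [Finsupp.notMem_support_iff.1 hk]
  omega

/-- At a monomial with exponent `b` of degree `n + 1`, the right-hand side counts the pairs `(k, r)`
with `1 ≤ r ≤ b k`. There are `b k` of them for each `k`, hence `n + 1` in all. -/
theorem isNewton_h : IsNewton pX (PowerSeries.mk fun n => (hSym n : MvPowerSeries ℕ ℂ)) := by
  classical
  refine isNewton_iff.2 ⟨?_, fun n => ?_⟩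
  · ext b
    rw [hSym, coeff_series, MvPowerSeries.coeff_one]
    exact if_congr (Finsupp.degree_eq_zero_iff b) rfl rfl
  · ext b
    rw [map_sum, Finset.sum_congr rfl fun p _ => coeff_pX_mul (Nat.succ_pos p.1)
      (hSym p.2 : MvPowerSeries ℕ ℂ) b]
    have hL : MvPowerSeries.coeff b ((hSym (n + 1) : MvPowerSeries ℕ ℂ) * ((n : MvPowerSeries ℕ ℂ)
        + 1)) = if b.degree = n + 1 then ((n + 1 : ℕ) : ℂ) else 0 := by
      have : ((n : MvPowerSeries ℕ ℂ) + 1) = MvPowerSeries.C ((n : ℂ) + 1) := by simp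
      rw [this, MvPowerSeries.coeff_mul_C, hSym, coeff_series]
      split_ifs <;> simp
    rw [hL, Finset.sum_comm]
    have hcoef : ∀ k ∈ b.support, ∀ p ∈ Finset.HasAntidiagonal.antidiagonal n,
        (if p.1 + 1 ≤ b k then MvPowerSeries.coeff (b - Finsupp.single k (p.1 + 1))
          (hSym p.2 : MvPowerSeries ℕ ℂ) else 0) =
        if b.degree = n + 1 ∧ p.1 < b k then 1 else 0 := by
      intro k _ p hp
      rw [Finset.HasAntidiagonal.mem_antidiagonal] at hp
      rw [hSym, coeff_series, ← ite_and]
      refine if_congr ⟨?_, ?_⟩ rfl rfl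
      · rintro ⟨h1, h2⟩
        have h3 := congrArg Finsupp.degree (tsub_add_cancel_of_le (Finsupp.single_le_iff.2 h1))
        rw [map_add, Finsupp.degree_single, h2] at h3
        omega
      · rintro ⟨h1, h2⟩
        have h3 := congrArg Finsupp.degree
          (tsub_add_cancel_of_le (Finsupp.single_le_iff.2 (Nat.succ_le_of_lt h2)))
        rw [map_add, Finsupp.degree_single] at h3
        simp only [Nat.succ_eq_add_one] at h3
        omega
    rw [Finset.sum_congr rfl fun k hk => Finset.sum_congr rfl (hcoef k hk)]
    split_ifs with hb
    · have hk : ∀ k ∈ b.support, ∑ p ∈ Finset.HasAntidiagonal.antidiagonal n,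
          (if b.degree = n + 1 ∧ p.1 < b k then (1 : ℂ) else 0) = b k := by
        intro k _
        rw [Finset.Nat.sum_antidiagonal_eq_sum_range_succ_mk]
        simp only [hb, true_and]
        rw [Finset.sum_boole]
        congr 1
        have hle : b k ≤ n + 1 := hb ▸ Finsupp.le_degree k b
        have : (Finset.range n.succ).filter (fun i => i < b k) = Finset.range (b k) := by
          ext i
          simp only [Finset.mem_filter, Finset.mem_range]
          omega
        rw [this, Finset.card_range]
      rw [Finset.sum_congr rfl hk, ← hb, Finsupp.degree_apply, Nat.cast_sum]
    · simp [hb]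

theorem coe_hSym (n : ℕ) : (hSym n : MvPowerSeries ℕ ℂ) = expCoeff pX n :=
  expCoeff_eq isNewton_h n

theorem hSym_eq (n : ℕ) : hSym n = ∑ lam ∈ parOf n, ((lam.z : ℂ)⁻¹) • pSym lam := by
  refine Subtype.ext ?_
  rw [coe_hSym, expCoeff, AddSubmonoidClass.coe_finsetSum]
  rfl

theorem plethysm_pSym {σ : Type*} (A : MvPowerSeries σ ℂ) (lam : Par) :
    plethysm A (pSym lam) = parProd (fun r => adams r A) lam := by
  change pBasis.constr ℂ (fun lam : Par => (lam.parts.map fun r => adams r A).prod) (pSym lam) = _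
  rw [← pBasis_apply, Module.Basis.constr_basis]
  rfl

theorem plethysm_hSym {σ : Type*} (A : MvPowerSeries σ ℂ) (n : ℕ) :
    plethysm A (hSym n) = expCoeff (fun r => adams r A) n := by
  rw [hSym_eq, map_sum, expCoeff]
  exact Finset.sum_congr rfl fun lam _ => by rw [map_smul, plethysm_pSym]

/-! ### The series `Ω(Y; ζ)` -/

/-- `∑_b ζ^{|b|} y^b`, the expansion of `∏_i (1 - ζ y_i)⁻¹`. -/
def hSeries (ζ : ℂ) : MvPowerSeries ℕ ℂ := series fun b => ζ ^ b.degree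

open Classical in
/-- The part of `hSeries ζ` in the variables from `s`. -/
def hSeriesOn (ζ : ℂ) (s : Finset ℕ) : MvPowerSeries ℕ ℂ :=
  series fun b => if b.support ⊆ s then ζ ^ b.degree else 0

/-- A geometric series in one variable: the monomials divisible by `y_i` cancel in pairs, and those
free of `y_i` remain. -/
theorem one_sub_mul_hSeriesOn (ζ : ℂ) {s : Finset ℕ} {i : ℕ} (hi : i ∉ s) :
    (1 - MvPowerSeries.C ζ * MvPowerSeries.X i) * hSeriesOn ζ (insert i s) = hSeriesOn ζ s := by
  classical
  ext b
  have hX : (MvPowerSeries.X i : MvPowerSeries ℕ ℂ) =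
      MvPowerSeries.monomial (Finsupp.single i 1) 1 := rfl
  rw [sub_mul, one_mul, mul_assoc, map_sub, MvPowerSeries.coeff_C_mul, hX,
    MvPowerSeries.coeff_monomial_mul, one_mul]
  simp only [hSeriesOn, coeff_series, Finsupp.single_le_iff]
  by_cases hb : 1 ≤ b i
  · have hadd := tsub_add_cancel_of_le (Finsupp.single_le_iff.2 hb)
    have hdeg := congrArg Finsupp.degree hadd
    rw [map_add, Finsupp.degree_single] at hdeg
    have hs : (b - Finsupp.single i 1).support ⊆ insert i s ↔ b.support ⊆ insert i s := by
      constructor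
      · intro h j hj
        by_cases hji : j = i
        · exact hji ▸ Finset.mem_insert_self i s
        · refine h ?_
          rw [Finsupp.mem_support_iff] at hj ⊢
          simpa [Ne.symm hji] using hj
      · exact fun h => (Finsupp.support_mono tsub_le_self).trans h
    have hns : ¬ b.support ⊆ s := fun h => hi (h (Finsupp.mem_support_iff.2 (by omega)))
    simp only [if_pos hb, hs, if_neg hns]
    split_ifs
    · rw [← hdeg, pow_succ]
      ring
    · ring
  · have hb0 : b i = 0 := by omega
    have hs : b.support ⊆ insert i s ↔ b.support ⊆ s := by
      rw [Finset.subset_insert_iff_of_notMem]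
      simpa using hb0
    simp only [if_neg hb, hs, mul_zero, sub_zero]

theorem constantCoeff_one_sub (ζ : ℂ) {σ : Type*} (i : σ) :
    MvPowerSeries.constantCoeff (1 - MvPowerSeries.C ζ * MvPowerSeries.X i) ≠ 0 := by
  simp

theorem prod_inv_eq_hSeriesOn (ζ : ℂ) (s : Finset ℕ) :
    ∏ i ∈ s, (1 - MvPowerSeries.C ζ * MvPowerSeries.X i)⁻¹ = hSeriesOn ζ s := by
  classical
  induction s using Finset.induction with
  | empty =>
    ext b
    rw [Finset.prod_empty, MvPowerSeries.coeff_one, hSeriesOn, coeff_series]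
    by_cases hb : b = 0
    · subst hb; simp
    · rw [if_neg hb, if_neg]
      simpa using hb
  | insert i s hi ih =>
    rw [Finset.prod_insert hi, ih, ← one_sub_mul_hSeriesOn ζ hi, ← mul_assoc,
      MvPowerSeries.inv_mul_cancel _ (constantCoeff_one_sub ζ i), one_mul]

/-- The coefficient at `d` of a finite partial product is constant as soon as the product includes
all variables in the support of `d`. -/
theorem hasProd_hSeries (ζ : ℂ) :
    HasProd (fun i : ℕ => (1 - MvPowerSeries.C ζ * MvPowerSeries.X i)⁻¹) (hSeries ζ) := by
  rw [HasProd, MvPowerSeries.WithPiTopology.tendsto_iff_coeff_tendsto]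
  intro d
  refine tendsto_const_nhds.congr' ?_
  rw [SummationFilter.unconditional_filter]
  filter_upwards [Filter.eventually_ge_atTop d.support] with s hs
  rw [prod_inv_eq_hSeriesOn, hSeriesOn, hSeries, coeff_series, coeff_series, if_pos hs]

theorem omegaProd_X {σ : Type*} (e : ℕ ↪ σ) (ζ : ℂ) :
    omegaProd (fun i : ℕ => MvPowerSeries.X (e i)) ζ = MvPowerSeries.rename e (hSeries ζ) := by
  have h := (hasProd_hSeries ζ).map (MvPowerSeries.rename (R := ℂ) e) (continuous_rename e)
  rw [omegaProd, ← h.tprod_eq]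
  refine tprod_congr fun i => ?_
  symm
  rw [Function.comp_apply, MvPowerSeries.eq_inv_iff_mul_eq_one (constantCoeff_one_sub ζ _)]
  have : (1 - MvPowerSeries.C ζ * MvPowerSeries.X (e i) : MvPowerSeries σ ℂ) =
      MvPowerSeries.rename e (1 - MvPowerSeries.C ζ * MvPowerSeries.X i) := by simp
  rw [this, ← map_mul, MvPowerSeries.inv_mul_cancel _ (constantCoeff_one_sub ζ i), map_one]

/-! ### Series in two sets of variables -/

/-- A series in `x`, as a series in `x` and `y`. -/
abbrev inX {σ : Type*} : MvPowerSeries σ ℂ →ₐ[ℂ] MvPowerSeries (σ ⊕ ℕ) ℂ :=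
  MvPowerSeries.rename (Function.Embedding.inl : σ ↪ σ ⊕ ℕ)

/-- A series in `y`, as a series in `x` and `y`. -/
abbrev inY {σ : Type*} : MvPowerSeries ℕ ℂ →ₐ[ℂ] MvPowerSeries (σ ⊕ ℕ) ℂ :=
  MvPowerSeries.rename (Function.Embedding.inr : ℕ ↪ σ ⊕ ℕ)

/-- The variable sets are disjoint, so an exponent splits in only one way into an `X`-part and a
`Y`-part. -/
theorem coeff_inX_mul_inY {σ : Type*} (a : σ →₀ ℕ) (b : ℕ →₀ ℕ) (f : MvPowerSeries σ ℂ)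
    (g : MvPowerSeries ℕ ℂ) : MvPowerSeries.coeff (a.sumElim b) (inX f * inY g) =
      MvPowerSeries.coeff a f * MvPowerSeries.coeff b g := by
  classical
  have hab : a.sumElim b = a.embDomain Function.Embedding.inl +
      b.embDomain Function.Embedding.inr := by
    rw [Finsupp.sumElim_eq_add, Finsupp.embDomain_eq_mapDomain, Finsupp.embDomain_eq_mapDomain]
    rfl
  rw [MvPowerSeries.coeff_mul, Finset.sum_eq_single (a.embDomain Function.Embedding.inl,
    b.embDomain Function.Embedding.inr), MvPowerSeries.coeff_embDomain_rename,
    MvPowerSeries.coeff_embDomain_rename]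
  · rintro ⟨u, v⟩ huv hne
    rw [Finset.HasAntidiagonal.mem_antidiagonal] at huv
    by_contra hc
    obtain ⟨hu, hv⟩ := ne_zero_and_ne_zero_of_mul hc
    have hu' : u ∈ Set.range (Finsupp.mapDomain (Function.Embedding.inl : σ ↪ σ ⊕ ℕ)) := by
      by_contra h
      exact hu (MvPowerSeries.coeff_rename_eq_zero _ _ h)
    have hv' : v ∈ Set.range (Finsupp.mapDomain (Function.Embedding.inr : ℕ ↪ σ ⊕ ℕ)) := by
      by_contra h
      exact hv (MvPowerSeries.coeff_rename_eq_zero _ _ h)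
    obtain ⟨u, rfl⟩ := hu'
    obtain ⟨v, rfl⟩ := hv'
    have h1 : u.sumElim v = a.sumElim b := by
      rw [Finsupp.sumElim_eq_add]
      exact huv
    have hua : u = a := Finsupp.ext fun i => by
      have := DFunLike.congr_fun h1 (Sum.inl i)
      simpa using this
    have hvb : v = b := Finsupp.ext fun i => by
      have := DFunLike.congr_fun h1 (Sum.inr i)
      simpa using this
    exact hne (by rw [hua, hvb, Finsupp.embDomain_eq_mapDomain, Finsupp.embDomain_eq_mapDomain])
  · intro h
    exact absurd (Finset.HasAntidiagonal.mem_antidiagonal.2 hab.symm) h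

/-! ### The expansion of the kernel -/

variable {m : ℕ} [NeZero m]

/-- The finite set of all `ρ ∈ Φ` with `|ρ| = n`. -/
def phiOf (m n : ℕ) [NeZero m] : Finset (Phi m) :=
  (@Set.toFinite _ {ρ : Phi m | ρ.size = n} (finite_phi n)).toFinset

theorem mem_phiOf {n : ℕ} {ρ : Phi m} : ρ ∈ phiOf m n ↔ ρ.size = n := by
  simp [phiOf]

/-- `∏_ζ ∏_{l ∈ ρ(ζ)} Ω(Y^l; ζ)`. -/
def cauchySeries (ρ : Phi m) : MvPowerSeries ℕ ℂ :=
  ∏ ζ : rootsOfUnity m ℂ, parProd (fun l => adams l (hSeries ((ζ : ℂˣ) : ℂ))) (ρ ζ)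

/-- The embedding of the variable set `X_ζ`. -/
def varEmb (ζ : rootsOfUnity m ℂ) : ℕ ↪ rootsOfUnity m ℂ × ℕ :=
  ⟨fun i => (ζ, i), fun _ _ h => (Prod.ext_iff.1 h).2⟩

/-- The substitution raises variables to the `r`-th power and leaves coefficients alone. So `1/m`
stays `1/m`, and `Ω(Y; ζ)` becomes `Ω(Y^r; ζ)` with the same `ζ`, not with `ζ^r`. -/
theorem adams_kernelAlphabet {r : ℕ} (hr : 0 < r) :
    adams r (kernelAlphabet m) = ∑ ζ : rootsOfUnity m ℂ, (m : ℂ)⁻¹ •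
      (inX (powerSum (fun i : ℕ => MvPowerSeries.X (ζ, i)) r) *
        inY (adams r (hSeries ((ζ : ℂˣ) : ℂ)))) := by
  have hsum : ∀ ζ : rootsOfUnity m ℂ,
      (∑' i : ℕ, (MvPowerSeries.X (Sum.inl (ζ, i)) : MvPowerSeries _ ℂ)) =
        inX (powerSum (fun i : ℕ => MvPowerSeries.X (ζ, i)) 1) := by
    intro ζ
    have := rename_powerSum (Function.Embedding.inl : _ ↪ (rootsOfUnity m ℂ × ℕ) ⊕ ℕ) (varEmb ζ)
      one_pos
    refine Eq.trans ?_ this.symm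
    simp only [powerSum, pow_one]
    rfl
  have hprod : ∀ ζ : rootsOfUnity m ℂ, omegaProd (fun i : ℕ =>
      (MvPowerSeries.X (Sum.inr i) : MvPowerSeries ((rootsOfUnity m ℂ × ℕ) ⊕ ℕ) ℂ))
        ((ζ : ℂˣ) : ℂ) = inY (hSeries ((ζ : ℂˣ) : ℂ)) := fun ζ =>
    omegaProd_X (Function.Embedding.inr : ℕ ↪ (rootsOfUnity m ℂ × ℕ) ⊕ ℕ) _
  rw [kernelAlphabet, adams, dif_neg hr.ne', map_smul, map_sum, Finset.smul_sum, one_div]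
  refine Finset.sum_congr rfl fun ζ _ => ?_
  rw [hsum, hprod, map_mul, expand_rename, expand_rename, adams, dif_neg hr.ne']
  have := expand_powerSum (varEmb ζ) hr.ne' one_pos
  rw [mul_one] at this
  congr 3

/-- The power sums of the alphabet are sums over `ζ`, so `expCoeff_sum` factors `h_n` over `ζ`.
Picking a partition in every factor means picking some `ρ`. Each part carries a factor `1/m`, and
these together with the `1/z` make up `1 / Z_ρ`. -/
theorem plethysm_kernelAlphabet (n : ℕ) :
    plethysm (kernelAlphabet m) (hSym n) =
      ∑ ρ ∈ phiOf m n, ((ρ.Z : ℂ)⁻¹) • (inX (P ρ) * inY (cauchySeries ρ)) := by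
  classical
  rw [plethysm_hSym, expCoeff_congr (fun r hr => adams_kernelAlphabet hr), expCoeff_sum]
  have hterm : ∀ (ζ : rootsOfUnity m ℂ) (lam : Par), ((lam.z : ℂ)⁻¹) • parProd (fun r =>
      (m : ℂ)⁻¹ • (inX (powerSum (fun i : ℕ => MvPowerSeries.X (ζ, i)) r) *
        inY (adams r (hSeries ((ζ : ℂˣ) : ℂ))))) lam =
      (((lam.z * m ^ lam.length : ℕ) : ℂ)⁻¹) •
        (inX (powerSumPar (fun i : ℕ => MvPowerSeries.X (ζ, i)) lam) *
          inY (parProd (fun l => adams l (hSeries ((ζ : ℂˣ) : ℂ))) lam)) := by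
    intro ζ lam
    rw [parProd_smul, parProd_mul, smul_smul]
    congr 1
    · rw [parProd, Multiset.map_const', Multiset.prod_replicate]
      push_cast
      rw [mul_inv, inv_pow]
      rfl
    · congr 1
      · exact (map_parProd (inX (σ := rootsOfUnity m ℂ × ℕ)).toRingHom _ lam).symm
      · exact (map_parProd (inY (σ := rootsOfUnity m ℂ × ℕ)).toRingHom _ lam).symm
  simp only [expCoeff, hterm]
  have hρ : ∀ ρ : Phi m, ∏ ζ : rootsOfUnity m ℂ, (((((ρ ζ).z * m ^ (ρ ζ).length : ℕ) : ℂ)⁻¹) •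
        (inX (powerSumPar (fun i : ℕ => MvPowerSeries.X (ζ, i)) (ρ ζ)) *
          inY (parProd (fun l => adams l (hSeries ((ζ : ℂˣ) : ℂ))) (ρ ζ)))) =
      ((ρ.Z : ℂ)⁻¹) • (inX (P ρ) * inY (cauchySeries ρ)) := by
    intro ρ
    rw [Finset.prod_smul, Finset.prod_mul_distrib, P, cauchySeries, map_prod, map_prod, Phi.Z,
      Nat.cast_prod, Finset.prod_inv_distrib]
  simp only [Finset.prod_univ_sum, hρ]
  rw [Finset.sum_sigma']
  -- The distribution of the degree `n` over `ζ` is redundant data: it is the family of sizes of the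
  -- `ρ(ζ)`.
  refine Finset.sum_bij' (fun x _ => x.2)
    (fun ρ _ => ⟨Finsupp.equivFunOnFinite.symm fun ζ => (ρ ζ).size, ρ⟩) ?_ ?_ ?_ ?_ ?_
  · rintro ⟨l, ρ⟩ h
    simp only [Finset.mem_sigma, Finset.mem_finsuppAntidiag, Fintype.mem_piFinset,
      mem_parOf] at h
    rw [mem_phiOf, Phi.size, Finset.sum_congr rfl fun ζ _ => h.2 ζ]
    exact h.1.1
  · intro ρ h
    simp only [Finset.mem_sigma, Finset.mem_finsuppAntidiag, Fintype.mem_piFinset, mem_parOf]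
    exact ⟨⟨mem_phiOf.1 h, Finset.subset_univ _⟩, fun ζ => rfl⟩
  · rintro ⟨l, ρ⟩ h
    simp only [Finset.mem_sigma, Finset.mem_finsuppAntidiag, Fintype.mem_piFinset,
      mem_parOf] at h
    have : l = Finsupp.equivFunOnFinite.symm fun ζ => (ρ ζ).size :=
      Finsupp.ext fun ζ => (h.2 ζ).symm
    rw [this]
  · intro ρ _
    rfl
  · intro x _
    rfl

/-! ### Homogeneity in `X` -/

theorem isHomogeneous_powerSum {σ ι : Type*} (e : ι ↪ σ) {r : ℕ} (hr : 0 < r) (a : σ →₀ ℕ)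
    (ha : MvPowerSeries.coeff a (powerSum (fun i => MvPowerSeries.X (R := ℂ) (e i)) r) ≠ 0) :
    a.degree = r := by
  classical
  have h := hasSum_X_pow e hr
  rw [MvPowerSeries.WithPiTopology.hasSum_iff_hasSum_coeff] at h
  by_contra hne
  refine ha ((h a).unique ?_)
  convert hasSum_zero with i
  rw [MvPowerSeries.coeff_X_pow, if_neg]
  rintro rfl
  simp at hne

theorem degree_of_coeff_mul {σ : Type*} {f g : MvPowerSeries σ ℂ} {d k : ℕ}
    (hf : ∀ a, MvPowerSeries.coeff a f ≠ 0 → a.degree = d)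
    (hg : ∀ a, MvPowerSeries.coeff a g ≠ 0 → a.degree = k) (a : σ →₀ ℕ)
    (ha : MvPowerSeries.coeff a (f * g) ≠ 0) : a.degree = d + k := by
  classical
  rw [MvPowerSeries.coeff_mul] at ha
  obtain ⟨p, hp, h⟩ := Finset.exists_ne_zero_of_sum_ne_zero ha
  rw [← Finset.HasAntidiagonal.mem_antidiagonal.1 hp, map_add, hf _ (left_ne_zero_of_mul h),
    hg _ (right_ne_zero_of_mul h)]

theorem degree_of_coeff_one {σ : Type*} (a : σ →₀ ℕ)
    (ha : MvPowerSeries.coeff a (1 : MvPowerSeries σ ℂ) ≠ 0) : a.degree = 0 := by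
  classical
  rw [MvPowerSeries.coeff_one] at ha
  by_cases h : a = 0
  · simp [h]
  · exact absurd (if_neg h) ha

theorem degree_of_coeff_parProd {σ : Type*} {c : ℕ → MvPowerSeries σ ℂ}
    (hc : ∀ r, 0 < r → ∀ a, MvPowerSeries.coeff a (c r) ≠ 0 → a.degree = r) (lam : Par) :
    ∀ a, MvPowerSeries.coeff a (parProd c lam) ≠ 0 → a.degree = lam.size := by
  have : ∀ s : Multiset ℕ, (∀ r ∈ s, 0 < r) → ∀ a,
      MvPowerSeries.coeff a (s.map c).prod ≠ 0 → a.degree = s.sum := by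
    intro s
    induction s using Multiset.induction with
    | empty => exact fun _ a ha => degree_of_coeff_one a (by simpa using ha)
    | cons r s ih =>
      intro hs a ha
      rw [Multiset.map_cons, Multiset.prod_cons] at ha
      rw [Multiset.sum_cons]
      exact degree_of_coeff_mul (hc r (hs r (Multiset.mem_cons_self r s)))
        (ih fun q hq => hs q (Multiset.mem_cons_of_mem hq)) a ha
  rw [← lam.sum_parts]
  exact this _ fun r hr => lam.pos hr

/-- The source of all convergence statements: an exponent `a` in `X` sees only the finitely many `ρ`
of size `a.degree`. -/
theorem degree_of_coeff_P (ρ : Phi m) (a : rootsOfUnity m ℂ × ℕ →₀ ℕ)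
    (ha : MvPowerSeries.coeff a (P ρ) ≠ 0) : a.degree = ρ.size := by
  classical
  have : ∀ s : Finset (rootsOfUnity m ℂ), ∀ a, MvPowerSeries.coeff a
      (∏ ζ ∈ s, powerSumPar (fun i : ℕ => MvPowerSeries.X (R := ℂ) (ζ, i)) (ρ ζ)) ≠ 0 →
      a.degree = ∑ ζ ∈ s, (ρ ζ).size := by
    intro s
    induction s using Finset.induction with
    | empty => exact fun a ha => degree_of_coeff_one a (by simpa using ha)
    | insert ζ s hζ ih =>
      intro a ha
      rw [Finset.prod_insert hζ] at ha
      rw [Finset.sum_insert hζ]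
      exact degree_of_coeff_mul (degree_of_coeff_parProd (fun r hr =>
        isHomogeneous_powerSum (varEmb ζ) hr) (ρ ζ)) ih a ha
  exact this Finset.univ a ha

theorem eq_sumElim {σ : Type*} (c : σ ⊕ ℕ →₀ ℕ) : ∃ (a : σ →₀ ℕ) (b : ℕ →₀ ℕ), c = a.sumElim b :=
  ⟨_, _, (Finsupp.sumFinsuppEquivProdFinsupp.symm_apply_apply c).symm⟩

theorem coeff_plethysm_kernelAlphabet (n : ℕ) (a : rootsOfUnity m ℂ × ℕ →₀ ℕ) (b : ℕ →₀ ℕ) :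
    MvPowerSeries.coeff (a.sumElim b) (plethysm (kernelAlphabet m) (hSym n)) =
      ∑ ρ ∈ phiOf m n, (ρ.Z : ℂ)⁻¹ *
        (MvPowerSeries.coeff a (P ρ) * MvPowerSeries.coeff b (cauchySeries ρ)) := by
  rw [plethysm_kernelAlphabet, map_sum]
  exact Finset.sum_congr rfl fun ρ _ => by rw [map_smul, coeff_inX_mul_inY, smul_eq_mul]

theorem coeff_plethysm_kernelAlphabet_of_ne {n : ℕ} {a : rootsOfUnity m ℂ × ℕ →₀ ℕ}
    (hn : n ≠ a.degree) (b : ℕ →₀ ℕ) :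
    MvPowerSeries.coeff (a.sumElim b) (plethysm (kernelAlphabet m) (hSym n)) = 0 := by
  rw [coeff_plethysm_kernelAlphabet]
  refine Finset.sum_eq_zero fun ρ hρ => ?_
  have : MvPowerSeries.coeff a (P ρ) = 0 := by
    by_contra h
    exact hn (by rw [degree_of_coeff_P ρ a h, mem_phiOf.1 hρ])
  rw [this, zero_mul, mul_zero]

/-- The term `h_n` is homogeneous of degree `n` in `X`, although it is of unbounded degree in `Y`.
Hence one value of `n` contributes to a given coefficient. -/
theorem hasSum_coeff_kernel (a : rootsOfUnity m ℂ × ℕ →₀ ℕ) (b : ℕ →₀ ℕ) :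
    HasSum (fun n => MvPowerSeries.coeff (a.sumElim b) (plethysm (kernelAlphabet m) (hSym n)))
      (MvPowerSeries.coeff (a.sumElim b) (plethysm (kernelAlphabet m) (hSym a.degree))) :=
  hasSum_single _ fun _ hn => coeff_plethysm_kernelAlphabet_of_ne hn b

theorem summable_kernel :
    Summable (fun n : ℕ => plethysm (kernelAlphabet m) (hSym n)) := by
  rw [MvPowerSeries.WithPiTopology.summable_iff_summable_coeff]
  intro d
  obtain ⟨a, b, rfl⟩ := eq_sumElim d
  exact (hasSum_coeff_kernel a b).summable

theorem coeffX_kernel (a : rootsOfUnity m ℂ × ℕ →₀ ℕ) :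
    coeffX a (plethysticExp (kernelAlphabet m)) = ∑ ρ ∈ phiOf m a.degree,
      ((ρ.Z : ℂ)⁻¹ * MvPowerSeries.coeff a (P ρ)) • cauchySeries ρ := by
  ext b
  rw [coeffX, coeff_series, plethysticExp, map_sum]
  have h := (MvPowerSeries.WithPiTopology.hasSum_iff_hasSum_coeff).1
    (summable_kernel (m := m)).hasSum (a.sumElim b)
  rw [h.unique (hasSum_coeff_kernel a b), coeff_plethysm_kernelAlphabet]
  exact Finset.sum_congr rfl fun ρ _ => by rw [map_smul, smul_eq_mul, mul_assoc]

/-! ### Homogeneous components of the Cauchy kernel -/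

/-- A splitting of the exponent `b` determines the degrees of its two pieces, so it is counted for
exactly one pair of degrees. This makes `components` multiplicative. -/
theorem homogeneousComponent_mul (F G : MvPowerSeries ℕ ℂ) (d : ℕ) :
    MvPowerSeries.homogeneousComponent d (F * G) = ∑ p ∈ Finset.HasAntidiagonal.antidiagonal d,
      MvPowerSeries.homogeneousComponent p.1 F * MvPowerSeries.homogeneousComponent p.2 G := by
  classical
  ext b
  rw [map_sum]
  simp only [MvPowerSeries.coeff_mul, MvPowerSeries.coeff_homogeneousComponent]
  rw [Finset.sum_comm]
  have h : ∀ y ∈ Finset.HasAntidiagonal.antidiagonal b,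
      ∑ x ∈ Finset.HasAntidiagonal.antidiagonal d,
        (if y.1.degree = x.1 then MvPowerSeries.coeff y.1 F else 0) *
          (if y.2.degree = x.2 then MvPowerSeries.coeff y.2 G else 0) =
      if b.degree = d then MvPowerSeries.coeff y.1 F * MvPowerSeries.coeff y.2 G else 0 := by
    intro y hy
    have hb := congrArg Finsupp.degree (Finset.HasAntidiagonal.mem_antidiagonal.1 hy)
    rw [map_add] at hb
    simp only [ite_zero_mul_ite_zero]
    by_cases hd : b.degree = d
    · rw [Finset.sum_eq_single (y.1.degree, y.2.degree)]
      · simp [hd]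
      · rintro ⟨i, j⟩ _ hne
        refine if_neg ?_
        rintro ⟨rfl, rfl⟩
        exact hne rfl
      · intro hn
        exact absurd (Finset.HasAntidiagonal.mem_antidiagonal.2 (hb.trans hd)) hn
    · rw [if_neg hd]
      refine Finset.sum_eq_zero fun p hp => if_neg ?_
      have := Finset.HasAntidiagonal.mem_antidiagonal.1 hp
      omega
  rw [Finset.sum_congr rfl h]
  split_ifs <;> simp

/-- The homogeneous components of a series, as the coefficients of a power series. -/
def components : MvPowerSeries ℕ ℂ →* PowerSeries (MvPowerSeries ℕ ℂ) where
  toFun F := PowerSeries.mk fun d => MvPowerSeries.homogeneousComponent d F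
  map_one' := by
    classical
    ext d b
    rw [PowerSeries.coeff_mk, MvPowerSeries.coeff_homogeneousComponent, PowerSeries.coeff_one]
    by_cases hb : b = 0
    · subst hb
      by_cases hd : d = 0
      · simp [hd]
      · simp [hd, Ne.symm hd]
    · rw [MvPowerSeries.coeff_one, if_neg hb, ite_self]
      split_ifs
      · rw [MvPowerSeries.coeff_one, if_neg hb]
      · simp
  map_mul' F G := by
    ext1 d
    rw [PowerSeries.coeff_mul, PowerSeries.coeff_mk, homogeneousComponent_mul]
    simp only [PowerSeries.coeff_mk]

theorem components_apply (F : MvPowerSeries ℕ ℂ) :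
    components F = PowerSeries.mk fun d => MvPowerSeries.homogeneousComponent d F := rfl

/-! ### Newton's recursion under ring maps, scaling and dilation of the variable. -/

section Newton

variable {R S : Type*} [CommRing R] [CommRing S]

theorem IsNewton.map (φ : R →+* S) {c f : ℕ → R} (h : IsNewton c (PowerSeries.mk f)) :
    IsNewton (fun r => φ (c r)) (PowerSeries.mk fun n => φ (f n)) := by
  rw [isNewton_iff] at h ⊢
  refine ⟨by rw [h.1, map_one], fun n => ?_⟩
  have := congrArg φ (h.2 n)
  simpa using this

/-- This is the substitution `t ↦ ζ t`. -/
theorem IsNewton.scale [Algebra ℂ R] (ζ : ℂ) {c f : ℕ → R} (h : IsNewton c (PowerSeries.mk f)) :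
    IsNewton (fun r => ζ ^ r • c r) (PowerSeries.mk fun n => ζ ^ n • f n) := by
  rw [isNewton_iff] at h ⊢
  refine ⟨by rw [h.1, pow_zero, one_smul], fun n => ?_⟩
  rw [smul_mul_assoc, h.2, Finset.smul_sum]
  refine Finset.sum_congr rfl fun p hp => ?_
  rw [smul_mul_smul_comm, ← pow_add]
  have := Finset.HasAntidiagonal.mem_antidiagonal.1 hp
  congr 2
  omega

/-- This is the substitution `t ↦ t^l`; the factor `l` in the new power sums comes from the chain
rule. -/
theorem IsNewton.dilate {l : ℕ} (hl : 0 < l) {c f : ℕ → R} (h : IsNewton c (PowerSeries.mk f)) :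
    IsNewton (fun r => if l ∣ r then (l : R) * c (r / l) else 0)
      (PowerSeries.mk fun n => if l ∣ n then f (n / l) else 0) := by
  rw [isNewton_iff] at h ⊢
  refine ⟨by simpa using h.1, fun n => ?_⟩
  by_cases hn : l ∣ n + 1
  · obtain ⟨k, hk⟩ := hn
    cases k with
    | zero => simp at hk
    | succ k =>
      have hn : (n : R) + 1 = l * (k + 1) := by exact_mod_cast congrArg (Nat.cast (R := R)) hk
      rw [if_pos ⟨_, hk⟩, hk, Nat.mul_div_cancel_left _ hl, hn, mul_left_comm, h.2, Finset.mul_sum]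
      -- The first entry stores the power sum index minus one, so multiplying that index by `l`
      -- sends `i` to `l (i + 1) - 1`. All pairs outside the image contribute zero.
      refine Finset.sum_of_injOn (fun p => (l * (p.1 + 1) - 1, l * p.2)) ?_ ?_ ?_ ?_
      · rintro ⟨i, j⟩ hij ⟨i', j'⟩ hij' heq
        simp only [Finset.mem_coe, Finset.HasAntidiagonal.mem_antidiagonal] at hij hij'
        have h2 : l * j = l * j' := (Prod.ext_iff.1 heq).2
        have h3 := Nat.eq_of_mul_eq_mul_left hl h2
        ext <;> simp <;> omega
      · rintro ⟨i, j⟩ hij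
        simp only [Finset.mem_coe, Finset.HasAntidiagonal.mem_antidiagonal] at hij ⊢
        have h1 : l * (i + 1) + l * j = n + 1 := by rw [← mul_add, hk, ← hij]; ring
        have h2 : 0 < l * (i + 1) := Nat.mul_pos hl (Nat.succ_pos i)
        omega
      · rintro ⟨i, j⟩ hij hne
        rw [Finset.HasAntidiagonal.mem_antidiagonal] at hij
        by_cases h1 : l ∣ i + 1
        · by_cases h2 : l ∣ j
          · refine absurd ?_ hne
            obtain ⟨s, hs⟩ := h1
            obtain ⟨t, rfl⟩ := h2
            cases s with
            | zero => simp at hs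
            | succ s =>
              refine ⟨(s, t), ?_, ?_⟩
              · simp only [Finset.mem_coe, Finset.HasAntidiagonal.mem_antidiagonal]
                have : l * (s + 1 + t) = l * (k + 1) := by rw [mul_add, ← hs, ← hk, ← hij]; ring
                have := Nat.eq_of_mul_eq_mul_left hl this
                omega
              · simp [← hs]
          · simp [h2]
        · simp [h1]
      · rintro ⟨i, j⟩ _
        have h2 : 0 < l * (i + 1) := Nat.mul_pos hl (Nat.succ_pos i)
        have h3 : l * (i + 1) - 1 + 1 = l * (i + 1) := by omega
        simp only [h3, Nat.mul_div_cancel_left _ hl, dvd_mul_right, if_true]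
        ring
  · rw [if_neg hn, zero_mul]
    symm
    refine Finset.sum_eq_zero fun p hp => ?_
    rw [Finset.HasAntidiagonal.mem_antidiagonal] at hp
    by_cases h1 : l ∣ p.1 + 1
    · have h2 : ¬ l ∣ p.2 := fun h2 => hn (by
        have := dvd_add h1 h2
        rwa [show p.1 + 1 + p.2 = n + 1 by omega] at this)
      rw [if_neg h2, mul_zero]
    · rw [if_neg h1, zero_mul]

end Newton

theorem IsNewton.congr {R : Type*} [CommRing R] {c d : ℕ → R} {F : PowerSeries R}
    (h : IsNewton c F) (hcd : ∀ r, 0 < r → c r = d r) : IsNewton d F := by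
  have : (fun n => c (n + 1)) = fun n => d (n + 1) := funext fun n => hcd _ (Nat.succ_pos n)
  rw [IsNewton, ← this]
  exact h

/-- The monomials involved are `y^(l b)` with coefficient `ζ^|b|`. In degree `d = l |b|` the power
of `ζ` is therefore `d / l`. -/
theorem homogeneousComponent_adams_hSeries (ζ : ℂ) {l : ℕ} (hl : 0 < l) (d : ℕ) :
    MvPowerSeries.homogeneousComponent d (adams l (hSeries ζ)) =
      if l ∣ d then ζ ^ (d / l) • adams l (hSym (d / l) : MvPowerSeries ℕ ℂ) else 0 := by
  ext b
  rw [MvPowerSeries.coeff_homogeneousComponent, adams, dif_neg hl.ne']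
  by_cases hb : ∀ i, l ∣ b i
  · obtain ⟨x, rfl⟩ := exists_eq_smul_of_dvd b hb
    have hdeg : (l • x).degree = l * x.degree := by rw [map_nsmul, smul_eq_mul]
    rw [hdeg, MvPowerSeries.coeff_expand_smul, hSeries, coeff_series]
    split_ifs with h1 h2 h2
    · subst h1
      rw [map_smul, adams, dif_neg hl.ne', MvPowerSeries.coeff_expand_smul, hSym, coeff_series,
        Nat.mul_div_cancel_left _ hl, if_pos rfl, smul_eq_mul, mul_one]
    · exact absurd ⟨_, h1.symm⟩ h2
    · obtain ⟨k, rfl⟩ := h2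
      have : x.degree ≠ k := by rintro rfl; exact h1 rfl
      rw [map_smul, adams, dif_neg hl.ne', MvPowerSeries.coeff_expand_smul, hSym, coeff_series,
        Nat.mul_div_cancel_left _ hl, if_neg this, smul_zero]
    · simp
  · push Not at hb
    obtain ⟨i, hi⟩ := hb
    rw [MvPowerSeries.coeff_expand_of_not_dvd _ _ _ hi, ite_self]
    split_ifs
    · rw [map_smul, adams, dif_neg hl.ne', MvPowerSeries.coeff_expand_of_not_dvd _ _ _ hi,
        smul_zero]
    · simp

/-- Starting from the series of the `h_n`, replace `Y` by `Y^l`, scale by `ζ` and dilate by `l`. The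
resulting coefficient of `p_r` is the trace of the `r`-th power of a monomial `l`-cycle with product
`ζ`; this coincidence links the kernel to the group. -/
theorem isNewton_components_adams (ζ : ℂ) {l : ℕ} (hl : 0 < l) :
    IsNewton (fun r => (if l ∣ r then (l : ℂ) * ζ ^ (r / l) else 0) • pX r)
      (components (adams l (hSeries ζ))) := by
  have h1 := isNewton_h.map (MvPowerSeries.expand (σ := ℕ) (R := ℂ) l hl.ne').toRingHom
  have h2 := (h1.scale ζ).dilate hl
  rw [components_apply]
  simp only [homogeneousComponent_adams_hSeries ζ hl]
  have h3 : ∀ n, adams l (hSym n : MvPowerSeries ℕ ℂ) =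
      MvPowerSeries.expand l hl.ne' (hSym n : MvPowerSeries ℕ ℂ) := fun n => dif_neg hl.ne'
  simp only [h3]
  refine h2.congr fun r hr => ?_
  split_ifs with h
  · obtain ⟨k, rfl⟩ := h
    have hk : 0 < k := Nat.pos_of_mul_pos_left hr
    have := expand_powerSum (Function.Embedding.refl ℕ) hl.ne' hk
    change MvPowerSeries.expand l hl.ne' (pX k) = pX (l * k) at this
    rw [Nat.mul_div_cancel_left _ hl, mul_smul, Nat.cast_smul_eq_nsmul, nsmul_eq_mul]
    change _ * (ζ ^ k • MvPowerSeries.expand l hl.ne' (pX k)) = _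
    rw [this]
  · rw [zero_smul]

variable {m : ℕ} [NeZero m]

/-- `∑_ζ ∑_{l ∈ ρ(ζ), l ∣ r} l ζ^{r/l}`, the `r`-th power sum of the eigenvalues of the elements
of `C_ρ`. -/
def eigenPowerSum (ρ : Phi m) (r : ℕ) : ℂ :=
  ∑ ζ : rootsOfUnity m ℂ, ((ρ ζ).parts.map fun l =>
    if l ∣ r then (l : ℂ) * ((ζ : ℂˣ) : ℂ) ^ (r / l) else 0).sum

/-- Logarithmic derivatives add over all parts of all `ρ(ζ)`, giving the power sums `eigenPowerSum ρ
r • p_r`. The exponential formula then produces the Cauchy expansion `∑ p_λ(Ξ_ρ) p_λ(Y) / z_λ`. -/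
theorem homogeneousComponent_cauchySeries (ρ : Phi m) (d : ℕ) :
    MvPowerSeries.homogeneousComponent d (cauchySeries ρ) = ∑ lam ∈ parOf d,
      ((lam.z : ℂ)⁻¹ * parProd (eigenPowerSum ρ) lam) • (pSym lam : MvPowerSeries ℕ ℂ) := by
  have h : IsNewton (fun r => eigenPowerSum ρ r • pX r) (components (cauchySeries ρ)) := by
    rw [cauchySeries, map_prod]
    have := IsNewton.prod Finset.univ (R := MvPowerSeries ℕ ℂ) fun (ζ : rootsOfUnity m ℂ) _ =>
      IsNewton.multiset_prod (ρ ζ).parts fun l hl =>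
        isNewton_components_adams ((ζ : ℂˣ) : ℂ) ((ρ ζ).pos hl)
    convert this using 1
    · funext r
      rw [eigenPowerSum, Finset.sum_smul]
      refine Finset.sum_congr rfl fun ζ _ => ?_
      rw [Multiset.sum_smul, Multiset.map_map]
      rfl
    · refine Finset.prod_congr rfl fun ζ _ => ?_
      rw [parProd, map_multiset_prod, Multiset.map_map]
      rfl
  rw [components_apply] at h
  have h2 := expCoeff_eq h d
  rw [h2, expCoeff]
  refine Finset.sum_congr rfl fun lam _ => ?_
  rw [parProd_smul, smul_smul, coe_pSym]

/-! ### The Hall pairing with a symmetric series -/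

theorem isSymm_of_components {F : MvPowerSeries ℕ ℂ}
    (h : ∀ d, IsSymm (MvPowerSeries.homogeneousComponent d F)) : IsSymm F := by
  rw [isSymm_iff]
  intro e a
  have := (isSymm_iff _).1 (h a.degree) e a
  rwa [MvPowerSeries.coeff_homogeneousComponent, MvPowerSeries.coeff_homogeneousComponent,
    Finsupp.degree_mapDomain, if_pos rfl, if_pos rfl] at this

theorem isSymm_of_eq_sum {F : MvPowerSeries ℕ ℂ} {α : Par → ℂ}
    (h : ∀ d, MvPowerSeries.homogeneousComponent d F =
      ∑ lam ∈ parOf d, α lam • (pSym lam : MvPowerSeries ℕ ℂ)) : IsSymm F := by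
  refine isSymm_of_components fun d => ?_
  rw [h]
  exact (Subalgebra.sum_mem SymmFun fun lam _ =>
    Subalgebra.smul_mem _ (pSym lam).2 (α lam)).1

/-- By orthogonality each `p_λ` in the expansion of `f` meets only the `p_λ` of the component of
degree `|λ|`. Since `f` involves finitely many `λ`, the sum over degrees is finite. -/
theorem hallSeries_eq {F : MvPowerSeries ℕ ℂ} (hF : IsSymm F) {α : Par → ℂ}
    (h : ∀ d, MvPowerSeries.homogeneousComponent d F =
      ∑ lam ∈ parOf d, α lam • (pSym lam : MvPowerSeries ℕ ℂ)) (f : SymmFun) :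
    hallSeries F hF f = (pBasis.repr f).sum fun lam c => c * (α lam * lam.z) := by
  classical
  have hd : ∀ d, hallPairing (symmComponent F hF d) f =
      ∑ lam ∈ (pBasis.repr f).support.filter (fun lam => lam.size = d),
        pBasis.repr f lam * (α lam * lam.z) := by
    intro d
    have h1 : symmComponent F hF d = ∑ lam ∈ parOf d, α lam • pSym lam := by
      refine Subtype.ext ?_
      rw [AddSubmonoidClass.coe_finsetSum]
      exact h d
    conv_lhs => rw [h1, ← pBasis.linearCombination_repr f, Finsupp.linearCombination_apply,
      Finsupp.sum, map_sum]
    rw [Finset.sum_filter]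
    refine Finset.sum_congr rfl fun lam _ => ?_
    rw [map_smul, map_sum, LinearMap.sum_apply, pBasis_apply, smul_eq_mul]
    simp only [map_smul, LinearMap.smul_apply, hallPairing_p, smul_eq_mul]
    split_ifs with hs
    · rw [Finset.sum_eq_single_of_mem lam (mem_parOf.2 hs)]
      · rw [if_pos rfl]
      · intro mu _ hne
        rw [if_neg hne, mul_zero]
    · rw [Finset.sum_eq_zero, mul_zero]
      intro mu hmu
      rw [if_neg, mul_zero]
      rintro rfl
      exact hs (mem_parOf.1 hmu)
  rw [hallSeries]
  simp only [hd]
  rw [finsum_eq_sum_of_support_subset (s := (pBasis.repr f).support.image Par.size),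
    Finsupp.sum]
  · exact Finset.sum_fiberwise_of_maps_to (fun lam hlam => Finset.mem_image_of_mem _ hlam) _
  · intro d hdd
    rw [Function.mem_support] at hdd
    obtain ⟨lam, hlam, -⟩ := Finset.exists_ne_zero_of_sum_ne_zero hdd
    rw [Finset.mem_filter] at hlam
    exact Finset.mem_coe.2 (Finset.mem_image.2 ⟨lam, hlam⟩)

theorem homogeneousComponent_coeffX_kernel (a : rootsOfUnity m ℂ × ℕ →₀ ℕ) (d : ℕ) :
    MvPowerSeries.homogeneousComponent d (coeffX a (plethysticExp (kernelAlphabet m))) =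
      ∑ lam ∈ parOf d, (∑ ρ ∈ phiOf m a.degree, (ρ.Z : ℂ)⁻¹ * MvPowerSeries.coeff a (P ρ) *
        ((lam.z : ℂ)⁻¹ * parProd (eigenPowerSum ρ) lam)) • (pSym lam : MvPowerSeries ℕ ℂ) := by
  rw [coeffX_kernel, map_sum]
  simp only [map_smul, homogeneousComponent_cauchySeries, Finset.sum_smul, Finset.smul_sum,
    smul_smul]
  rw [Finset.sum_comm]

/-- Every homogeneous component in `Y` is a combination of power sums, hence symmetric. -/
theorem isSymmY_kernel : IsSymmY (plethysticExp (kernelAlphabet m)) := fun a =>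
  isSymm_of_eq_sum (homogeneousComponent_coeffX_kernel a)

/-- The linear functional on `Λ` with `p_λ ↦ c_λ`. -/
def evalPower (c : ℕ → ℂ) : SymmFun →ₗ[ℂ] ℂ := pBasis.constr ℂ fun lam => parProd c lam

/-- The reproducing property: the `z_λ` of the Hall pairing cancels the `1 / z_λ` of the Cauchy
expansion, leaving `f` evaluated at the power sums `eigenPowerSum ρ`. -/
theorem coeff_pairingY_kernel (a : rootsOfUnity m ℂ × ℕ →₀ ℕ) (f : SymmFun) :
    MvPowerSeries.coeff a (pairingY (plethysticExp (kernelAlphabet m)) isSymmY_kernel f) =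
      ∑ ρ ∈ phiOf m a.degree, evalPower (eigenPowerSum ρ) f / (ρ.Z : ℂ) *
        MvPowerSeries.coeff a (P ρ) := by
  rw [pairingY, coeff_series, hallSeries_eq _ (homogeneousComponent_coeffX_kernel a)]
  simp only [evalPower, Module.Basis.constr_apply, Finsupp.sum, smul_eq_mul, Finset.sum_div,
    Finset.sum_mul, Finset.mul_sum]
  rw [Finset.sum_comm]
  refine Finset.sum_congr rfl fun ρ _ => Finset.sum_congr rfl fun lam _ => ?_
  have : (lam.z : ℂ) ≠ 0 := Nat.cast_ne_zero.2 lam.z_pos.ne'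
  field_simp

/-! ### Evaluation of symmetric functions -/

theorem killCompl_pX (n : ℕ) {r : ℕ} (hr : 0 < r) :
    MvPowerSeries.killCompl (Fin.valEmbedding : Fin n ↪ ℕ) (pX r) =
      ((∑ i : Fin n, MvPolynomial.X i ^ r : MvPolynomial (Fin n) ℂ) :
        MvPowerSeries (Fin n) ℂ) := by
  classical
  ext b
  rw [MvPowerSeries.coeff_killCompl, pX, coeff_powerSum_X hr, MvPolynomial.coeff_coe,
    MvPolynomial.coeff_sum]
  simp only [MvPolynomial.coeff_X_pow]
  split_ifs with h
  · obtain ⟨i, hi⟩ := h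
    have hir : i ∈ (b.embDomain Fin.valEmbedding).support := by rw [hi]; simp [hr.ne']
    rw [Finsupp.support_embDomain, Finset.mem_map] at hir
    obtain ⟨j, -, rfl⟩ := hir
    have hb : b = Finsupp.single j r := by
      refine Finsupp.embDomain_injective Fin.valEmbedding ?_
      rw [hi, Finsupp.embDomain_single]
    subst hb
    rw [Finset.sum_eq_single j]
    · rw [if_pos rfl]
    · intro k _ hk
      rw [if_neg]
      rw [Finsupp.single_left_inj hr.ne']
      exact hk
    · simp
  · symm
    refine Finset.sum_eq_zero fun i _ => if_neg ?_
    rintro rfl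
    exact h ⟨i, by rw [Finsupp.embDomain_single]; rfl⟩

/-- Both sides are linear in `f` and agree on the basis `p_λ`, by multiplicativity and
`killCompl_pX`. In particular the restriction of `f` to `n` variables is a polynomial, which makes
its evaluation a finite sum. -/
theorem killCompl_eq (n : ℕ) (f : SymmFun) :
    MvPowerSeries.killCompl (Fin.valEmbedding : Fin n ↪ ℕ) (f : MvPowerSeries ℕ ℂ) =
      ((pBasis.constr ℂ (fun lam => parProd
        (fun r => (∑ i : Fin n, MvPolynomial.X i ^ r : MvPolynomial (Fin n) ℂ)) lam) f :
        MvPolynomial (Fin n) ℂ) : MvPowerSeries (Fin n) ℂ) := by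
  have : (MvPowerSeries.killCompl (R := ℂ) (Fin.valEmbedding : Fin n ↪ ℕ)).toLinearMap ∘ₗ
      SymmFun.val.toLinearMap =
      (MvPolynomial.coeToMvPowerSeries.algHom (σ := Fin n) (R := ℂ) ℂ).toLinearMap ∘ₗ
      pBasis.constr ℂ (fun lam => parProd
        (fun r => (∑ i : Fin n, MvPolynomial.X i ^ r : MvPolynomial (Fin n) ℂ)) lam) := by
    refine pBasis.ext fun lam => ?_
    rw [LinearMap.comp_apply, LinearMap.comp_apply, Module.Basis.constr_basis, pBasis_apply]
    change MvPowerSeries.killCompl (R := ℂ) (Fin.valEmbedding : Fin n ↪ ℕ) (parProd pX lam) = _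
    refine (map_parProd (MvPowerSeries.killCompl (R := ℂ)
      (Fin.valEmbedding : Fin n ↪ ℕ)).toRingHom pX lam).trans ?_
    refine Eq.trans ?_ (map_parProd (MvPolynomial.coeToMvPowerSeries.algHom
      (σ := Fin n) (R := ℂ) ℂ).toRingHom _ lam).symm
    refine parProd_congr (fun r hr => ?_) lam
    exact killCompl_pX n hr
  have h := LinearMap.congr_fun this f
  simpa using h

theorem evalFin_eq {n : ℕ} (f : SymmFun) (x : Fin n → ℂ) :
    evalFin f x = evalPower (fun r => ∑ i, x i ^ r) f := by
  set q := pBasis.constr ℂ (fun lam => parProd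
    (fun r => (∑ i : Fin n, MvPolynomial.X i ^ r : MvPolynomial (Fin n) ℂ)) lam) f with hq
  have h1 : evalFin f x = MvPolynomial.eval x q := by
    rw [MvPolynomial.eval_eq', evalFin]
    simp only [← MvPowerSeries.coeff_killCompl, killCompl_eq, MvPolynomial.coeff_coe]
    refine finsum_eq_sum_of_support_subset _ fun b hb => ?_
    rw [Function.mem_support] at hb
    exact Finset.mem_coe.2 (MvPolynomial.mem_support_iff.2 (left_ne_zero_of_mul hb))
  rw [h1, hq]
  have : (MvPolynomial.aeval x).toLinearMap ∘ₗ pBasis.constr ℂ (fun lam => parProd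
      (fun r => (∑ i : Fin n, MvPolynomial.X i ^ r : MvPolynomial (Fin n) ℂ)) lam) =
      evalPower (fun r => ∑ i, x i ^ r) := by
    refine pBasis.ext fun lam => ?_
    rw [LinearMap.comp_apply, evalPower, Module.Basis.constr_basis, Module.Basis.constr_basis]
    refine (map_parProd (MvPolynomial.aeval (R := ℂ) x).toRingHom _ lam).trans ?_
    refine parProd_congr (fun r _ => ?_) lam
    simp
  exact LinearMap.congr_fun this f

theorem evalPower_congr {c d : ℕ → ℂ} (h : ∀ r, 0 < r → c r = d r) : evalPower c = evalPower d := by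
  rw [evalPower, evalPower]
  congr 1
  funext lam
  exact parProd_congr h lam

theorem evalMultiset_eq (f : SymmFun) (A : Multiset ℂ) :
    evalMultiset f A = evalPower (fun r => (A.map fun a => a ^ r).sum) f := by
  rw [evalMultiset, evalFin_eq]
  refine LinearMap.congr_fun (evalPower_congr fun r _ => ?_) f
  conv_rhs => rw [← A.coe_toList, Multiset.map_coe, Multiset.sum_coe]
  rw [← List.sum_ofFn]
  congr 1
  conv_rhs => rw [← List.ofFn_get A.toList, List.map_ofFn]
  rfl

/-! ### Multisets are determined by their power sums -/

/-- By linearity `A` and `B` give the same sum of values for every polynomial. A Lagrange polynomial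
that is `1` at `c` and `0` at the other points reads off the multiplicity of `c`. -/
theorem eq_of_powerSum_eq {A B : Multiset ℂ}
    (h : ∀ r : ℕ, (A.map fun a => a ^ r).sum = (B.map fun a => a ^ r).sum) : A = B := by
  classical
  have hp : ∀ p : Polynomial ℂ, (A.map fun a => p.eval a).sum = (B.map fun a => p.eval a).sum := by
    intro p
    simp only [Polynomial.eval_eq_sum_range]
    rw [Multiset.sum_map_sum, Multiset.sum_map_sum]
    refine Finset.sum_congr rfl fun r _ => ?_
    rw [Multiset.sum_map_mul_left, Multiset.sum_map_mul_left, h]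
  ext c
  let s : Finset ℂ := insert c (A.toFinset ∪ B.toFinset)
  let p : Polynomial ℂ := Lagrange.basis s id c
  have hind : ∀ C : Multiset ℂ, (C.map fun a => if c = a then (1 : ℂ) else 0).sum = C.count c := by
    intro C
    induction C using Multiset.induction with
    | empty => simp
    | cons a C ih =>
      rw [Multiset.map_cons, Multiset.sum_cons, ih, Multiset.count_cons]
      split_ifs <;> push_cast <;> ring
  have hcount : ∀ C : Multiset ℂ, C.toFinset ⊆ s →
      (C.map fun a => p.eval a).sum = C.count c := by
    intro C hC
    have h1 : (C.map fun a => p.eval a) = C.map fun a => if c = a then 1 else 0 := by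
      refine Multiset.map_congr rfl fun a ha => ?_
      have has : a ∈ s := hC (Multiset.mem_toFinset.2 ha)
      have hinj : Set.InjOn (id : ℂ → ℂ) s := Function.injective_id.injOn
      split_ifs with hca
      · subst hca
        exact Lagrange.eval_basis_self hinj has
      · exact Lagrange.eval_basis_of_ne (v := (id : ℂ → ℂ)) hca has
    rw [h1, hind]
  have := hp p
  rw [hcount A (Finset.subset_union_left.trans (Finset.subset_insert _ _)),
    hcount B (Finset.subset_union_right.trans (Finset.subset_insert _ _))] at this
  exact_mod_cast this

/-! ### Diagonalization of matrices of finite order -/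

/-- The matrix is annihilated by `X^N - 1`, which is separable over `ℂ`; so it is semisimple and its
eigenspaces span. A basis is then extracted from the set of eigenvectors. -/
theorem exists_eigenbasis {n N : ℕ} (hN : 0 < N) (A : Matrix (Fin n) (Fin n) ℂ) (hA : A ^ N = 1) :
    ∃ (b : Module.Basis (Fin n) ℂ (Fin n → ℂ)) (x : Fin n → ℂ), ∀ j, A.mulVec (b j) = x j • b j := by
  set f : Module.End ℂ (Fin n → ℂ) := Matrix.toLin' A with hf
  have hss : f.IsSemisimple := by
    refine Module.End.isSemisimple_of_squarefree_aeval_eq_zero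
      (p := Polynomial.X ^ N - 1) ?_ ?_
    · have : (Polynomial.X ^ N - 1 : Polynomial ℂ).Separable :=
        Polynomial.separable_X_pow_sub_C (1 : ℂ) (Nat.cast_ne_zero.2 hN.ne') one_ne_zero
      exact this.squarefree
    · have : f ^ N = 1 := by
        rw [hf, ← Matrix.toLin'_pow, hA, Matrix.toLin'_one]
        rfl
      simp [this]
  set S : Set (Fin n → ℂ) := {v | ∃ μ : ℂ, f v = μ • v}
  have hS : ⊤ ≤ Submodule.span ℂ S := by
    rw [← hss.iSup_eigenspace_eq_top]
    exact iSup_le fun μ v hv => Submodule.subset_span ⟨μ, Module.End.mem_eigenspace_iff.1 hv⟩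
  let b := Module.Basis.ofSpan hS
  have hb : ∀ i, b i ∈ S := fun i => Module.Basis.ofSpan_subset hS (Set.mem_range_self i)
  have := Module.Finite.finite_basis b
  have := Fintype.ofFinite ((linearIndepOn_empty ℂ id).extend (Set.empty_subset S))
  have hcard := (Module.finrank_eq_card_basis b).symm.trans (Module.finrank_fin_fun ℂ)
  let e := Fintype.equivFinOfCardEq hcard
  choose x hx using fun j => hb (e.symm j)
  refine ⟨b.reindex e, x, fun j => ?_⟩
  rw [Module.Basis.reindex_apply]
  exact hx j

/-- The conjugation takes place inside `GL_n`, so that it can also be applied to characters of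
representations of `GL_n`. -/
theorem exists_conj_diagonal {n N : ℕ} (hN : 0 < N) (g : Matrix.GeneralLinearGroup (Fin n) ℂ)
    (hg : g ^ N = 1) : ∃ (h D : Matrix.GeneralLinearGroup (Fin n) ℂ) (x : Fin n → ℂ),
      D.val = Matrix.diagonal x ∧ g = h * D * h⁻¹ := by
  obtain ⟨b, x, hb⟩ := exists_eigenbasis hN g.val (by
    rw [← Units.val_pow_eq_pow_val, hg, Units.val_one])
  let e := Pi.basisFun ℂ (Fin n)
  let h : Matrix.GeneralLinearGroup (Fin n) ℂ :=
    ⟨e.toMatrix b, b.toMatrix e, e.toMatrix_mul_toMatrix_flip b, b.toMatrix_mul_toMatrix_flip e⟩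
  refine ⟨h, h⁻¹ * g * h, x, ?_, by group⟩
  have key : g.val * h.val = h.val * Matrix.diagonal x := by
    ext i j
    have := congrFun (hb j) i
    rw [Matrix.mul_diagonal]
    have hh : ∀ i j, h.val i j = b j i := fun i j => by
      change e.toMatrix b i j = b j i
      simp [e, Module.Basis.toMatrix_apply]
    rw [hh, mul_comm, Matrix.mul_apply]
    simp only [hh]
    simpa [Matrix.mulVec, dotProduct] using this
  rw [Units.val_mul, Units.val_mul, mul_assoc, key, ← mul_assoc, ← Units.val_mul, inv_mul_cancel,
    Units.val_one, one_mul]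

theorem roots_charpoly_conj_diagonal {n : ℕ} {g h D : Matrix.GeneralLinearGroup (Fin n) ℂ}
    {x : Fin n → ℂ} (hD : D.val = Matrix.diagonal x) (hg : g = h * D * h⁻¹) :
    g.val.charpoly.roots = Finset.univ.val.map x := by
  have h1 : g.val.charpoly = (Matrix.diagonal x).charpoly := by
    rw [hg, Units.val_mul, Units.val_mul, hD, Matrix.coe_units_inv,
      Matrix.charpoly_units_conj]
  have h2 := Polynomial.roots_multiset_prod_X_sub_C (Finset.univ.val.map x)
  rw [Multiset.map_map] at h2
  rw [h1, Matrix.charpoly_diagonal]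
  exact h2

theorem trace_pow_conj_diagonal {n : ℕ} {g h D : Matrix.GeneralLinearGroup (Fin n) ℂ}
    {x : Fin n → ℂ} (hD : D.val = Matrix.diagonal x) (hg : g = h * D * h⁻¹) (r : ℕ) :
    (g.val ^ r).trace = ∑ i, x i ^ r := by
  rw [← Units.val_pow_eq_pow_val, hg, conj_pow, Units.val_mul, Units.val_mul,
    Matrix.trace_units_conj, Units.val_pow_eq_pow_val, hD, Matrix.diagonal_pow,
    Matrix.trace_diagonal]
  rfl

/-! ### Eigenvalues of the elements of the wreath product. -/

instance finite_wreathGroup {m n : ℕ} [NeZero m] : Finite (WreathGroup m n) :=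
  Finite.of_injective (fun γ => (γ.left, γ.right)) fun γ δ h => by
    rw [Prod.mk.injEq] at h
    exact SemidirectProduct.ext h.1 h.2

theorem exists_conj_diagonal_toGL {m n : ℕ} [NeZero m] (γ : WreathGroup m n) :
    ∃ (h D : Matrix.GeneralLinearGroup (Fin n) ℂ) (x : Fin n → ℂ),
      D.val = Matrix.diagonal x ∧ toGL γ = h * D * h⁻¹ := by
  obtain ⟨N, hN, h⟩ := (isOfFinOrder_of_finite γ).exists_pow_eq_one
  exact exists_conj_diagonal hN (toGL γ) (by rw [← map_pow, h, map_one])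

/-- In diagonal form both sides are `∑ x_i^r`. This reduces the study of eigenvalues to traces of
powers, which only see fixed points. -/
theorem powerSum_roots_charpoly {m n : ℕ} [NeZero m] (γ : WreathGroup m n) (r : ℕ) :
    ((toMatrix γ).charpoly.roots.map fun a => a ^ r).sum = (toMatrix (γ ^ r)).trace := by
  obtain ⟨h, D, x, hD, hg⟩ := exists_conj_diagonal_toGL γ
  have h1 := roots_charpoly_conj_diagonal hD hg
  have h2 := trace_pow_conj_diagonal hD hg r
  change (toMatrix γ).charpoly.roots = _ at h1
  change ((toMatrix γ) ^ r).trace = _ at h2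
  rw [map_pow, h2, h1, Multiset.map_map]
  rfl

/-! ### Traces of powers of monomial matrices -/

section Trace

variable {m n : ℕ}

theorem pow_right (γ : WreathGroup m n) (r : ℕ) : (γ ^ r).right = γ.right ^ r :=
  map_pow SemidirectProduct.rightHom γ r

/-- The action `(σ • a)_i = a_{σ⁻¹ i}` makes the labels accumulate along the backward orbit of `i`.
For this reason cycles are listed below along the inverse permutation. -/
theorem pow_left (γ : WreathGroup m n) (r : ℕ) (i : Fin n) :
    (γ ^ r).left i = ∏ k ∈ Finset.range r, γ.left ((γ.right⁻¹ : Equiv.Perm (Fin n))^[k] i) := by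
  induction r generalizing i with
  | zero => simp
  | succ r ih =>
    rw [pow_succ', SemidirectProduct.mul_left, Finset.prod_range_succ']
    change γ.left i * (γ ^ r).left (γ.right⁻¹ i) = _
    rw [ih, mul_comm]
    rfl

theorem trace_toMatrix (γ : WreathGroup m n) :
    (toMatrix γ).trace = ∑ i, if γ.right i = i then ((γ.left i : ℂˣ) : ℂ) else 0 := by
  rw [Matrix.trace]
  refine Finset.sum_congr rfl fun i _ => ?_
  exact if_congr eq_comm rfl rfl

/-- The points of the cycle through `i`, listed along the inverse permutation. -/
theorem points_eq_image (γ : WreathGroup m n) (i : Fin n) :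
    Cycle.points (γ := γ) (Quotient.mk _ i) =
      (Finset.range (Function.minimalPeriod (γ.right⁻¹ : Equiv.Perm (Fin n)) i)).image
        fun k => (γ.right⁻¹ : Equiv.Perm (Fin n))^[k] i := by
  classical
  ext j
  simp only [Cycle.points, Finset.mem_filter, Finset.mem_univ, true_and, Finset.mem_image,
    Finset.mem_range]
  rw [Quotient.eq]
  change Equiv.Perm.SameCycle γ.right j i ↔ _
  rw [Equiv.Perm.sameCycle_comm, ← Equiv.Perm.sameCycle_inv]
  have hper : 0 < Function.minimalPeriod (γ.right⁻¹ : Equiv.Perm (Fin n)) i :=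
    Function.minimalPeriod_pos_of_mem_periodicPts
      (Function.Injective.mem_periodicPts (Equiv.injective _) i)
  constructor
  · intro h
    obtain ⟨k, hk⟩ := h.exists_nat_pow_eq
    refine ⟨k % Function.minimalPeriod (γ.right⁻¹ : Equiv.Perm (Fin n)) i,
      Nat.mod_lt _ hper, ?_⟩
    rw [Function.iterate_mod_minimalPeriod_eq, ← hk, Equiv.Perm.iterate_eq_pow]
  · rintro ⟨k, -, rfl⟩
    rw [Equiv.Perm.iterate_eq_pow]
    exact ⟨k, by simp⟩

theorem injOn_iterate (γ : WreathGroup m n) (i : Fin n) :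
    Set.InjOn (fun k => (γ.right⁻¹ : Equiv.Perm (Fin n))^[k] i)
      (Finset.range (Function.minimalPeriod (γ.right⁻¹ : Equiv.Perm (Fin n)) i)) := by
  rw [Finset.coe_range]
  exact Function.iterate_injOn_Iio_minimalPeriod

theorem card_points (γ : WreathGroup m n) (i : Fin n) :
    (Cycle.points (γ := γ) (Quotient.mk _ i)).card =
      Function.minimalPeriod (γ.right⁻¹ : Equiv.Perm (Fin n)) i := by
  rw [points_eq_image, Finset.card_image_of_injOn (injOn_iterate γ i), Finset.card_range]

theorem cycleProduct_mk (γ : WreathGroup m n) (i : Fin n) :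
    cycleProduct (γ := γ) (Quotient.mk _ i) =
      ∏ k ∈ Finset.range (Function.minimalPeriod (γ.right⁻¹ : Equiv.Perm (Fin n)) i),
        γ.left ((γ.right⁻¹ : Equiv.Perm (Fin n))^[k] i) := by
  rw [cycleProduct, points_eq_image, Finset.prod_image (injOn_iterate γ i)]

/-- The backward orbit winds `s` times around the cycle and collects one cycle product per turn. -/
theorem pow_left_of_dvd (γ : WreathGroup m n) (i : Fin n) (s : ℕ) :
    (γ ^ ((Cycle.points (γ := γ) (Quotient.mk _ i)).card * s)).left i =
      cycleProduct (γ := γ) (Quotient.mk _ i) ^ s := by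
  rw [card_points, pow_left, cycleProduct_mk]
  induction s with
  | zero => simp
  | succ s ih =>
    rw [Nat.mul_succ, Finset.prod_range_add, ih, pow_succ]
    congr 1
    refine Finset.prod_congr rfl fun k _ => ?_
    rw [add_comm, Function.iterate_add_apply]
    rw [show (γ.right⁻¹ : Equiv.Perm (Fin n))^[_ * s] i = i from
      (Function.isPeriodicPt_minimalPeriod _ i).mul_const s]

theorem pow_right_apply_eq_iff (γ : WreathGroup m n) (i : Fin n) (r : ℕ) :
    (γ ^ r).right i = i ↔ (Cycle.points (γ := γ) (Quotient.mk _ i)).card ∣ r := by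
  rw [card_points, ← Function.isPeriodicPt_iff_minimalPeriod_dvd, pow_right,
    Function.IsPeriodicPt, Function.IsFixedPt, Equiv.Perm.iterate_eq_pow, inv_pow,
    Equiv.Perm.inv_eq_iff_eq, eq_comm]

/-- The `r`-th power of the permutation fixes a point exactly when the length of its cycle divides
`r`. All points of that cycle then have the same diagonal entry, a power of the cycle product. -/
theorem trace_toMatrix_pow (γ : WreathGroup m n) [Fintype (Cycle γ)] (r : ℕ) :
    (toMatrix (γ ^ r)).trace = ∑ q : Cycle γ, if q.points.card ∣ r then
      (q.points.card : ℂ) * (((cycleProduct q : rootsOfUnity m ℂ) : ℂˣ) : ℂ) ^ (r / q.points.card)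
      else 0 := by
  classical
  rw [trace_toMatrix, ← Finset.sum_fiberwise Finset.univ (fun i => (Quotient.mk _ i : Cycle γ))]
  refine Finset.sum_congr rfl fun (q : Cycle γ) _ => ?_
  have hq : Finset.univ.filter (fun i => (Quotient.mk _ i : Cycle γ) = q) = q.points := by
    rw [Cycle.points]
  rw [hq]
  have hi : ∀ i ∈ q.points, (if (γ ^ r).right i = i then (((γ ^ r).left i : ℂˣ) : ℂ) else 0) =
      if q.points.card ∣ r then
        (((cycleProduct q : rootsOfUnity m ℂ) : ℂˣ) : ℂ) ^ (r / q.points.card) else 0 := by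
    intro i hi
    have hqi : (Quotient.mk _ i : Cycle γ) = q := by
      rw [Cycle.points, Finset.mem_filter] at hi
      exact hi.2
    subst hqi
    refine if_ctx_congr (pow_right_apply_eq_iff γ i r) (fun h => ?_) fun _ => rfl
    have h2 := pow_left_of_dvd γ i (r / (Cycle.points (γ := γ) (Quotient.mk _ i)).card)
    rw [Nat.mul_div_cancel' h] at h2
    rw [h2]
    simp
  rw [Finset.sum_congr rfl hi, Finset.sum_const, nsmul_eq_mul, mul_ite, mul_zero]

theorem points_card_pos {γ : WreathGroup m n} (q : Cycle γ) : 0 < q.points.card := by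
  obtain ⟨i, rfl⟩ := Quotient.exists_rep q
  rw [Finset.card_pos]
  exact ⟨i, by simp [Cycle.points]⟩

open Classical in
theorem parts_eq_of_mem_conjClass {γ : WreathGroup m n} [Fintype (Cycle γ)] {ρ : Phi m}
    (h : γ ∈ conjClass n ρ) (ζ : rootsOfUnity m ℂ) :
    ((Finset.univ.filter fun q : Cycle γ => cycleProduct q = ζ).val.map
      fun q => q.points.card) = (ρ ζ).parts := by
  ext l
  rw [Multiset.count_map]
  -- The definition of `conjClass` prescribes counts only for `l ≥ 1`; for `l = 0` both counts
  -- vanish, as cycles are nonempty and parts are positive.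
  rcases Nat.eq_zero_or_pos l with rfl | hl
  · rw [Multiset.count_eq_zero.2 fun h0 => lt_irrefl 0 ((ρ ζ).pos h0), Multiset.card_eq_zero,
      Multiset.filter_eq_nil]
    exact fun q _ h0 => (points_card_pos q).ne h0
  · rw [← show Nat.card {q : Cycle γ // cycleProduct q = ζ ∧ q.points.card = l} =
      (ρ ζ).parts.count l from h ζ l hl, Nat.card_eq_fintype_card, Fintype.card_subtype,
      ← Finset.filter_filter]
    simp only [eq_comm (a := l)]
    rfl

/-- Sorting the cycles by their product recovers the parts of each `ρ(ζ)`, so the trace depends on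
`ρ` alone. -/
theorem trace_pow_of_mem_conjClass [NeZero m] {γ : WreathGroup m n} {ρ : Phi m}
    (h : γ ∈ conjClass n ρ) (r : ℕ) : (toMatrix (γ ^ r)).trace = eigenPowerSum ρ r := by
  classical
  rw [trace_toMatrix_pow, eigenPowerSum, ← Finset.sum_fiberwise Finset.univ
    (fun q : Cycle γ => (cycleProduct q : rootsOfUnity m ℂ))]
  refine Finset.sum_congr rfl fun ζ _ => ?_
  rw [← parts_eq_of_mem_conjClass h ζ, Multiset.map_map]
  change _ = ∑ q ∈ _, _
  refine Finset.sum_congr rfl fun q hq => ?_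
  rw [(Finset.mem_filter.1 hq).2]
  rfl

end Trace

/-! ### Every class is nonempty -/

section Nonempty

variable {m : ℕ} (ρ : Phi m)

/-- The index set of the cycles of an element of `C_ρ`. -/
abbrev CycleIndex : Type := Σ ζ : rootsOfUnity m ℂ, Fin (ρ ζ).parts.toList.length

/-- The length of the cycle with a given index. -/
def cycleLen (i : CycleIndex ρ) : ℕ := (ρ i.1).parts.toList.get i.2

/-- The set permuted by the standard element of `C_ρ`. -/
abbrev CyclePoint : Type := Σ i : CycleIndex ρ, Fin (cycleLen ρ i)

theorem cycleLen_pos (i : CycleIndex ρ) : 0 < cycleLen ρ i :=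
  (ρ i.1).pos (Multiset.mem_toList.1 (List.get_mem _ _))

theorem sum_get {M : Type*} [AddCommMonoid M] (s : Multiset ℕ) (f : ℕ → M) :
    ∑ k : Fin s.toList.length, f (s.toList.get k) = (s.map f).sum := by
  conv_rhs => rw [← s.coe_toList, Multiset.map_coe, Multiset.sum_coe]
  rw [← List.sum_ofFn]
  congr 1
  conv_rhs => rw [← List.ofFn_get s.toList, List.map_ofFn]
  rfl

/-- The permutation rotating each cycle. -/
def rotation : Equiv.Perm (CyclePoint ρ) :=
  Equiv.Perm.sigmaCongrRight fun i => finRotate (cycleLen ρ i)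

theorem rotation_fst (u : CyclePoint ρ) : (rotation ρ u).1 = u.1 := rfl

variable [NeZero m]

theorem card_cyclePoint : Fintype.card (CyclePoint ρ) = ρ.size := by
  rw [Fintype.card_sigma, Fintype.sum_sigma, Phi.size]
  refine Finset.sum_congr rfl fun ζ _ => ?_
  simp only [Fintype.card_fin]
  have := sum_get (ρ ζ).parts id
  rw [Multiset.map_id, Par.sum_parts] at this
  exact this

/-- An enumeration of the points. -/
def pointEquiv : CyclePoint ρ ≃ Fin ρ.size := Fintype.equivFinOfCardEq (card_cyclePoint ρ)

/-- The standard element of `C_ρ`. -/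
def standardElement : WreathGroup m ρ.size where
  -- The label `ζ` sits at position `0` of its cycle and all other labels are `1`, so the cycle
  -- product is `ζ`.
  left := fun x => if ((pointEquiv ρ).symm x).2.val = 0 then ((pointEquiv ρ).symm x).1.1 else 1
  right := (pointEquiv ρ).permCongr (rotation ρ)

theorem standardElement_right_apply (u : CyclePoint ρ) :
    (standardElement ρ).right (pointEquiv ρ u) = pointEquiv ρ (rotation ρ u) := by
  simp [standardElement, Equiv.permCongr_apply]

theorem standardElement_left_apply (u : CyclePoint ρ) :
    (standardElement ρ).left (pointEquiv ρ u) = if u.2.val = 0 then u.1.1 else 1 :=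
  congrArg (fun u : CyclePoint ρ => if u.2.val = 0 then u.1.1 else 1)
    ((pointEquiv ρ).symm_apply_apply u)

theorem finRotate_apply_of_lt {l : ℕ} (j : Fin l) (hj : j.val + 1 < l) :
    finRotate l j = ⟨j.val + 1, hj⟩ := by
  cases l with
  | zero => exact j.elim0
  | succ l =>
    obtain ⟨k, hk⟩ := j
    exact finRotate_of_lt (by simpa using hj)

theorem sameCycle_zero (i : CycleIndex ρ) (k : ℕ) (hk : k < cycleLen ρ i) :
    (standardElement ρ).right.SameCycle (pointEquiv ρ ⟨i, ⟨0, cycleLen_pos ρ i⟩⟩)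
      (pointEquiv ρ ⟨i, ⟨k, hk⟩⟩) := by
  induction k with
  | zero => exact Equiv.Perm.SameCycle.refl _ _
  | succ k ih =>
    have h1 := ih (by omega)
    have h2 : rotation ρ ⟨i, ⟨k, by omega⟩⟩ = ⟨i, ⟨k + 1, hk⟩⟩ := by
      change (⟨i, finRotate (cycleLen ρ i) ⟨k, _⟩⟩ : CyclePoint ρ) = _
      rw [finRotate_apply_of_lt _ hk]
    rw [← h2, ← standardElement_right_apply, Equiv.Perm.sameCycle_apply_right]
    exact h1

/-- The cycle index is invariant under rotation, and every point of a cycle is reached from its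
position `0`. -/
theorem sameCycle_iff (u v : CyclePoint ρ) :
    (standardElement ρ).right.SameCycle (pointEquiv ρ u) (pointEquiv ρ v) ↔ u.1 = v.1 := by
  constructor
  · intro h
    obtain ⟨k, hk⟩ := h.exists_nat_pow_eq
    have : ∀ k : ℕ, ((pointEquiv ρ).symm (((standardElement ρ).right ^ k) (pointEquiv ρ u))).1 =
        u.1 := by
      intro k
      induction k with
      | zero => simp
      | succ k ih =>
        obtain ⟨w, hw⟩ := (pointEquiv ρ).surjective (((standardElement ρ).right ^ k)
          (pointEquiv ρ u))
        rw [← hw, Equiv.symm_apply_apply] at ih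
        rw [pow_succ', Equiv.Perm.mul_apply, ← hw, standardElement_right_apply,
          Equiv.symm_apply_apply, rotation_fst, ih]
    have h2 := this k
    rw [hk, Equiv.symm_apply_apply] at h2
    exact h2.symm
  · obtain ⟨i, j⟩ := u
    obtain ⟨i', j'⟩ := v
    intro h
    change i = i' at h
    subst h
    exact (sameCycle_zero ρ i j.1 j.2).symm.trans (sameCycle_zero ρ i j'.1 j'.2)

/-- The cycles of the standard element. -/
def cycleEquiv : CycleIndex ρ ≃ Cycle (standardElement ρ) :=
  Equiv.ofBijective (fun i => Quotient.mk _ (pointEquiv ρ ⟨i, ⟨0, cycleLen_pos ρ i⟩⟩)) <| by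
    constructor
    · intro i i' h
      exact (sameCycle_iff ρ _ _).1 (Quotient.exact h)
    · intro q
      obtain ⟨x, rfl⟩ := Quotient.exists_rep q
      obtain ⟨u, rfl⟩ := (pointEquiv ρ).surjective x
      exact ⟨u.1, Quotient.sound ((sameCycle_iff ρ _ _).2 rfl)⟩

theorem points_cycleEquiv (i : CycleIndex ρ) : (cycleEquiv ρ i).points =
    (Finset.univ : Finset (Fin (cycleLen ρ i))).map
      ((Function.Embedding.sigmaMk i).trans (pointEquiv ρ).toEmbedding) := by
  classical
  ext x
  obtain ⟨u, rfl⟩ := (pointEquiv ρ).surjective x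
  simp only [Cycle.points, Finset.mem_filter, Finset.mem_univ, true_and, Finset.mem_map]
  change (Quotient.mk _ (pointEquiv ρ u) : Cycle (standardElement ρ)) =
    Quotient.mk _ (pointEquiv ρ ⟨i, ⟨0, cycleLen_pos ρ i⟩⟩) ↔ _
  rw [Quotient.eq]
  refine (sameCycle_iff ρ _ _).trans ?_
  constructor
  · obtain ⟨i', j⟩ := u
    rintro h
    change i' = i at h
    subst h
    exact ⟨j, rfl⟩
  · rintro ⟨j, hj⟩
    have := (pointEquiv ρ).injective hj
    rw [← this]
    rfl

theorem card_points_cycleEquiv (i : CycleIndex ρ) :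
    (cycleEquiv ρ i).points.card = cycleLen ρ i := by
  rw [points_cycleEquiv, Finset.card_map, Finset.card_univ, Fintype.card_fin]

theorem cycleProduct_cycleEquiv (i : CycleIndex ρ) : cycleProduct (cycleEquiv ρ i) = i.1 := by
  rw [cycleProduct, points_cycleEquiv, Finset.prod_map,
    Finset.prod_eq_single (⟨0, cycleLen_pos ρ i⟩ : Fin (cycleLen ρ i))]
  · exact (standardElement_left_apply ρ _).trans (if_pos rfl)
  · intro j _ hj
    have : j.val ≠ 0 := fun h => hj (Fin.ext h)
    exact (standardElement_left_apply ρ _).trans (if_neg this)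
  · simp

theorem standardElement_mem : standardElement ρ ∈ conjClass ρ.size ρ := by
  classical
  intro ζ l _
  have h1 : Nat.card {q : Cycle (standardElement ρ) // cycleProduct q = ζ ∧ q.points.card = l} =
      Nat.card {i : CycleIndex ρ // i.1 = ζ ∧ cycleLen ρ i = l} :=
    Nat.card_congr ((cycleEquiv ρ).subtypeEquiv fun i => by
      rw [card_points_cycleEquiv, cycleProduct_cycleEquiv]).symm
  rw [h1, Nat.card_eq_fintype_card, Fintype.card_subtype, Finset.card_filter, Fintype.sum_sigma,
    Finset.sum_eq_single ζ]
  · simp only [true_and]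
    refine (sum_get (ρ ζ).parts fun k => if k = l then 1 else 0).trans ?_
    rw [Par.mult]
    generalize (ρ ζ).parts = s
    induction s using Multiset.induction with
    | empty => simp
    | cons a s ih =>
      rw [Multiset.map_cons, Multiset.sum_cons, ih, Multiset.count_cons, add_comm]
      simp only [eq_comm]
  · intro ζ' _ h
    simp [h]
  · simp

theorem conjClass_nonempty : (conjClass ρ.size ρ).Nonempty := ⟨_, standardElement_mem ρ⟩

theorem classRep_mem : classRep ρ.size ρ ∈ conjClass ρ.size ρ := by
  rw [classRep, dif_pos (conjClass_nonempty ρ)]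
  exact (conjClass_nonempty ρ).some_mem

theorem powerSum_roots_of_mem {γ : WreathGroup m ρ.size} (h : γ ∈ conjClass ρ.size ρ) (r : ℕ) :
    ((toMatrix γ).charpoly.roots.map fun a => a ^ r).sum = eigenPowerSum ρ r := by
  rw [powerSum_roots_charpoly, trace_pow_of_mem_conjClass h]

/-- Both multisets have the power sums `eigenPowerSum ρ`. -/
theorem roots_eq_Xi {γ : WreathGroup m ρ.size} (h : γ ∈ conjClass ρ.size ρ) :
    (toMatrix γ).charpoly.roots = Xi ρ :=
  eq_of_powerSum_eq fun r => by
    rw [powerSum_roots_of_mem ρ h, Xi, powerSum_roots_of_mem ρ (classRep_mem ρ)]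

theorem evalMultiset_Xi (f : SymmFun) :
    evalMultiset f (Xi ρ) = evalPower (eigenPowerSum ρ) f := by
  rw [evalMultiset_eq]
  exact LinearMap.congr_fun (evalPower_congr fun r _ =>
    powerSum_roots_of_mem ρ (classRep_mem ρ) r) f

/-! ### The generating series -/

variable (lam : Par)

theorem coeff_FTerm_eq_zero {ρ : Phi m} {a : rootsOfUnity m ℂ × ℕ →₀ ℕ}
    (h : ρ ∉ phiOf m a.degree) : MvPowerSeries.coeff a (FTerm lam ρ) = 0 := by
  have : MvPowerSeries.coeff a (P ρ) = 0 := by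
    by_contra hc
    exact h (mem_phiOf.2 (degree_of_coeff_P ρ a hc).symm)
  rw [FTerm, map_smul, this, smul_zero]

theorem hasSum_coeff_FTerm (a : rootsOfUnity m ℂ × ℕ →₀ ℕ) :
    HasSum (fun ρ : Phi m => MvPowerSeries.coeff a (FTerm lam ρ))
      (∑ ρ ∈ phiOf m a.degree, MvPowerSeries.coeff a (FTerm lam ρ)) :=
  hasSum_sum_of_ne_finset_zero fun _ h => coeff_FTerm_eq_zero lam h

theorem summable_FTerm : Summable (fun ρ : Phi m => FTerm lam ρ) := by
  rw [MvPowerSeries.WithPiTopology.summable_iff_summable_coeff]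
  exact fun a => (hasSum_coeff_FTerm lam a).summable

theorem coeff_F (a : rootsOfUnity m ℂ × ℕ →₀ ℕ) : MvPowerSeries.coeff a (F m lam) =
    ∑ ρ ∈ phiOf m a.degree, MvPowerSeries.coeff a (FTerm lam ρ) := by
  have h := (MvPowerSeries.WithPiTopology.hasSum_iff_hasSum_coeff).1
    (summable_FTerm (m := m) lam).hasSum a
  exact h.unique (hasSum_coeff_FTerm lam a)

/-- The coefficient at `a` of either side is a sum over `|ρ| = a.degree` whose terms agree, since
`eigenPowerSum ρ` gives the power sums of `Ξ_ρ`. -/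
theorem F_eq_pairingY : F m lam =
    pairingY (plethysticExp (kernelAlphabet m)) isSymmY_kernel (schur lam) := by
  ext a
  rw [coeff_F, coeff_pairingY_kernel]
  refine Finset.sum_congr rfl fun ρ _ => ?_
  rw [FTerm, map_smul, evalMultiset_Xi, smul_eq_mul]

theorem homogeneousComponent_F (n : ℕ) : MvPowerSeries.homogeneousComponent n (F m lam) =
    ∑ ρ ∈ phiOf m n, FTerm lam ρ := by
  ext a
  rw [MvPowerSeries.coeff_homogeneousComponent, map_sum]
  split_ifs with h
  · rw [coeff_F, h]
  · refine (Finset.sum_eq_zero fun ρ hρ => coeff_FTerm_eq_zero lam fun hc => h ?_).symm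
    rw [← mem_phiOf.1 hρ, ← mem_phiOf.1 hc]

end Nonempty

/-! ### Exchange relations between minors -/

section Exchange

variable {n p q : ℕ}

theorem minor_eq_sum (c : Fin p → Fin n) : minor c = ∑ α : Equiv.Perm (Fin p),
    ((Equiv.Perm.sign α : ℤ) : MvPolynomial (ℕ × Fin n) ℂ) *
      ∏ b, MvPolynomial.X ((α b : ℕ), c b) := by
  rw [minor, Matrix.det_apply']
  rfl

theorem minor_comp_perm (c : Fin p → Fin n) (w : Equiv.Perm (Fin p)) :
    minor (c ∘ w) = ((Equiv.Perm.sign w : ℤ) : MvPolynomial (ℕ × Fin n) ℂ) * minor c := by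
  rw [minor, minor, ← Matrix.det_permute']
  rfl

theorem minor_eq_zero {c : Fin p → Fin n} (h : ¬ Function.Injective c) : minor c = 0 := by
  rw [Function.not_injective_iff] at h
  obtain ⟨a, b, hab, hne⟩ := h
  refine Matrix.det_zero_of_column_eq hne fun k => ?_
  simp only [Matrix.of_apply, hab]

variable (c : Fin p → Fin n) (d : Fin q → Fin n) (P : Fin p → Prop) (Q : Fin q → Prop)

/-- The entries of two columns at the positions selected by `P` and `Q`. -/
def selected : {b // P b} ⊕ {b // Q b} → Fin n := Sum.elim (fun b => c b) fun b => d b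

section Left

variable [DecidablePred P]

/-- The first column, after permuting the selected entries. -/
def exchangeLeft (w : Equiv.Perm ({b // P b} ⊕ {b // Q b})) (b : Fin p) : Fin n :=
  if h : P b then selected c d P Q (w (Sum.inl ⟨b, h⟩)) else c b

theorem prod_exchangeLeft {M : Type*} [CommMonoid M] (w : Equiv.Perm ({b // P b} ⊕ {b // Q b}))
    (f : Fin p → Fin n → M) : ∏ b, f b (exchangeLeft c d P Q w b) =
      (∏ b : {b // P b}, f b (selected c d P Q (w (Sum.inl b)))) * ∏ b : {b // ¬ P b}, f b (c b) := by
  rw [← Fintype.prod_subtype_mul_prod_subtype P]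
  congr 1
  · exact Finset.prod_congr rfl fun b _ => by rw [exchangeLeft, dif_pos b.2]
  · exact Finset.prod_congr rfl fun b _ => by rw [exchangeLeft, dif_neg b.2]

theorem sum_exchangeLeft (w : Equiv.Perm ({b // P b} ⊕ {b // Q b})) :
    ∑ b, (exchangeLeft c d P Q w b : ℕ) =
      (∑ b : {b // P b}, (selected c d P Q (w (Sum.inl b)) : ℕ)) + ∑ b : {b // ¬ P b}, (c b : ℕ) := by
  have := prod_exchangeLeft (M := Multiplicative ℕ) c d P Q w
    fun _ v => Multiplicative.ofAdd (v : ℕ)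
  exact this

end Left

section Right

variable [DecidablePred Q]

/-- The second column, after permuting the selected entries. -/
def exchangeRight (w : Equiv.Perm ({b // P b} ⊕ {b // Q b})) (b : Fin q) : Fin n :=
  if h : Q b then selected c d P Q (w (Sum.inr ⟨b, h⟩)) else d b

theorem prod_exchangeRight {M : Type*} [CommMonoid M] (w : Equiv.Perm ({b // P b} ⊕ {b // Q b}))
    (f : Fin q → Fin n → M) : ∏ b, f b (exchangeRight c d P Q w b) =
      (∏ b : {b // Q b}, f b (selected c d P Q (w (Sum.inr b)))) * ∏ b : {b // ¬ Q b}, f b (d b) := by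
  rw [← Fintype.prod_subtype_mul_prod_subtype Q]
  congr 1
  · exact Finset.prod_congr rfl fun b _ => by rw [exchangeRight, dif_pos b.2]
  · exact Finset.prod_congr rfl fun b _ => by rw [exchangeRight, dif_neg b.2]

theorem sum_exchangeRight (w : Equiv.Perm ({b // P b} ⊕ {b // Q b})) :
    ∑ b, (exchangeRight c d P Q w b : ℕ) =
      (∑ b : {b // Q b}, (selected c d P Q (w (Sum.inr b)) : ℕ)) + ∑ b : {b // ¬ Q b}, (d b : ℕ) := by
  have := prod_exchangeRight (M := Multiplicative ℕ) c d P Q w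
    fun _ v => Multiplicative.ofAdd (v : ℕ)
  exact this

end Right

variable [DecidablePred P] [DecidablePred Q]

/-- Antisymmetrizing a product of two minors in more columns than there are rows gives zero. -/
theorem sum_exchange (hqp : q ≤ p) (hK : p < Fintype.card ({b // P b} ⊕ {b // Q b})) :
    ∑ w : Equiv.Perm ({b // P b} ⊕ {b // Q b}),
      ((Equiv.Perm.sign w : ℤ) : MvPolynomial (ℕ × Fin n) ℂ) *
        (minor (exchangeLeft c d P Q w) * minor (exchangeRight c d P Q w)) = 0 := by
  have hdet : ∀ (α : Equiv.Perm (Fin p)) (β : Equiv.Perm (Fin q)),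
      ∑ w : Equiv.Perm ({b // P b} ⊕ {b // Q b}),
        ((Equiv.Perm.sign w : ℤ) : MvPolynomial (ℕ × Fin n) ℂ) *
          ((∏ b, MvPolynomial.X ((α b : ℕ), exchangeLeft c d P Q w b)) *
            ∏ b, MvPolynomial.X ((β b : ℕ), exchangeRight c d P Q w b)) = 0 := by
    intro α β
    let row : {b // P b} ⊕ {b // Q b} → Fin p :=
      Sum.elim (fun b => α b) fun b => Fin.castLE hqp (β b)
    -- There are more than `p` selected positions but only `p` rows, because `q ≤ p`. So two
    -- positions use the same row and the matrix `A` below has two equal columns.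
    obtain ⟨k, l, hkl, hrow⟩ := Fintype.exists_ne_map_eq_of_card_lt row (by simpa using hK)
    let A : Matrix ({b // P b} ⊕ {b // Q b}) ({b // P b} ⊕ {b // Q b})
        (MvPolynomial (ℕ × Fin n) ℂ) :=
      Matrix.of fun i j => MvPolynomial.X ((row j : ℕ), selected c d P Q i)
    have hA : A.det = 0 := Matrix.det_zero_of_column_eq hkl fun i => by
      simp only [A, Matrix.of_apply, hrow]
    rw [Matrix.det_apply'] at hA
    -- The unselected factors do not depend on `w`; the selected ones form a term of the Leibniz
    -- expansion of `det A`.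
    have hterm : ∀ w : Equiv.Perm ({b // P b} ⊕ {b // Q b}),
        ((Equiv.Perm.sign w : ℤ) : MvPolynomial (ℕ × Fin n) ℂ) *
          ((∏ b, MvPolynomial.X ((α b : ℕ), exchangeLeft c d P Q w b)) *
            ∏ b, MvPolynomial.X ((β b : ℕ), exchangeRight c d P Q w b)) =
        (((Equiv.Perm.sign w : ℤ) : MvPolynomial (ℕ × Fin n) ℂ) * ∏ i, A (w i) i) *
          ((∏ b : {b // ¬ P b}, MvPolynomial.X ((α b : ℕ), c b)) *
            ∏ b : {b // ¬ Q b}, MvPolynomial.X ((β b : ℕ), d b)) := by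
      intro w
      rw [prod_exchangeLeft c d P Q w fun b v => MvPolynomial.X ((α b : ℕ), v),
        prod_exchangeRight c d P Q w fun b v => MvPolynomial.X ((β b : ℕ), v),
        Fintype.prod_sum_type]
      simp only [A, Matrix.of_apply, row, Sum.elim_inl, Sum.elim_inr, Fin.val_castLE]
      ring
    rw [Finset.sum_congr rfl fun w _ => hterm w, ← Finset.sum_mul, hA, zero_mul]
  simp only [minor_eq_sum]
  simp only [Finset.sum_mul_sum]
  simp only [Finset.mul_sum]
  rw [Finset.sum_comm]
  refine Finset.sum_eq_zero fun α _ => ?_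
  rw [Finset.sum_comm]
  refine Finset.sum_eq_zero fun β _ => ?_
  rw [← mul_zero (((Equiv.Perm.sign α : ℤ) : MvPolynomial (ℕ × Fin n) ℂ) *
    ((Equiv.Perm.sign β : ℤ) : MvPolynomial (ℕ × Fin n) ℂ)), ← hdet α β, Finset.mul_sum]
  exact Finset.sum_congr rfl fun w _ => by ring

/-- A permutation of the selected entries that preserves the two columns. -/
def PreservesColumns (w : Equiv.Perm ({b // P b} ⊕ {b // Q b})) : Prop :=
  Set.MapsTo w (Set.range Sum.inl) (Set.range Sum.inl)

/-- Such a permutation is a pair acting on the two columns separately. Each minor changes by the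
sign of its own component, and together these cancel the sign of `w`. -/
theorem exchange_of_preserves {w : Equiv.Perm ({b // P b} ⊕ {b // Q b})}
    (hw : PreservesColumns P Q w) : ((Equiv.Perm.sign w : ℤ) : MvPolynomial (ℕ × Fin n) ℂ) *
      (minor (exchangeLeft c d P Q w) * minor (exchangeRight c d P Q w)) = minor c * minor d := by
  obtain ⟨⟨w₁, w₂⟩, rfl⟩ := Equiv.Perm.mem_sumCongrHom_range_of_perm_mapsTo_inl hw
  have hL : exchangeLeft c d P Q (Equiv.Perm.sumCongrHom _ _ (w₁, w₂)) =
      c ∘ Equiv.Perm.ofSubtype w₁ := by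
    funext b
    by_cases h : P b
    · rw [exchangeLeft, dif_pos h, Function.comp_apply, Equiv.Perm.ofSubtype_apply_of_mem _ h]
      rfl
    · rw [exchangeLeft, dif_neg h, Function.comp_apply, Equiv.Perm.ofSubtype_apply_of_not_mem _ h]
  have hR : exchangeRight c d P Q (Equiv.Perm.sumCongrHom _ _ (w₁, w₂)) =
      d ∘ Equiv.Perm.ofSubtype w₂ := by
    funext b
    by_cases h : Q b
    · rw [exchangeRight, dif_pos h, Function.comp_apply, Equiv.Perm.ofSubtype_apply_of_mem _ h]
      rfl
    · rw [exchangeRight, dif_neg h, Function.comp_apply, Equiv.Perm.ofSubtype_apply_of_not_mem _ h]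
  have hsq : ∀ u : ℤˣ, ((u : ℤ) : MvPolynomial (ℕ × Fin n) ℂ) * ((u : ℤ) : _) = 1 := by
    intro u
    rw [← Int.cast_mul, ← Units.val_mul, Int.units_mul_self, Units.val_one, Int.cast_one]
  have hs : Equiv.Perm.sign (Equiv.Perm.sumCongrHom _ _ (w₁, w₂)) =
      Equiv.Perm.sign w₁ * Equiv.Perm.sign w₂ := Equiv.Perm.sign_sumCongr w₁ w₂
  rw [hL, hR, minor_comp_perm, minor_comp_perm, Equiv.Perm.sign_ofSubtype,
    Equiv.Perm.sign_ofSubtype, hs, Units.val_mul, Int.cast_mul]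
  linear_combination (minor c * minor d) * (hsq (Equiv.Perm.sign w₁)) *
    (((Equiv.Perm.sign w₂ : ℤ) : MvPolynomial (ℕ × Fin n) ℂ) *
      ((Equiv.Perm.sign w₂ : ℤ) : MvPolynomial (ℕ × Fin n) ℂ)) +
    (minor c * minor d) * (hsq (Equiv.Perm.sign w₂))

theorem sum_exchange_add (w : Equiv.Perm ({b // P b} ⊕ {b // Q b})) :
    ∑ b, (exchangeLeft c d P Q w b : ℕ) + ∑ b, (exchangeRight c d P Q w b : ℕ) =
      ∑ b, (c b : ℕ) + ∑ b, (d b : ℕ) := by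
  have h := Equiv.sum_comp w fun k => (selected c d P Q k : ℕ)
  rw [Fintype.sum_sum_type, Fintype.sum_sum_type] at h
  have hc := Fintype.sum_subtype_add_sum_subtype P fun b => (c b : ℕ)
  have hd := Fintype.sum_subtype_add_sum_subtype Q fun b => (d b : ℕ)
  have h1 : ∑ b : {b // P b}, (selected c d P Q (Sum.inl b) : ℕ) = ∑ b : {b // P b}, (c b : ℕ) := rfl
  have h2 : ∑ b : {b // Q b}, (selected c d P Q (Sum.inr b) : ℕ) = ∑ b : {b // Q b}, (d b : ℕ) := rfl
  rw [sum_exchangeLeft, sum_exchangeRight]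
  omega

/-- If all selected entries of the first column exceed those of the second, a permutation that does
not preserve the columns decreases the sum of the first column. -/
theorem sum_exchangeLeft_lt {θ : ℕ} (hc : ∀ b, P b → θ ≤ c b) (hd : ∀ b, Q b → (d b : ℕ) < θ)
    {w : Equiv.Perm ({b // P b} ⊕ {b // Q b})} (hw : ¬ PreservesColumns P Q w) :
    ∑ b, (exchangeLeft c d P Q w b : ℕ) < ∑ b, (c b : ℕ) := by
  have hex : ∃ b b', w (Sum.inl b) = Sum.inr b' := by
    by_contra hne
    push Not at hne
    refine hw ?_
    rintro _ ⟨b, rfl⟩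
    cases hb : w (Sum.inl b) with
    | inl b' => exact ⟨b', rfl⟩
    | inr b' => exact absurd hb (hne b b')
  rw [sum_exchangeLeft, ← Fintype.sum_subtype_add_sum_subtype P fun b => (c b : ℕ)]
  refine Nat.add_lt_add_right ?_ _
  let g : {b // P b} ⊕ {b // Q b} → ℤ := fun k => (selected c d P Q k : ℤ) - θ
  -- This is the positive part of `g`. Its total over all selected positions is invariant under `w`
  -- and equals the sum of `g` over the first column, while `g < g'` wherever an entry of the second
  -- column moves in.
  let g' : {b // P b} ⊕ {b // Q b} → ℤ := Sum.elim (fun b => g (Sum.inl b)) fun _ => 0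
  have hg0 : ∀ b, 0 ≤ g (Sum.inl b) := fun b =>
    sub_nonneg.2 (Int.ofNat_le.2 (hc b.1 b.2))
  have hg1 : ∀ b, g (Sum.inr b) < 0 := fun b =>
    sub_neg.2 (Int.ofNat_lt.2 (hd b.1 b.2))
  have hg'0 : ∀ k, 0 ≤ g' k := by
    rintro (b | b)
    · exact hg0 b
    · exact le_rfl
  have hgg' : ∀ k, g k ≤ g' k := by
    rintro (b | b)
    · exact le_rfl
    · exact (hg1 b).le
  have h1 : ∑ b : {b // P b}, g (w (Sum.inl b)) < ∑ b : {b // P b}, g' (w (Sum.inl b)) := by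
    obtain ⟨b, b', hb⟩ := hex
    refine Finset.sum_lt_sum (fun b _ => hgg' _) ⟨b, Finset.mem_univ b, ?_⟩
    rw [hb]
    exact hg1 b'
  have h2 : ∑ b : {b // P b}, g' (w (Sum.inl b)) ≤ ∑ k, g' (w k) := by
    rw [Fintype.sum_sum_type]
    exact le_add_of_nonneg_right (Finset.sum_nonneg fun b _ => hg'0 _)
  have h3 : ∑ k, g' (w k) = ∑ b : {b // P b}, g (Sum.inl b) := by
    rw [Equiv.sum_comp w g', Fintype.sum_sum_type]
    simp [g']
  have h4 := (h1.trans_le h2).trans_eq h3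
  simp only [g, Finset.sum_sub_distrib] at h4
  have h5 : ∑ b : {b // P b}, (selected c d P Q (w (Sum.inl b)) : ℕ) <
      ∑ b : {b // P b}, (selected c d P Q (Sum.inl b) : ℕ) := by
    exact_mod_cast sub_lt_sub_iff_right _ |>.1 h4
  exact h5

end Exchange

/-! ### Standard fillings span -/

section Straightening

variable {n : ℕ} {mu : YoungDiagram}

/-- Fillings of a diagram, column by column. -/
abbrev Filling (mu : YoungDiagram) (n : ℕ) : Type :=
  (j : Fin (mu.rowLen 0)) → Fin (mu.colLen j) → Fin n

/-- A filling whose columns increase strictly and whose rows increase weakly. -/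
def IsStandard (T : Filling mu n) : Prop :=
  (∀ j, StrictMono (T j)) ∧ ∀ (j j' : Fin (mu.rowLen 0)) (h : j < j') (b : Fin (mu.colLen j')),
    T j (Fin.castLE (mu.colLen_anti j j' h.le) b) ≤ T j' b

/-- The column sums, weighted by the column index. -/
def potential (T : Filling mu n) : ℕ := ∑ j : Fin (mu.rowLen 0), (j : ℕ) * ∑ b, (T j b : ℕ)

theorem minorProd_update {j j' : Fin (mu.rowLen 0)} (h : j ≠ j') (T : Filling mu n)
    (c : Fin (mu.colLen j) → Fin n) (d : Fin (mu.colLen j') → Fin n) :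
    minorProd mu (Function.update (Function.update T j c) j' d) =
      minor c * minor d * ∏ k ∈ (Finset.univ.erase j).erase j', minor (T k) := by
  have hj' : j' ∈ Finset.univ.erase j := Finset.mem_erase.2 ⟨h.symm, Finset.mem_univ _⟩
  rw [minorProd, ← Finset.mul_prod_erase _ _ (Finset.mem_univ j), ← Finset.mul_prod_erase _ _ hj',
    Function.update_of_ne h, Function.update_self, Function.update_self, ← mul_assoc]
  congr 1
  refine Finset.prod_congr rfl fun k hk => ?_
  have h1 : k ≠ j' := Finset.ne_of_mem_erase hk
  have h2 : k ≠ j := Finset.ne_of_mem_erase (Finset.mem_of_mem_erase hk)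
  rw [Function.update_of_ne h1, Function.update_of_ne h2]

theorem minorProd_eq_mul {j j' : Fin (mu.rowLen 0)} (h : j ≠ j') (T : Filling mu n) :
    minorProd mu T = minor (T j) * minor (T j') *
      ∏ k ∈ (Finset.univ.erase j).erase j', minor (T k) := by
  have := minorProd_update h T (T j) (T j')
  rwa [Function.update_eq_self, Function.update_eq_self] at this

theorem potential_update {j j' : Fin (mu.rowLen 0)} (h : j ≠ j') (T : Filling mu n)
    (c : Fin (mu.colLen j) → Fin n) (d : Fin (mu.colLen j') → Fin n) :
    potential (Function.update (Function.update T j c) j' d) =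
      (j : ℕ) * ∑ b, (c b : ℕ) + (j' : ℕ) * ∑ b, (d b : ℕ) +
        ∑ k ∈ (Finset.univ.erase j).erase j', (k : ℕ) * ∑ b, (T k b : ℕ) := by
  have hj' : j' ∈ Finset.univ.erase j := Finset.mem_erase.2 ⟨h.symm, Finset.mem_univ _⟩
  rw [potential, ← Finset.add_sum_erase _ _ (Finset.mem_univ j), ← Finset.add_sum_erase _ _ hj',
    Function.update_of_ne h, Function.update_self, Function.update_self, ← add_assoc]
  congr 1
  refine Finset.sum_congr rfl fun k hk => ?_
  have h1 : k ≠ j' := Finset.ne_of_mem_erase hk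
  have h2 : k ≠ j := Finset.ne_of_mem_erase (Finset.mem_of_mem_erase hk)
  rw [Function.update_of_ne h1, Function.update_of_ne h2]

theorem potential_eq_add {j j' : Fin (mu.rowLen 0)} (h : j ≠ j') (T : Filling mu n) :
    potential T = (j : ℕ) * ∑ b, (T j b : ℕ) + (j' : ℕ) * ∑ b, (T j' b : ℕ) +
      ∑ k ∈ (Finset.univ.erase j).erase j', (k : ℕ) * ∑ b, (T k b : ℕ) := by
  have := potential_update h T (T j) (T j')
  rwa [Function.update_eq_self, Function.update_eq_self] at this

/-- For `i < p` there are `p - i` positions from `i` downwards in the first column and `i + 1`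
positions down to `i` in the second, `p + 1` in total. -/
theorem card_selected {p q : ℕ} (i : Fin q) :
    p < Fintype.card ({b : Fin p // i.val ≤ b.val} ⊕ {b : Fin q // b.val ≤ i.val}) := by
  let f : Fin (p + 1) → {b : Fin p // i.val ≤ b.val} ⊕ {b : Fin q // b.val ≤ i.val} := fun k =>
    if h : k.val ≤ i.val then Sum.inr ⟨⟨k.val, by omega⟩, h⟩
    else Sum.inl ⟨⟨k.val - 1, by omega⟩, by change i.val ≤ k.val - 1; omega⟩
  have hf : Function.Injective f := by
    intro k l hkl
    simp only [f] at hkl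
    split_ifs at hkl with h1 h2 h2
    · simp only [Sum.inr.injEq, Subtype.mk.injEq, Fin.mk.injEq] at hkl
      exact Fin.ext hkl
    · simp only [Sum.inl.injEq, Subtype.mk.injEq, Fin.mk.injEq] at hkl
      exact Fin.ext (by omega)
  have := Fintype.card_le_of_injective f hf
  rw [Fintype.card_fin] at this
  exact this

/-- The straightening step: a filling with strictly increasing columns that is not standard is a
combination of fillings of larger potential. -/
theorem mem_of_not_standard (S : Submodule ℂ (MvPolynomial (ℕ × Fin n) ℂ)) (T : Filling mu n)
    (hcol : ∀ j, StrictMono (T j)) (hT : ¬ IsStandard T)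
    (hS : ∀ T' : Filling mu n, potential T < potential T' → minorProd mu T' ∈ S) :
    minorProd mu T ∈ S := by
  classical
  have hviol : ∃ (j j' : Fin (mu.rowLen 0)) (h : j < j') (b : Fin (mu.colLen j')),
      T j' b < T j (Fin.castLE (mu.colLen_anti j j' h.le) b) := by
    by_contra hne
    push Not at hne
    exact hT ⟨hcol, hne⟩
  obtain ⟨j, j', hjj', i, hi⟩ := hviol
  have hqp : mu.colLen j' ≤ mu.colLen j := mu.colLen_anti j j' hjj'.le
  -- The Garnir choice at a violation in row `i`: the lower part of the left column and the upper
  -- part of the right one. As columns increase, every selected entry on the left exceeds every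
  -- selected entry on the right.
  let PP : Fin (mu.colLen j) → Prop := fun b => i.val ≤ b.val
  let QQ : Fin (mu.colLen j') → Prop := fun b => b.val ≤ i.val
  let TT : Equiv.Perm ({b // PP b} ⊕ {b // QQ b}) → Filling mu n := fun w =>
    Function.update (Function.update T j (exchangeLeft (T j) (T j') PP QQ w)) j'
      (exchangeRight (T j) (T j') PP QQ w)
  have hrel := sum_exchange (T j) (T j') PP QQ hqp (card_selected i)
  have hrel2 : ∑ w : Equiv.Perm ({b // PP b} ⊕ {b // QQ b}),
      ((Equiv.Perm.sign w : ℤ) : MvPolynomial (ℕ × Fin n) ℂ) * minorProd mu (TT w) = 0 := by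
    rw [← zero_mul (∏ k ∈ (Finset.univ.erase j).erase j', minor (T k)), ← hrel, Finset.sum_mul]
    refine Finset.sum_congr rfl fun w _ => ?_
    rw [minorProd_update hjj'.ne, ← mul_assoc]
  rw [← Finset.sum_filter_add_sum_filter_not _ (PreservesColumns PP QQ)] at hrel2
  have hH : ∀ w ∈ Finset.univ.filter (PreservesColumns PP QQ),
      ((Equiv.Perm.sign w : ℤ) : MvPolynomial (ℕ × Fin n) ℂ) * minorProd mu (TT w) =
        minorProd mu T := by
    intro w hw
    rw [minorProd_update hjj'.ne, ← mul_assoc,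
      exchange_of_preserves _ _ _ _ (Finset.mem_filter.1 hw).2, minorProd_eq_mul hjj'.ne]
  rw [Finset.sum_congr rfl hH, Finset.sum_const] at hrel2
  have hrest : ∑ w ∈ Finset.univ.filter (fun w => ¬ PreservesColumns PP QQ w),
      ((Equiv.Perm.sign w : ℤ) : MvPolynomial (ℕ × Fin n) ℂ) * minorProd mu (TT w) ∈ S := by
    refine Submodule.sum_mem _ fun w hw => ?_
    have hlt := sum_exchangeLeft_lt (T j) (T j') PP QQ
      (θ := (T j (Fin.castLE hqp i) : ℕ))
      (fun b hb => Fin.le_def.1 ((hcol j).monotone (Fin.le_def.2 hb)))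
      (fun b hb => lt_of_le_of_lt
        (Fin.le_def.1 ((hcol j').monotone (Fin.le_def.2 hb))) (Fin.lt_def.1 hi))
      (Finset.mem_filter.1 hw).2
    have hadd := sum_exchange_add (T j) (T j') PP QQ w
    -- The sum of both columns is unchanged and that of the left one drops. So some of the total
    -- moves to column `j'`, which has the larger weight.
    have hpot : potential T < potential (TT w) := by
      rw [potential_eq_add hjj'.ne, potential_update hjj'.ne]
      refine Nat.add_lt_add_right ?_ _
      have hlt' : (j : ℕ) < j' := hjj'
      nlinarith
    have hm := hS _ hpot
    rcases Int.units_eq_one_or (Equiv.Perm.sign w) with h | h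
    · rw [h]
      simpa using hm
    · rw [h]
      simpa using hm
  -- The column-preserving terms all equal the original product. Their number is positive, the
  -- identity being one of them, so it can be divided out over `ℂ`.
  set N := (Finset.univ.filter (PreservesColumns PP QQ)).card
  have hN : (N : ℂ) ≠ 0 := by
    refine Nat.cast_ne_zero.2 (Finset.card_pos.2 ⟨1, ?_⟩).ne'
    refine Finset.mem_filter.2 ⟨Finset.mem_univ _, ?_⟩
    exact fun x hx => hx
  have h3 : (N : ℂ) • minorProd mu T ∈ S := by
    rw [Nat.cast_smul_eq_nsmul, eq_neg_of_add_eq_zero_left hrel2]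
    exact S.neg_mem hrest
  exact (S.smul_mem_iff hN).1 h3

/-- A nonzero product forces distinct entries within each column. Sorting a column changes its minor
by a sign and keeps its sum, hence the potential. -/
theorem exists_sorted (T : Filling mu n) (hT : minorProd mu T ≠ 0) : ∃ T' : Filling mu n,
    (∀ j, StrictMono (T' j)) ∧ potential T' = potential T ∧
      (minorProd mu T' = minorProd mu T ∨ minorProd mu T' = -minorProd mu T) := by
  have hinj : ∀ j, Function.Injective (T j) := by
    intro j
    by_contra h
    exact hT (Finset.prod_eq_zero (Finset.mem_univ j) (minor_eq_zero h))
  refine ⟨fun j => T j ∘ Tuple.sort (T j), fun j => (Tuple.monotone_sort (T j)).strictMono_of_injective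
    ((hinj j).comp (Equiv.injective _)), ?_, ?_⟩
  · refine Finset.sum_congr rfl fun j _ => ?_
    congr 1
    exact Equiv.sum_comp (Tuple.sort (T j)) fun b => (T j b : ℕ)
  · have : minorProd mu (fun j => T j ∘ Tuple.sort (T j)) =
        (((∏ j, Equiv.Perm.sign (Tuple.sort (T j)) : ℤˣ) : ℤ) : MvPolynomial (ℕ × Fin n) ℂ) *
          minorProd mu T := by
      rw [minorProd, minorProd, Units.coe_prod, Int.cast_prod, ← Finset.prod_mul_distrib]
      exact Finset.prod_congr rfl fun j _ => minor_comp_perm _ _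
    rw [this]
    rcases Int.units_eq_one_or (∏ j, Equiv.Perm.sign (Tuple.sort (T j))) with h | h
    · left; simp [h]
    · right; simp [h]

/-- Extremal argument: among the finitely many fillings outside the span, one of largest potential,
once sorted, would be either standard or a combination of fillings of larger potential. -/
theorem minorProd_mem_span_standard (T : Filling mu n) : minorProd mu T ∈
    Submodule.span ℂ (minorProd (n := n) mu '' {T | IsStandard T}) := by
  set S := Submodule.span ℂ (minorProd (n := n) mu '' {T | IsStandard T}) with hS
  by_contra hT
  obtain ⟨T₀, hT₀, hmax⟩ := Set.exists_max_image {T : Filling mu n | minorProd mu T ∉ S} potential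
    (Set.toFinite _) ⟨T, hT⟩
  have hne : minorProd mu T₀ ≠ 0 := fun h => hT₀ (h ▸ S.zero_mem)
  obtain ⟨T', hcol, hpot, hsign⟩ := exists_sorted T₀ hne
  have hbad : minorProd mu T' ∉ S := by
    rcases hsign with h | h
    · rwa [h]
    · rw [h, S.neg_mem_iff]
      exact hT₀
  by_cases hstd : IsStandard T'
  · exact hbad (Submodule.subset_span ⟨T', hstd, rfl⟩)
  · refine hbad (mem_of_not_standard S T' hcol hstd fun T'' hlt => ?_)
    by_contra hc
    have := hmax T'' hc
    omega

end Straightening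

/-! ### Leading monomials -/

section Leading

variable {n : ℕ}

/-- The weight of a monomial, with `x_{a,c}` of weight `a c`. -/
def monWeight : (ℕ × Fin n →₀ ℕ) →+ ℕ := Finsupp.weight fun q => q.1 * (q.2 : ℕ)

/-- `e` is the exponent of the unique term of largest weight of `f`, and its coefficient is `1`. -/
def IsLeading (f : MvPolynomial (ℕ × Fin n) ℂ) (e : ℕ × Fin n →₀ ℕ) : Prop :=
  MvPolynomial.coeff e f = 1 ∧
    ∀ e', MvPolynomial.coeff e' f ≠ 0 → e' = e ∨ monWeight e' < monWeight e

theorem IsLeading.le {f : MvPolynomial (ℕ × Fin n) ℂ} {e u : ℕ × Fin n →₀ ℕ}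
    (hf : IsLeading f e) (hu : MvPolynomial.coeff u f ≠ 0) : monWeight u ≤ monWeight e := by
  rcases hf.2 u hu with h | h
  · exact (congrArg monWeight h).le
  · exact h.le

/-- The weight is additive, so any product of terms other than the two leading ones has strictly
smaller weight. -/
theorem IsLeading.mul {f g : MvPolynomial (ℕ × Fin n) ℂ} {e e' : ℕ × Fin n →₀ ℕ}
    (hf : IsLeading f e) (hg : IsLeading g e') : IsLeading (f * g) (e + e') := by
  classical
  have key : ∀ u v, MvPolynomial.coeff u f * MvPolynomial.coeff v g ≠ 0 →
      (u = e ∧ v = e') ∨ monWeight (u + v) < monWeight (e + e') := by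
    intro u v hc
    have hu := left_ne_zero_of_mul hc
    have hv := right_ne_zero_of_mul hc
    have hu' := hf.le hu
    have hv' := hg.le hv
    rw [map_add, map_add]
    rcases hf.2 u hu with h1 | h1
    · rcases hg.2 v hv with h2 | h2
      · exact Or.inl ⟨h1, h2⟩
      · exact Or.inr (add_lt_add_of_le_of_lt hu' h2)
    · exact Or.inr (add_lt_add_of_lt_of_le h1 hv')
  refine ⟨?_, fun u hu => ?_⟩
  · rw [MvPolynomial.coeff_mul, Finset.sum_eq_single (e, e'), hf.1, hg.1, one_mul]
    · rintro ⟨u, v⟩ huv hne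
      have hsum : u + v = e + e' := Finset.HasAntidiagonal.mem_antidiagonal.1 huv
      by_contra hc
      rcases key u v hc with ⟨h1, h2⟩ | h
      · exact hne (by rw [h1, h2])
      · rw [hsum] at h
        exact lt_irrefl _ h
    · intro h
      refine absurd ?_ h
      rw [Finset.HasAntidiagonal.mem_antidiagonal]
  · rw [MvPolynomial.coeff_mul] at hu
    obtain ⟨⟨u₁, u₂⟩, hp, hne⟩ := Finset.exists_ne_zero_of_sum_ne_zero hu
    have hsum : u₁ + u₂ = u := Finset.HasAntidiagonal.mem_antidiagonal.1 hp
    rw [← hsum]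
    rcases key u₁ u₂ hne with ⟨h1, h2⟩ | h
    · exact Or.inl (by rw [h1, h2])
    · exact Or.inr h

theorem IsLeading.prod {ι : Type*} (s : Finset ι) {f : ι → MvPolynomial (ℕ × Fin n) ℂ}
    {e : ι → ℕ × Fin n →₀ ℕ} (h : ∀ i ∈ s, IsLeading (f i) (e i)) :
    IsLeading (∏ i ∈ s, f i) (∑ i ∈ s, e i) := by
  classical
  induction s using Finset.induction with
  | empty =>
    refine ⟨by simp, fun e' he' => Or.inl ?_⟩
    by_contra hne
    rw [Finset.prod_empty, MvPolynomial.coeff_one, if_neg (fun h => hne h.symm)] at he'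
    exact he' rfl
  | insert i s hi ih =>
    rw [Finset.prod_insert hi, Finset.sum_insert hi]
    exact (h i (Finset.mem_insert_self i s)).mul (ih fun j hj => h j (Finset.mem_insert_of_mem hj))

theorem minor_eq_sum_monomial {p : ℕ} (c : Fin p → Fin n) : minor c =
    ∑ α : Equiv.Perm (Fin p), MvPolynomial.monomial
      (∑ b, Finsupp.single ((α b : ℕ), c b) 1) (((Equiv.Perm.sign α : ℤ) : ℂ)) := by
  rw [minor_eq_sum]
  refine Finset.sum_congr rfl fun α _ => ?_
  rw [← mul_one (((Equiv.Perm.sign α : ℤ) : ℂ)), ← MvPolynomial.C_mul_monomial,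
    MvPolynomial.monomial_sum_one, map_intCast]
  rfl

/-- The term of a permutation `α` has weight `∑ α(b) c(b)`. By the rearrangement inequality this is
largest for the identity, and only there because `c` is strictly increasing. -/
theorem isLeading_minor {p : ℕ} {c : Fin p → Fin n} (hc : StrictMono c) :
    IsLeading (minor c) (∑ b : Fin p, Finsupp.single ((b : ℕ), c b) 1) := by
  classical
  have hw : ∀ α : Equiv.Perm (Fin p), monWeight (∑ b, Finsupp.single ((α b : ℕ), c b) 1) =
      ∑ b, (α b : ℕ) * (c b : ℕ) := by
    intro α
    rw [map_sum]
    exact Finset.sum_congr rfl fun b _ => by rw [monWeight, Finsupp.weight_single, one_smul]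
  have hmono : Monovary (fun b : Fin p => (b : ℕ)) fun b => (c b : ℕ) := by
    intro a b hab
    have : c a < c b := hab
    exact (hc.lt_iff_lt.1 this).le
  have hlt : ∀ α : Equiv.Perm (Fin p), α ≠ 1 →
      monWeight (∑ b, Finsupp.single ((α b : ℕ), c b) 1) <
        monWeight (∑ b : Fin p, Finsupp.single ((b : ℕ), c b) 1) := by
    intro α hα
    have h1 := hw 1
    simp only [Equiv.Perm.one_apply] at h1
    rw [hw, h1, hmono.sum_comp_perm_mul_lt_sum_mul_iff]
    intro h
    refine hα ((Equiv.Perm.monotone_iff α).1 fun a b hab => ?_)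
    rcases hab.eq_or_lt with rfl | hab
    · exact le_rfl
    · exact h (Fin.lt_def.1 (hc hab))
  refine ⟨?_, fun e he => ?_⟩
  · rw [minor_eq_sum_monomial, MvPolynomial.coeff_sum, Finset.sum_eq_single 1]
    · simp
    · intro α _ hα
      rw [MvPolynomial.coeff_monomial, if_neg]
      intro h
      have := hlt α hα
      rw [h] at this
      exact lt_irrefl _ this
    · simp
  · rw [minor_eq_sum_monomial, MvPolynomial.coeff_sum] at he
    obtain ⟨α, -, hα⟩ := Finset.exists_ne_zero_of_sum_ne_zero he
    rw [MvPolynomial.coeff_monomial] at hα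
    have he' : ∑ b, Finsupp.single ((α b : ℕ), c b) 1 = e := by
      by_contra h
      exact hα (if_neg h)
    subst he'
    by_cases h1 : α = 1
    · left
      rw [h1]
      rfl
    · exact Or.inr (hlt α h1)

/-- Polynomials with distinct leading monomials are linearly independent. -/
theorem linearIndependent_of_isLeading {ι : Type*} {f : ι → MvPolynomial (ℕ × Fin n) ℂ}
    {e : ι → ℕ × Fin n →₀ ℕ} (h : ∀ i, IsLeading (f i) (e i)) (he : Function.Injective e) :
    LinearIndependent ℂ f := by
  rw [linearIndependent_iff]
  intro l hl
  by_contra hne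
  -- For an index of largest leading weight, the leading monomial occurs in no other polynomial of
  -- the relation: there it would have to be the leading monomial or be of smaller weight.
  obtain ⟨i, hi, hmax⟩ := Finset.exists_max_image l.support (fun i => monWeight (e i))
    (Finsupp.support_nonempty_iff.2 hne)
  have h0 := congrArg (MvPolynomial.coeff (e i)) hl
  rw [Finsupp.linearCombination_apply, Finsupp.sum, MvPolynomial.coeff_sum,
    MvPolynomial.coeff_zero, Finset.sum_eq_single i, MvPolynomial.coeff_smul, (h i).1,
    smul_eq_mul, mul_one] at h0
  · exact Finsupp.mem_support_iff.1 hi h0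
  · intro k hk hki
    rw [MvPolynomial.coeff_smul]
    by_contra hc
    rcases (h k).2 (e i) (right_ne_zero_of_smul hc) with h1 | h1
    · exact hki (he h1.symm)
    · exact absurd (hmax k hk) (not_le.2 h1)
  · intro hk
    exact absurd hi hk

end Leading

/-! ### The basis of semistandard tableaux -/

section Tableaux

variable (mu : YoungDiagram) (n : ℕ)

/-- Semistandard tableaux with entries in `{0, …, n-1}`. -/
abbrev BoundedTableau : Type :=
  {T : SemistandardYoungTableau mu // ∀ i j, (i, j) ∈ mu → T i j < n}

variable {mu n}

/-- The columns of a semistandard tableau. -/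
def toFilling (T : BoundedTableau mu n) : Filling mu n := fun j b =>
  ⟨T.1 b j, T.2 b j (YoungDiagram.mem_iff_lt_colLen.2 b.2)⟩

theorem lt_rowLen_zero {i j : ℕ} (h : (i, j) ∈ mu) : j < mu.rowLen 0 :=
  YoungDiagram.mem_iff_lt_rowLen.1 (mu.up_left_mem (Nat.zero_le i) le_rfl h)

theorem isStandard_toFilling (T : BoundedTableau mu n) : IsStandard (toFilling T) := by
  refine ⟨fun j b b' h => ?_, fun j j' h b => ?_⟩
  · exact T.1.col_strict (Fin.lt_def.1 h) (YoungDiagram.mem_iff_lt_colLen.2 b'.2)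
  · exact T.1.row_weak (Fin.lt_def.1 h) (YoungDiagram.mem_iff_lt_colLen.2 b.2)

theorem exists_toFilling {T : Filling mu n} (hT : IsStandard T) :
    ∃ T' : BoundedTableau mu n, toFilling T' = T := by
  classical
  let entry : ℕ → ℕ → ℕ := fun i j =>
    if h : (i, j) ∈ mu then T ⟨j, lt_rowLen_zero h⟩ ⟨i, YoungDiagram.mem_iff_lt_colLen.1 h⟩ else 0
  have hentry : ∀ {i j : ℕ} (h : (i, j) ∈ mu), entry i j =
      T ⟨j, lt_rowLen_zero h⟩ ⟨i, YoungDiagram.mem_iff_lt_colLen.1 h⟩ := fun h => dif_pos h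
  refine ⟨⟨⟨entry, ?_, ?_, fun h => dif_neg h⟩, ?_⟩, ?_⟩
  · intro i j₁ j₂ hlt hcell
    rw [hentry hcell, hentry (mu.up_left_mem le_rfl hlt.le hcell)]
    exact hT.2 ⟨j₁, _⟩ ⟨j₂, _⟩ hlt ⟨i, _⟩
  · intro i₁ i₂ j hlt hcell
    rw [hentry hcell, hentry (mu.up_left_mem hlt.le le_rfl hcell)]
    exact hT.1 ⟨j, _⟩ hlt
  · intro i j h
    exact (hentry h).trans_lt (Fin.is_lt _)
  · funext j b
    exact Fin.ext (hentry (YoungDiagram.mem_iff_lt_colLen.2 b.2))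

/-- The leading monomial of the product of minors attached to a filling. -/
def leadingMon (T : Filling mu n) : ℕ × Fin n →₀ ℕ :=
  ∑ j : Fin (mu.rowLen 0), ∑ b : Fin (mu.colLen j), Finsupp.single ((b : ℕ), T j b) 1

theorem isLeading_minorProd (T : BoundedTableau mu n) :
    IsLeading (minorProd mu (toFilling T)) (leadingMon (toFilling T)) :=
  IsLeading.prod _ fun j _ => isLeading_minor ((isStandard_toFilling T).1 j)

theorem sum_columns {M : Type*} [AddCommMonoid M] (f : ℕ × ℕ → M) :
    ∑ j : Fin (mu.rowLen 0), ∑ b : Fin (mu.colLen j), f ((b : ℕ), (j : ℕ)) = ∑ c ∈ mu.cells, f c := by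
  rw [Finset.sum_sigma']
  refine Finset.sum_bij (fun q _ => ((q.2 : ℕ), (q.1 : ℕ))) (fun q _ => ?_) ?_ ?_ fun _ _ => rfl
  · exact (YoungDiagram.mem_cells _).2 (YoungDiagram.mem_iff_lt_colLen.2 q.2.2)
  · rintro ⟨j, b⟩ - ⟨j', b'⟩ - h
    obtain ⟨h1, h2⟩ := Prod.mk.inj h
    obtain rfl : j = j' := Fin.ext h2
    obtain rfl : b = b' := Fin.ext h1
    rfl
  · rintro ⟨i, j⟩ hc
    have hc' : (i, j) ∈ mu := (YoungDiagram.mem_cells _).1 hc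
    exact ⟨⟨⟨j, lt_rowLen_zero hc'⟩, ⟨i, YoungDiagram.mem_iff_lt_colLen.1 hc'⟩⟩,
      Finset.mem_sigma.2 ⟨Finset.mem_univ _, Finset.mem_univ _⟩, rfl⟩

end Tableaux

/-! ### The character of `V^λ` -/

section Character

variable {mu : YoungDiagram} {n : ℕ}

/-- The exponent of `x_{r,c}` in the leading monomial is the number of entries `c` in row `r`;
adding over `c < v` gives the row threshold. -/
theorem num_eq_weight_leadingMon (T : BoundedTableau mu n) (r v : ℕ) :
    BenderKnuth.num T.1 r v = Finsupp.weight
      (fun q : ℕ × Fin n => if q.1 = r ∧ (q.2 : ℕ) < v then 1 else 0)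
      (leadingMon (toFilling T)) := by
  classical
  rw [leadingMon, map_sum]
  simp only [map_sum, Finsupp.weight_single, one_smul]
  have h := sum_columns (mu := mu) fun c => if c.1 = r ∧ T.1 c.1 c.2 < v then 1 else 0
  refine Eq.trans ?_ h.symm
  rw [← Finset.card_filter, BenderKnuth.num]
  refine Finset.card_bij (fun j _ => (r, j)) (fun j hj => ?_) (fun _ _ _ _ h => (Prod.mk.inj h).2) ?_
  · rw [Finset.mem_filter, Finset.mem_range] at hj
    exact Finset.mem_filter.2
      ⟨(YoungDiagram.mem_cells _).2 (YoungDiagram.mem_iff_lt_rowLen.2 hj.1), rfl, hj.2⟩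
  · rintro ⟨i, j⟩ hc
    obtain ⟨hm, rfl, hv⟩ := Finset.mem_filter.1 hc
    exact ⟨j, Finset.mem_filter.2 ⟨Finset.mem_range.2
      (YoungDiagram.mem_iff_lt_rowLen.1 ((YoungDiagram.mem_cells _).1 hm)), hv⟩, rfl⟩

/-- Rows increase weakly, so a tableau is recovered from its thresholds `num`, and the leading
monomial determines these. -/
theorem leadingMon_toFilling_injective :
    Function.Injective fun T : BoundedTableau mu n => leadingMon (toFilling T) := by
  intro T T' h
  refine Subtype.ext (SemistandardYoungTableau.ext fun i j => ?_)
  by_cases hc : (i, j) ∈ mu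
  · have hj := YoungDiagram.mem_iff_lt_rowLen.1 hc
    have hv : ∀ v, T.1 i j < v ↔ T'.1 i j < v := fun v => by
      rw [BenderKnuth.lt_num_iff T.1 hj, BenderKnuth.lt_num_iff T'.1 hj,
        num_eq_weight_leadingMon, num_eq_weight_leadingMon]
      exact iff_of_eq (congrArg (fun e => j < Finsupp.weight _ e) h)
    exact le_antisymm (Nat.lt_succ_iff.1 ((hv _).2 (Nat.lt_succ_self _)))
      (Nat.lt_succ_iff.1 ((hv _).1 (Nat.lt_succ_self _)))
  · rw [T.1.zeros hc, T'.1.zeros hc]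

instance finite_boundedTableau : Finite (BoundedTableau mu n) :=
  Finite.of_injective (β := Filling mu n) toFilling
    (Function.Injective.of_comp (f := leadingMon) leadingMon_toFilling_injective)

instance fintypeBoundedTableau : Fintype (BoundedTableau mu n) := Fintype.ofFinite _

theorem span_minorProd_toFilling :
    Submodule.span ℂ (Set.range fun T : BoundedTableau mu n => minorProd mu (toFilling T)) =
      weylModule n mu := by
  refine le_antisymm (Submodule.span_mono ?_) (Submodule.span_le.2 ?_)
  · rintro _ ⟨T, rfl⟩
    exact ⟨toFilling T, rfl⟩
  · rintro _ ⟨T, rfl⟩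
    refine Submodule.span_mono ?_ (minorProd_mem_span_standard T)
    rintro _ ⟨T, hT, rfl⟩
    obtain ⟨T', rfl⟩ := exists_toFilling hT
    exact ⟨T', rfl⟩

/-- The semistandard basis of `V^λ`. -/
def tableauBasis (mu : YoungDiagram) (n : ℕ) :
    Module.Basis (BoundedTableau mu n) ℂ (weylModule n mu) :=
  (Module.Basis.span (linearIndependent_of_isLeading isLeading_minorProd
    leadingMon_toFilling_injective)).map (LinearEquiv.ofEq _ _ span_minorProd_toFilling)

theorem coe_tableauBasis (T : BoundedTableau mu n) :
    (tableauBasis mu n T : MvPolynomial (ℕ × Fin n) ℂ) = minorProd mu (toFilling T) := by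
  rw [tableauBasis, Module.Basis.map_apply, LinearEquiv.coe_ofEq_apply]
  exact Module.Basis.coe_span_apply _ _

/-! ### Diagonal matrices, weights and Schur polynomials. -/

variable {D : Matrix.GeneralLinearGroup (Fin n) ℂ} {x : Fin n → ℂ}

theorem polyRep_diagonal_minor (hD : D.val = Matrix.diagonal x) {p : ℕ} (c : Fin p → Fin n) :
    polyRep n D (minor c) = (∏ b, x (c b)) • minor c := by
  rw [polyRep_minor, Finset.sum_eq_single c]
  · simp [hD]
  · intro d _ hd
    obtain ⟨b, hb⟩ := Function.ne_iff.1 hd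
    rw [Finset.prod_eq_zero (Finset.mem_univ b), zero_smul]
    rw [hD, Matrix.diagonal_apply_ne _ hb]
  · simp

theorem polyRep_diagonal_minorProd (hD : D.val = Matrix.diagonal x) (T : Filling mu n) :
    polyRep n D (minorProd mu T) =
      (∏ j : Fin (mu.rowLen 0), ∏ b, x (T j b)) • minorProd mu T := by
  have hprod : polyRep n D (minorProd mu T) = ∏ j, polyRep n D (minor (T j)) :=
    map_prod (MvPolynomial.aeval fun q : ℕ × Fin n =>
      ∑ d, (D.val d q.2) • (MvPolynomial.X (q.1, d) : MvPolynomial (ℕ × Fin n) ℂ)) _ _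
  rw [hprod]
  simp only [polyRep_diagonal_minor hD]
  rw [Finset.prod_smul]
  rfl

theorem trace_eq_sum_of_eigenbasis {ι V : Type*} [Fintype ι] [AddCommGroup V] [Module ℂ V]
    (b : Module.Basis ι ℂ V) (f : V →ₗ[ℂ] V) (c : ι → ℂ) (h : ∀ i, f (b i) = c i • b i) :
    LinearMap.trace ℂ V f = ∑ i, c i := by
  classical
  rw [LinearMap.trace_eq_matrix_trace ℂ b, Matrix.trace]
  refine Finset.sum_congr rfl fun i _ => ?_
  rw [Matrix.diag_apply, LinearMap.toMatrix_apply, h, map_smul, Module.Basis.repr_self]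
  simp

/-- The semistandard basis consists of weight vectors: a diagonal matrix multiplies a product of
minors by the monomial of its filling. -/
theorem character_weylRep_diagonal (hD : D.val = Matrix.diagonal x) (lam : Par) :
    (weylRep n lam).character D = ∑ T : BoundedTableau lam.diagram n,
      ∏ j : Fin (lam.diagram.rowLen 0), ∏ b, x (toFilling T j b) := by
  refine trace_eq_sum_of_eigenbasis (tableauBasis lam.diagram n) _ _ fun T => Subtype.ext ?_
  change polyRep n D (tableauBasis lam.diagram n T : MvPolynomial (ℕ × Fin n) ℂ) =
    _ • (tableauBasis lam.diagram n T : MvPolynomial (ℕ × Fin n) ℂ)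
  rw [coe_tableauBasis, polyRep_diagonal_minorProd hD]

/-- The exponent of the monomial attached to a filling. -/
def fillingContent (T : Filling mu n) : Fin n →₀ ℕ :=
  ∑ j : Fin (mu.rowLen 0), ∑ b, Finsupp.single (T j b) 1

theorem embDomain_fillingContent (T : BoundedTableau mu n) :
    (fillingContent (toFilling T)).embDomain Fin.valEmbedding = content T.1 := by
  rw [content, ← sum_columns (mu := mu) fun c => Finsupp.single (T.1 c.1 c.2) 1, fillingContent,
    Finsupp.embDomain_eq_mapDomain, Finsupp.mapDomain_finsetSum]
  refine Finset.sum_congr rfl fun j _ => ?_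
  rw [Finsupp.mapDomain_finsetSum]
  exact Finset.sum_congr rfl fun b _ => Finsupp.mapDomain_single

theorem prod_pow_fillingContent (T : Filling mu n) (x : Fin n → ℂ) :
    ∏ i, x i ^ fillingContent T i = ∏ j : Fin (mu.rowLen 0), ∏ b, x (T j b) := by
  classical
  simp only [fillingContent, Finsupp.coe_finsetSum, Finset.sum_apply,
    ← Finset.prod_pow_eq_pow_sum]
  rw [Finset.prod_comm]
  refine Finset.prod_congr rfl fun j _ => ?_
  rw [Finset.prod_comm]
  refine Finset.prod_congr rfl fun b _ => ?_
  rw [Finset.prod_eq_single (T j b)]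
  · simp
  · intro i _ hi
    rw [Finsupp.single_eq_of_ne hi, pow_zero]
  · simp

theorem lt_of_content_eq_embDomain {T : SemistandardYoungTableau mu} {a : Fin n →₀ ℕ}
    (h : content T = a.embDomain Fin.valEmbedding) {i j : ℕ} (hc : (i, j) ∈ mu) : T i j < n := by
  by_contra hlt
  have h0 : content T (T i j) = 0 := by
    rw [h]
    refine Finsupp.embDomain_of_notMem_range _ _ _ ?_
    rintro ⟨k, hk⟩
    exact hlt (hk ▸ k.2)
  rw [content, Finsupp.finsetSum_apply, Finset.sum_eq_zero_iff] at h0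
  simpa using h0 (i, j) ((YoungDiagram.mem_cells _).2 hc)

/-- Setting the variables from `x_n` on to zero leaves exactly the tableaux with entries below `n`;
grouping these by content gives the coefficients of the Schur series. -/
theorem evalFin_schur (lam : Par) (x : Fin n → ℂ) :
    evalFin (schur lam) x = ∑ T : BoundedTableau lam.diagram n,
      ∏ j : Fin (lam.diagram.rowLen 0), ∏ b, x (toFilling T j b) := by
  classical
  have hcoeff : ∀ a : Fin n →₀ ℕ, MvPowerSeries.coeff (a.embDomain Fin.valEmbedding)
      (schur lam : MvPowerSeries ℕ ℂ) = ((Finset.univ.filter fun T : BoundedTableau lam.diagram n =>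
        fillingContent (toFilling T) = a).card : ℂ) := by
    intro a
    change ((Nat.card _ : ℕ) : ℂ) = _
    rw [← Fintype.card_subtype, ← Nat.card_eq_fintype_card]
    congr 1
    have hiff : ∀ T : BoundedTableau lam.diagram n, fillingContent (toFilling T) = a ↔
        content T.1 = a.embDomain Fin.valEmbedding := fun T => by
      rw [← embDomain_fillingContent, (Finsupp.embDomain_injective _).eq_iff]
    exact Nat.card_congr
      { toFun := fun T => ⟨⟨T.1, fun i j hc => lt_of_content_eq_embDomain T.2 hc⟩,
          (hiff _).2 T.2⟩
        invFun := fun T => ⟨T.1.1, (hiff _).1 T.2⟩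
        left_inv := fun _ => rfl
        right_inv := fun _ => rfl }
  rw [evalFin, finsum_eq_sum_of_support_subset (s := Finset.univ.image
    fun T : BoundedTableau lam.diagram n => fillingContent (toFilling T))]
  · rw [← Finset.sum_fiberwise_of_maps_to (t := Finset.univ.image
      fun T : BoundedTableau lam.diagram n => fillingContent (toFilling T))
      (g := fun T => fillingContent (toFilling T))
      fun T _ => Finset.mem_image_of_mem _ (Finset.mem_univ T)]
    refine Finset.sum_congr rfl fun a _ => ?_
    rw [hcoeff, ← nsmul_eq_mul, ← Finset.sum_const]
    refine Finset.sum_congr rfl fun T hT => ?_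
    rw [← prod_pow_fillingContent, (Finset.mem_filter.1 hT).2]
  · intro a ha
    rw [Function.mem_support, hcoeff] at ha
    have h := left_ne_zero_of_mul ha
    rw [Nat.cast_ne_zero, Finset.card_ne_zero] at h
    obtain ⟨T, hT⟩ := h
    exact Finset.mem_coe.2 (Finset.mem_image.2 ⟨T, Finset.mem_univ T, (Finset.mem_filter.1 hT).2⟩)

/-- A character of `GL_n` is invariant under conjugation, so `γ` may be replaced by a diagonal
matrix `diag(x)`. There the value is `s_λ(x)`, and the power sums of `x` are the traces of the
powers of `γ`. -/
theorem character_resWeylRep {m : ℕ} [NeZero m] (lam : Par) {γ : WreathGroup m n} {ρ : Phi m}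
    (h : γ ∈ conjClass n ρ) :
    (resWeylRep m n lam).character γ = evalPower (eigenPowerSum ρ) (schur lam) := by
  obtain ⟨g, D, x, hD, hg⟩ := exists_conj_diagonal_toGL γ
  have h1 : (resWeylRep m n lam).character γ = (weylRep n lam).character D := by
    rw [← Representation.char_conj _ D g, ← hg]
    rfl
  rw [h1, character_weylRep_diagonal hD, ← evalFin_schur, evalFin_eq]
  refine LinearMap.congr_fun (evalPower_congr fun r _ => ?_) _
  rw [← trace_pow_of_mem_conjClass h, map_pow]
  exact (trace_pow_conj_diagonal hD hg r).symm

theorem homogeneousComponent_F_eq_frobeniusChar {m : ℕ} [NeZero m] (lam : Par) (n : ℕ) :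
    MvPowerSeries.homogeneousComponent n (F m lam) = frobeniusChar (resWeylRep m n lam) := by
  have hterm : ∀ ρ : Phi m, ρ.size = n → FTerm lam ρ =
      ((resWeylRep m n lam).character (classRep n ρ) / (ρ.Z : ℂ)) • P ρ := by
    rintro ρ rfl
    rw [FTerm, evalMultiset_Xi, character_resWeylRep lam (classRep_mem ρ)]
  have hfin := Fintype.ofFinite {ρ : Phi m // ρ.size = n}
  rw [homogeneousComponent_F, frobeniusChar, finsum_eq_sum_of_fintype,
    ← Finset.sum_subtype (phiOf m n) (fun ρ => mem_phiOf)
      fun ρ => ((resWeylRep m n lam).character (classRep n ρ) / (ρ.Z : ℂ)) • P ρ]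
  exact Finset.sum_congr rfl fun ρ hρ => hterm ρ (mem_phiOf.1 hρ)

end Character

end WreathSym

end

/-! ### The proposition, assembled from its parts. -/

theorem mainTheorem2 (m : ℕ) [NeZero m] (lam : WreathSym.Par) :
    -- `Ξ_ρ` is well defined: `C_ρ` is nonempty, and all of its elements have eigenvalues `Ξ_ρ`
    (∀ ρ : WreathSym.Phi m, (WreathSym.conjClass ρ.size ρ).Nonempty ∧
      ∀ γ ∈ WreathSym.conjClass ρ.size ρ,
        (WreathSym.toMatrix γ).charpoly.roots = WreathSym.Xi ρ) ∧
    -- the series defining `F_λ` and `Ω((1/m) ∑_ζ X_ζ Ω(Y; ζ))` converge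
    Summable (fun ρ : WreathSym.Phi m => WreathSym.FTerm lam ρ) ∧
    Summable (fun n : ℕ =>
      WreathSym.plethysm (WreathSym.kernelAlphabet m) (WreathSym.hSym n)) ∧
    -- the formula for `F_λ`; the kernel is symmetric in `Y`, so that the pairing makes sense
    (∃ hK : WreathSym.IsSymmY (WreathSym.plethysticExp (WreathSym.kernelAlphabet m)),
      WreathSym.F m lam =
        WreathSym.pairingY (WreathSym.plethysticExp (WreathSym.kernelAlphabet m)) hK
          (WreathSym.schur lam)) ∧
    -- the component of degree `n` is the Frobenius characteristic of the restriction of `V^λ`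
    (∀ n : ℕ, lam.length ≤ n →
      MvPowerSeries.homogeneousComponent n (WreathSym.F m lam) =
        WreathSym.frobeniusChar (WreathSym.resWeylRep m n lam)) :=
  ⟨fun ρ => ⟨WreathSym.conjClass_nonempty ρ, fun _ h => WreathSym.roots_eq_Xi ρ h⟩,
    WreathSym.summable_FTerm lam, WreathSym.summable_kernel,
    ⟨WreathSym.isSymmY_kernel, WreathSym.F_eq_pairingY lam⟩,
    fun n _ => WreathSym.homogeneousComponent_F_eq_frobeniusChar lam n⟩
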